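/- Let $K\ge 2$ and let $p_1,\dots,p_K$ be probability mass functions (arms) on discrete alphabets $\mathcal X_1,\dots,\mathcal X_K$. The arms are memoryless sources: at each round $t=1,2,\dots$ the player picks an arm $I(t)\in[K]$, on the basis of the past, and observes a symbol $X_{I(t)}(t)$ of law $p_{I(t)}$ that is independent of the past. Write $H(p)=-\sum_x p(x)\log p(x)$, $H_i=H(p_i)$, $\Delta_i=\max_j H_j-H_i$, $S_i=|\{x:p_i(x)>0\}|$, $N_i(t)$ for the number of rounds $\tau\le t$ with $I(\tau)=i$, and let $$R(t)=t\max_jH_j-\sum_{i}\mathbb E[N_i(t)]\,H_i$$ be the expected pseudo-regret. Let $\kappa_i\ge1$ be known numbers such that $p_i(x)\ge 1/\kappa_i$ whenever $p_i(x)>0$ (so that $S_i\le\kappa_i$), for every $i\in[K]$. For a sequence $Y=(Y_1,\dots,Y_n)$ of $n\ge1$ samples let $H(\hat p(Y))$ be the entropy of its empirical distribution $\hat p(Y)$ and $\hat S(Y)$ the number of distinct symbols in it, and for $\delta\in(0,1)$ and $\kappa\ge 1$ set $$\mathrm{UCD}_{\mathrm{SE}}(Y,\delta,n;\kappa)=\log\left(1+\frac1n\left[\frac{\hat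 S(Y)+\sqrt{\tfrac12\log\tfrac1\delta}}{1-e^{-n/\kappa}}-1\right]\right)+\sqrt{\frac{2\log^2 n}{n}\log\frac2\delta}.$$ Let $\alpha>2$. Suppose that the player runs the UCB algorithm with the plug-in entropy estimator and this deviation: at every round $t$ it plays an arm $i$ that maximizes $$H(\hat p(Y_i))+\mathrm{UCD}_{\mathrm{SE}}\big(Y_i,t^{-\alpha},N_i(t-1);\kappa_i\big),$$ where $Y_i$ is the sequence of the $N_i(t-1)$ symbols observed from arm $i$ before round $t$; the bound of an arm that was not played yet is $+\infty$, and ties are broken arbitrarily. Then for every $\beta\in(0,1)$ and every $t\ge1$, $$R(t)\le\sum_{i:\Delta_i>0}\left[\Gamma_{\mathrm{SE}}(\alpha,\beta,S_i,\kappa_i,\Delta_i,t)\,\Delta_i+\frac{4(\alpha-1)}{\alpha-2}\,\Delta_i\right],$$ where, with $\Lambda_2(s)=s\log^2 s$ (and $\Lambda_2(0)=0$), $$\Gamma_{\mathrm{SE}}(\alpha,\beta,S,\kappa,\Delta,t)=\max\left\{\frac{2\sqrt\kappa\left(\sqrt S+(\alpha\log(t)/2)^{1/4}\right)}{\min\left\{e^{\beta\Delta/2}-1,\sqrt{e^{\beta\Delta/2}-1}\right\}},\;15\,\Lambda_2\!\left(\frac{8\log(2t^\alpha)}{(1-\beta)^2\Delta^2}\right)\right\}.$$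 -/

import Mathlib

open MeasureTheory ProbabilityTheory

noncomputable section

namespace EntropyBandit

/-! ### Entropy, support and the plug-in estimators -/

/-- Shannon entropy (in nats) of a family of probabilities, `H(f) = -∑ y, f y * log (f y)`,
with the convention `0 * log 0 = 0`. -/
def entropy {𝒴 : Type*} (f : 𝒴 → ℝ) : ℝ := ∑' y, Real.negMulLog (f y)

/-- The entropy `H(p)` of a probability mass function. -/
def pmfEntropy {𝒴 : Type*} (p : PMF 𝒴) : ℝ := entropy fun y => (p y).toReal

/-- The support size `S(p)`, the number of symbols of positive probability. -/
def supportSize {𝒴 : Type*} (p : PMF 𝒴) : ℕ := p.support.ncard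

open Classical in
/-- The empirical distribution of a finite sequence of samples: `y ↦ #{ℓ | Y ℓ = y} / n`. -/
def empirical {𝒴 : Type*} (Y : List 𝒴) (y : 𝒴) : ℝ := (Y.count y : ℝ) / (Y.length : ℝ)

/-- The plug-in entropy estimator: the entropy of the empirical distribution. -/
def plugInEntropy {𝒴 : Type*} (Y : List 𝒴) : ℝ := entropy (empirical Y)

open Classical in
/-- The plug-in support size estimator: the number of distinct symbols among the samples. -/
def supportEstimate {𝒴 : Type*} (Y : List 𝒴) : ℕ := Y.toFinset.card

/-! ### The upper confidence deviation with support estimation -/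

/-- The bias correction with support estimation `B_SE(Y, δ, n)`, where `n` is the length of `Y`
(meaningful for `1 ≤ n`). -/
def biasSE {𝒴 : Type*} (κ : ℝ) (Y : List 𝒴) (δ : ℝ) : ℝ :=
  Real.log (1 + 1 / (Y.length : ℝ) *
    (((supportEstimate Y : ℝ) + √(1 / 2 * Real.log (1 / δ))) *
      (1 - Real.exp (-((Y.length : ℝ) / κ)))⁻¹ - 1))

/-- The upper confidence deviation with support estimation `UCD_SE(Y, δ, n)`. -/
def ucdSE {𝒴 : Type*} (κ : ℝ) (Y : List 𝒴) (δ : ℝ) : ℝ :=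
  biasSE κ Y δ +
    √(2 * Real.log (Y.length : ℝ) ^ 2 / (Y.length : ℝ) * Real.log (2 / δ))

/-! ### The bandit and the UCB algorithm -/

variable {K : ℕ} {𝒳 : Fin K → Type*} {Ω : Type*}

/-- The gap `Δ i = max_j H(p j) - H(p i)` of an arm. -/
def gap (p : ∀ i, PMF (𝒳 i)) (i : Fin K) : ℝ := (⨆ j, pmfEntropy (p j)) - pmfEntropy (p i)

/-- `X i t` is the symbol that source `i` emits at round `t` (rounds are `1, 2, …`), and `ℱ t` is
the information available after round `t`. The sources are memoryless with laws `p i`: every symbol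
`X i (t + 1)` has law `p i` and is independent of everything that happened up to round `t`.
(`ℱ` may contain further randomness, for instance that of a randomized tie-breaking.) -/
structure IsMemoryless [∀ i, MeasurableSpace (𝒳 i)] {mΩ : MeasurableSpace Ω} (μ : Measure Ω)
    (ℱ : Filtration ℕ mΩ) (p : ∀ i, PMF (𝒳 i)) (X : ∀ i, ℕ → Ω → 𝒳 i) : Prop where
  measurable_symbol : ∀ i t, Measurable[ℱ (t + 1)] (X i (t + 1))
  law_symbol : ∀ i t x, μ {ω | X i (t + 1) ω = x} = p i x
  indep_past : ∀ i t, Indep (MeasurableSpace.comap (X i (t + 1)) inferInstance) (ℱ t) μ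

/-- The sequence of the symbols observed from arm `i` up to round `t`, when arm `I τ` is played at
every round `τ`. -/
def samples (X : ∀ i, ℕ → Ω → 𝒳 i) (I : ℕ → Ω → Fin K) (i : Fin K) : ℕ → Ω → List (𝒳 i)
  | 0, _ => []
  | t + 1, ω =>
    if I (t + 1) ω = i then samples X I i t ω ++ [X i (t + 1) ω] else samples X I i t ω

/-- `N_i(t)`, the number of rounds among `1, …, t` in which arm `i` is played. -/
def playCount (I : ℕ → Ω → Fin K) (i : Fin K) (t : ℕ) (ω : Ω) : ℕ :=
  ((Finset.Icc 1 t).filter fun τ => I τ ω = i).card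

/-- The upper confidence bound of an arm with samples `Y`: estimator plus deviation, and `+∞` for an
arm that was not sampled yet. -/
def ucbIndex {𝒴 : Type*} (Hhat : List 𝒴 → ℝ) (UCD : List 𝒴 → ℝ → ℝ) (Y : List 𝒴) (δ : ℝ) : EReal :=
  if Y.length = 0 then ⊤ else ((Hhat Y + UCD Y δ : ℝ) : EReal)

/-- `I` is a run of the UCB algorithm: the arm played at round `t + 1` is decided from the
information available after round `t`, and it maximizes the upper confidence bound with confidence
parameter `δ (t + 1)` computed from the samples observed up to round `t` (ties are broken
arbitrarily). -/
structure IsUCBRun {mΩ : MeasurableSpace Ω} (ℱ : Filtration ℕ mΩ) (X : ∀ i, ℕ → Ω → 𝒳 i)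
    (Hhat : ∀ i, List (𝒳 i) → ℝ) (UCD : ∀ i, List (𝒳 i) → ℝ → ℝ) (δ : ℕ → ℝ)
    (I : ℕ → Ω → Fin K) : Prop where
  measurable_play : ∀ t, Measurable[ℱ t] (I (t + 1))
  maximizes : ∀ t ω j,
    ucbIndex (Hhat j) (UCD j) (samples X I j t ω) (δ (t + 1)) ≤
      ucbIndex (Hhat (I (t + 1) ω)) (UCD (I (t + 1) ω)) (samples X I (I (t + 1) ω) t ω) (δ (t + 1))

/-- The expected pseudo-regret `R(t) = t * max_j H(p j) - ∑ i, E[N_i(t)] * H(p i)`. -/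
def pseudoRegret {mΩ : MeasurableSpace Ω} (μ : Measure Ω) (p : ∀ i, PMF (𝒳 i))
    (I : ℕ → Ω → Fin K) (t : ℕ) : ℝ :=
  (t : ℝ) * (⨆ j, pmfEntropy (p j)) -
    ∑ i, (∫ ω, (playCount I i t ω : ℝ) ∂μ) * pmfEntropy (p i)

/-! ### The quantity in the regret bound -/

/-- `Λ_k(s) = s * log^k s`. -/
def polylog (k : ℕ) (s : ℝ) : ℝ := s * Real.log s ^ k

/-- The number of samples `Γ_SE(α, β, S, κ, Δ, t)`. -/
def gammaSE (α β S κ Δ t : ℝ) : ℝ :=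
  max
    (2 * √κ * (√S + (α * Real.log t / 2) ^ (1 / 4 : ℝ)) /
      min (Real.exp (β * Δ / 2) - 1) (√(Real.exp (β * Δ / 2) - 1)))
    (15 * polylog 2 (8 * Real.log (2 * t ^ α) / ((1 - β) ^ 2 * Δ ^ 2)))

end EntropyBandit

end

/-! Write the confidence parameter as δ = exp (-2 s²). The bias correction then replaces the support
size by (Ŝ + s) / (1 - e^(-n/κ)). Bounded differences only give Ŝ ≥ E Ŝ - s √n, so the correction
alone need not cover the bias of the plug-in entropy. The bound holds because of slack elsewhere:
replacing one sample moves the plug-in entropy by at most (log n + 1) / n, whereas the algorithm's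
width is computed with 2 log n / n. For n ≥ 3 the difference of the two widths, `devGap`, is at
least s (log n - 1) / √n, and the core of the proof is that this pays for the missing √n.

The frame is the usual UCB argument. Once a suboptimal arm has been played Γ times, its total width
is below its gap (`upperWidth_lt`). A further play then requires that the index of an optimal arm
lies below its entropy, or that the plug-in entropy of the suboptimal arm is far too large. The
samples of an arm have a given prefix with probability at most that of independent samples
(`measure_prefix_le`). A union bound over the number n of samples therefore leaves two estimates for
independent lists, both resting on McDiarmid's inequality: `iidProb_gt_le` and the hard one,
`iidProb_lt_le`.

For the latter, the bias is at most ∑ p log (1 + 1 / (n p)), which is compared with log (1 + S / n),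
with log (1 + κ / n), and with μ = ∑ (1 - e^(-n p)) ≤ E Ŝ. Three regimes appear in
`BiasBounds.le_of_conditions`. If s is comparable to √n, the gap exceeds log (n / (1 + s)) and no
estimate of the support is needed. If n / κ is bounded below, so that the inverse factor is bounded,
two logarithms are compared directly. If n / κ is small, the bias bound is linear and the correction
concave in Ŝ, so two end points suffice. Lists with a single symbol are treated apart: either they
are rare, or one atom is so heavy that the entropy is small. Throughout s² ≥ log (n + 1), because α
> 2 and n is less than the round.

McDiarmid's width is taken at failure probability c δ, with larger c for some small n where the
slack is short. The failure probabilities, plus 1/2 for the upper tail, sum over n ≤ m to 4 (m + 1)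
plus a bounded excess. Weighted by (m + 1)^(-α) this gives 4 / (α - 2) + 3; rounding Γ up costs 1
more, in total 4 (α - 1) / (α - 2). -/

namespace EntropyBandit

/-! ### Expectations over finite sequences of independent samples -/

/-- The expectation of `F` over lists of `n` independent samples with weights `p` on `T`. -/
noncomputable def iidMean {𝒴 : Type*} (T : Finset 𝒴) (p : 𝒴 → ℝ) : ℕ → (List 𝒴 → ℝ) → ℝ
  | 0, F => F []
  | n + 1, F => ∑ x ∈ T, p x * iidMean T p n fun l => F (x :: l)

/-- `p` is a family of nonnegative weights on `T` of total mass one. -/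
structure IsWeight {𝒴 : Type*} (T : Finset 𝒴) (p : 𝒴 → ℝ) : Prop where
  nonneg : ∀ x ∈ T, 0 ≤ p x
  sum_eq_one : ∑ x ∈ T, p x = 1

section iidMean

variable {𝒴 : Type*} {T : Finset 𝒴} {p : 𝒴 → ℝ}

theorem iidMean_congr {n : ℕ} {F G : List 𝒴 → ℝ}
    (h : ∀ l : List 𝒴, l.length = n → (∀ x ∈ l, x ∈ T) → F l = G l) :
    iidMean T p n F = iidMean T p n G := by
  induction n generalizing F G with
  | zero => exact h [] rfl (by simp)
  | succ n ih =>
    refine Finset.sum_congr rfl fun x hx => ?_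
    rw [ih fun l hl hlT => h (x :: l) (by simp [hl]) (by simpa [hx] using hlT)]

theorem iidMean_mono (hp : IsWeight T p) {n : ℕ} {F G : List 𝒴 → ℝ}
    (h : ∀ l : List 𝒴, l.length = n → (∀ x ∈ l, x ∈ T) → F l ≤ G l) :
    iidMean T p n F ≤ iidMean T p n G := by
  induction n generalizing F G with
  | zero => exact h [] rfl (by simp)
  | succ n ih =>
    refine Finset.sum_le_sum fun x hx => mul_le_mul_of_nonneg_left ?_ (hp.nonneg x hx)
    exact ih fun l hl hlT => h (x :: l) (by simp [hl]) (by simpa [hx] using hlT)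

theorem iidMean_add (n : ℕ) (F G : List 𝒴 → ℝ) :
    iidMean T p n (fun l => F l + G l) = iidMean T p n F + iidMean T p n G := by
  induction n generalizing F G with
  | zero => rfl
  | succ n ih => simp only [iidMean, ih, mul_add, Finset.sum_add_distrib]

theorem iidMean_const_mul (n : ℕ) (c : ℝ) (F : List 𝒴 → ℝ) :
    iidMean T p n (fun l => c * F l) = c * iidMean T p n F := by
  induction n generalizing F with
  | zero => rfl
  | succ n ih =>
    simp only [iidMean, ih, Finset.mul_sum]
    exact Finset.sum_congr rfl fun x _ => by ring

theorem iidMean_neg (n : ℕ) (F : List 𝒴 → ℝ) :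
    iidMean T p n (fun l => -F l) = -iidMean T p n F := by
  have := iidMean_const_mul (T := T) (p := p) n (-1) F
  simpa using this

theorem iidMean_sub (n : ℕ) (F G : List 𝒴 → ℝ) :
    iidMean T p n (fun l => F l - G l) = iidMean T p n F - iidMean T p n G := by
  simp only [sub_eq_add_neg]
  rw [iidMean_add, iidMean_neg]

theorem iidMean_const (hp : IsWeight T p) (n : ℕ) (c : ℝ) :
    iidMean T p n (fun _ => c) = c := by
  induction n with
  | zero => rfl
  | succ n ih => simp only [iidMean, ih, ← Finset.sum_mul, hp.sum_eq_one, one_mul]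

theorem iidMean_sum {ι : Type*} (n : ℕ) (s : Finset ι) (F : ι → List 𝒴 → ℝ) :
    iidMean T p n (fun l => ∑ i ∈ s, F i l) = ∑ i ∈ s, iidMean T p n (F i) := by
  induction n generalizing F with
  | zero => rfl
  | succ n ih =>
    simp only [iidMean, ih, Finset.mul_sum]
    exact Finset.sum_comm

open Classical in
/-- The probability that `n` independent samples lie in the set `B`. -/
noncomputable def iidProb (T : Finset 𝒴) (p : 𝒴 → ℝ) (n : ℕ) (B : List 𝒴 → Prop) : ℝ :=
  iidMean T p n fun l => if B l then 1 else 0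

theorem iidProb_nonneg (hp : IsWeight T p) (n : ℕ) (B : List 𝒴 → Prop) :
    0 ≤ iidProb T p n B := by
  classical
  rw [← iidMean_const hp n 0]
  refine iidMean_mono hp fun l _ _ => ?_
  split_ifs <;> norm_num

theorem iidProb_mono (hp : IsWeight T p) {n : ℕ} {A B : List 𝒴 → Prop}
    (h : ∀ l : List 𝒴, l.length = n → (∀ x ∈ l, x ∈ T) → A l → B l) :
    iidProb T p n A ≤ iidProb T p n B := by
  classical
  refine iidMean_mono hp fun l hl hT => ?_
  by_cases hA : A l
  · simp [hA, h l hl hT hA]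
  · simp only [hA, if_false]; split_ifs <;> norm_num

theorem iidProb_or_le (hp : IsWeight T p) (n : ℕ) (A B : List 𝒴 → Prop) :
    iidProb T p n (fun l => A l ∨ B l) ≤ iidProb T p n A + iidProb T p n B := by
  classical
  rw [iidProb, iidProb, iidProb, ← iidMean_add]
  refine iidMean_mono hp fun l _ _ => ?_
  by_cases hA : A l <;> by_cases hB : B l <;> simp [hA, hB]

theorem iidProb_false (hp : IsWeight T p) {n : ℕ} {B : List 𝒴 → Prop}
    (h : ∀ l : List 𝒴, l.length = n → (∀ x ∈ l, x ∈ T) → ¬ B l) : iidProb T p n B = 0 := by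
  classical
  rw [iidProb, iidMean_congr (G := fun _ => 0), iidMean_const hp]
  intro l hl hT
  simp [h l hl hT]

/-! ### Moments of the counts -/

open Classical in
theorem iidMean_count (hp : IsWeight T p) {x : 𝒴} (hx : x ∈ T) (n : ℕ) :
    iidMean T p n (fun l => (l.count x : ℝ)) = n * p x := by
  induction n with
  | zero => simp [iidMean]
  | succ n ih =>
    have h : ∀ y ∈ T, p y * iidMean T p n (fun l => ((y :: l).count x : ℝ))
        = p y * (n * p x) + (if y = x then p y else 0) := by
      intro y _
      have : (fun l : List 𝒴 => ((y :: l).count x : ℝ))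
          = fun l => (l.count x : ℝ) + (if y = x then (1 : ℝ) else 0) := by
        funext l; rw [List.count_cons]; push_cast; simp
      rw [this, iidMean_add, iidMean_const hp, ih]; split_ifs <;> ring
    rw [iidMean, Finset.sum_congr rfl h, Finset.sum_add_distrib, ← Finset.sum_mul, hp.sum_eq_one,
      Finset.sum_ite_eq' T x, if_pos hx]
    push_cast; ring

open Classical in
theorem iidMean_count_sq (hp : IsWeight T p) {x : 𝒴} (hx : x ∈ T) (n : ℕ) :
    iidMean T p n (fun l => (l.count x : ℝ) ^ 2) = n * p x * (1 - p x) + (n * p x) ^ 2 := by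
  induction n with
  | zero => simp [iidMean]
  | succ n ih =>
    have h : ∀ y ∈ T, p y * iidMean T p n (fun l => ((y :: l).count x : ℝ) ^ 2)
        = p y * (n * p x * (1 - p x) + (n * p x) ^ 2)
          + (if y = x then p y * (2 * (n * p x) + 1) else 0) := by
      intro y _
      have : (fun l : List 𝒴 => ((y :: l).count x : ℝ) ^ 2)
          = fun l => (l.count x : ℝ) ^ 2 + ((if y = x then (2 : ℝ) else 0) * (l.count x : ℝ)
            + (if y = x then (1 : ℝ) else 0)) := by
        funext l; rw [List.count_cons]; push_cast; split_ifs <;> simp_all; ring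
      rw [this, iidMean_add, iidMean_add, iidMean_const_mul, iidMean_const hp, ih,
        iidMean_count hp hx]
      split_ifs <;> ring
    rw [iidMean, Finset.sum_congr rfl h, Finset.sum_add_distrib, ← Finset.sum_mul, hp.sum_eq_one,
      Finset.sum_ite_eq' T x, if_pos hx]
    push_cast; ring

open Classical in
theorem iidMean_mem (hp : IsWeight T p) {x : 𝒴} (hx : x ∈ T) (n : ℕ) :
    iidMean T p n (fun l => if x ∈ l then (1 : ℝ) else 0) = 1 - (1 - p x) ^ n := by
  induction n with
  | zero => simp [iidMean]
  | succ n ih =>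
    have h : ∀ y ∈ T, p y * iidMean T p n (fun l => if x ∈ y :: l then (1 : ℝ) else 0)
        = p y * (1 - (1 - p x) ^ n) + (if y = x then p y * (1 - p x) ^ n else 0) := by
      intro y _
      by_cases hy : y = x
      · subst hy
        simp only [List.mem_cons, true_or, if_true, iidMean_const hp]; ring
      · have : (fun l : List 𝒴 => if x ∈ y :: l then (1 : ℝ) else 0)
            = fun l => if x ∈ l then (1 : ℝ) else 0 := by
          funext l; simp [List.mem_cons, Ne.symm hy]
        rw [this, ih, if_neg hy, add_zero]
    rw [iidMean, Finset.sum_congr rfl h, Finset.sum_add_distrib, ← Finset.sum_mul, hp.sum_eq_one,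
      Finset.sum_ite_eq' T x, if_pos hx]
    ring

/-! ### The bounded differences inequality -/

/-- Hoeffding's lemma for a finitely supported weight. -/
theorem sum_weight_exp_le (hp : IsWeight T p) {G : 𝒴 → ℝ} {c : ℝ} (lam : ℝ)
    (hG : ∀ x ∈ T, ∀ y ∈ T, |G x - G y| ≤ c) :
    ∑ x ∈ T, p x * Real.exp (lam * G x)
      ≤ Real.exp (lam * (∑ x ∈ T, p x * G x) + lam ^ 2 * c ^ 2 / 8) := by
  classical
  have hne : T.Nonempty := by
    by_contra h
    have := hp.sum_eq_one
    rw [Finset.not_nonempty_iff_eq_empty.1 h] at this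
    simp at this
  obtain ⟨x₀, hx₀, hmin⟩ := T.exists_min_image G hne
  have hc : 0 ≤ c := (abs_nonneg _).trans (hG x₀ hx₀ x₀ hx₀)
  -- The weight becomes a sum of Dirac masses on the discrete σ-algebra, so that the
  -- measure-theoretic Hoeffding lemma applies with range [G x₀, G x₀ + c].
  let _ : MeasurableSpace 𝒴 := ⊤
  set μ : Measure 𝒴 := ∑ x ∈ T, ENNReal.ofReal (p x) • Measure.dirac x with hμ
  have hint : ∀ f : 𝒴 → ℝ, ∫ x, f x ∂μ = ∑ x ∈ T, p x * f x := by
    intro f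
    rw [hμ, integral_finsetSum_measure]
    · refine Finset.sum_congr rfl fun x hx => ?_
      rw [integral_smul_measure, integral_dirac, ENNReal.toReal_ofReal (hp.nonneg x hx),
        smul_eq_mul]
    · intro x _
      exact (integrable_dirac (by simp)).smul_measure ENNReal.ofReal_ne_top
  have _ : IsProbabilityMeasure μ := ⟨by
    rw [hμ, Measure.finsetSum_apply]
    simp only [Measure.smul_apply, measure_univ, smul_eq_mul, mul_one]
    rw [← ENNReal.ofReal_sum_of_nonneg hp.nonneg, hp.sum_eq_one, ENNReal.ofReal_one]⟩
  have hae : ∀ᵐ x ∂μ, G x ∈ Set.Icc (G x₀) (G x₀ + c) := by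
    rw [ae_iff, hμ, Measure.finsetSum_apply]
    refine Finset.sum_eq_zero fun x hx => ?_
    have h1 := hmin x hx
    have h2 := (abs_le.1 (hG x hx x₀ hx₀)).2
    rw [Measure.smul_apply, Measure.dirac_apply' _ (by trivial), Set.indicator_of_notMem, smul_zero]
    simp only [Set.mem_ofPred_eq, not_not, Set.mem_Icc]
    exact ⟨h1, by linarith⟩
  have hsub := (hasSubgaussianMGF_of_mem_Icc (μ := μ) (X := G)
    (measurable_from_top.aemeasurable) hae).mgf_le lam
  rw [mgf, hint, hint] at hsub
  have hcoef : (((‖G x₀ + c - G x₀‖₊ / 2) ^ 2 : NNReal) : ℝ) * lam ^ 2 / 2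
      = lam ^ 2 * c ^ 2 / 8 := by
    rw [add_sub_cancel_left]
    push_cast
    rw [Real.norm_eq_abs, abs_of_nonneg hc]; ring
  rw [hcoef] at hsub
  set m := ∑ x ∈ T, p x * G x
  calc ∑ x ∈ T, p x * Real.exp (lam * G x)
      = Real.exp (lam * m) * ∑ x ∈ T, p x * Real.exp (lam * (G x - m)) := by
        rw [Finset.mul_sum]
        refine Finset.sum_congr rfl fun x _ => ?_
        rw [show lam * G x = lam * m + lam * (G x - m) by ring, Real.exp_add]; ring
    _ ≤ Real.exp (lam * m) * Real.exp (lam ^ 2 * c ^ 2 / 8) := by gcongr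
    _ = _ := by rw [← Real.exp_add]

/-- `F` changes by at most `c` when one of the `n` samples is replaced. -/
def HasBoundedDiff (n : ℕ) (c : ℝ) (F : List 𝒴 → ℝ) : Prop :=
  ∀ (a b : List 𝒴) (x y : 𝒴), a.length + b.length + 1 = n → |F (a ++ x :: b) - F (a ++ y :: b)| ≤ c

/-- Conditioning on the first sample: the conditional means given its value differ pairwise by at
most `c`, so Hoeffding's lemma contributes one factor exp (λ² c² / 8), and the induction hypothesis
one for each remaining sample. -/
theorem iidMean_exp_le (hp : IsWeight T p) {n : ℕ} {c : ℝ} {F : List 𝒴 → ℝ} (lam : ℝ)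
    (hF : HasBoundedDiff n c F) :
    iidMean T p n (fun l => Real.exp (lam * F l))
      ≤ Real.exp (lam * iidMean T p n F + lam ^ 2 * (n * c ^ 2) / 8) := by
  induction n generalizing F with
  | zero => simp [iidMean]
  | succ n ih =>
    have h1 : ∀ x ∈ T, p x * iidMean T p n (fun l => Real.exp (lam * F (x :: l)))
        ≤ p x * Real.exp (lam * iidMean T p n (fun l => F (x :: l))) *
          Real.exp (lam ^ 2 * (n * c ^ 2) / 8) := by
      intro x hx
      rw [mul_assoc, ← Real.exp_add]
      refine mul_le_mul_of_nonneg_left (ih (F := fun l => F (x :: l)) ?_) (hp.nonneg x hx)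
      intro a b y z hab
      exact hF (x :: a) b y z (by simp; omega)
    have h2 : ∀ x ∈ T, ∀ y ∈ T,
        |iidMean T p n (fun l => F (x :: l)) - iidMean T p n (fun l => F (y :: l))| ≤ c := by
      intro x _ y _
      rw [← iidMean_sub, abs_le, ← iidMean_const hp n c, ← iidMean_neg]
      have h3 : ∀ l : List 𝒴, l.length = n → |F (x :: l) - F (y :: l)| ≤ c := fun l hl =>
        hF [] l x y (by simp [hl])
      exact ⟨iidMean_mono hp fun l hl _ => (abs_le.1 (h3 l hl)).1,
        iidMean_mono hp fun l hl _ => (abs_le.1 (h3 l hl)).2⟩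
    calc iidMean T p (n + 1) (fun l => Real.exp (lam * F l))
        ≤ (∑ x ∈ T, p x * Real.exp (lam * iidMean T p n (fun l => F (x :: l)))) *
          Real.exp (lam ^ 2 * (n * c ^ 2) / 8) := by
          rw [Finset.sum_mul]; exact Finset.sum_le_sum h1
      _ ≤ Real.exp (lam * (∑ x ∈ T, p x * iidMean T p n (fun l => F (x :: l)))
            + lam ^ 2 * c ^ 2 / 8) * Real.exp (lam ^ 2 * (n * c ^ 2) / 8) := by
          gcongr
          exact sum_weight_exp_le hp lam h2
      _ = _ := by
          rw [← Real.exp_add, iidMean]; congr 1; push_cast; ring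

/-- McDiarmid's inequality, upper tail. -/
theorem iidProb_ge_le (hp : IsWeight T p) {n : ℕ} {c e : ℝ} {F : List 𝒴 → ℝ} (hn : 0 < n)
    (hc : 0 < c) (he : 0 ≤ e) (hF : HasBoundedDiff n c F) :
    iidProb T p n (fun l => iidMean T p n F + e ≤ F l) ≤ Real.exp (-(2 * e ^ 2 / (n * c ^ 2))) := by
  classical
  set m := iidMean T p n F
  have hn' : (0 : ℝ) < n := by exact_mod_cast hn
  -- The minimizer of the Chernoff exponent -λ e + λ² n c² / 8.
  set lam := 4 * e / (n * c ^ 2) with hlam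
  have hl : 0 ≤ lam := by positivity
  calc iidProb T p n (fun l => m + e ≤ F l)
      ≤ iidMean T p n (fun l => Real.exp (-(lam * (m + e))) * Real.exp (lam * F l)) := by
        refine iidMean_mono hp fun l _ _ => ?_
        rw [← Real.exp_add]
        split_ifs with h
        · rw [Real.one_le_exp_iff]; nlinarith
        · positivity
    _ ≤ Real.exp (-(lam * (m + e))) * Real.exp (lam * m + lam ^ 2 * (n * c ^ 2) / 8) := by
        rw [iidMean_const_mul]
        gcongr
        exact iidMean_exp_le hp lam hF
    _ = _ := by
        rw [← Real.exp_add]; congr 1; rw [hlam]; field_simp; ring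

/-- McDiarmid's inequality, lower tail. -/
theorem iidProb_le_le (hp : IsWeight T p) {n : ℕ} {c e : ℝ} {F : List 𝒴 → ℝ} (hn : 0 < n)
    (hc : 0 < c) (he : 0 ≤ e) (hF : HasBoundedDiff n c F) :
    iidProb T p n (fun l => F l ≤ iidMean T p n F - e) ≤ Real.exp (-(2 * e ^ 2 / (n * c ^ 2))) := by
  have h := iidProb_ge_le (F := fun l => -F l) hp hn hc he (by
    intro a b x y hab
    rw [show -F (a ++ x :: b) - -F (a ++ y :: b) = -(F (a ++ x :: b) - F (a ++ y :: b)) by ring,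
      abs_neg]
    exact hF a b x y hab)
  refine (iidProb_mono hp fun l _ _ hl => ?_).trans h
  rw [iidMean_neg]; linarith

end iidMean

/-! ### The plug-in entropy estimator -/

theorem one_le_log_three : 1 ≤ Real.log 3 := by
  rw [Real.le_log_iff_exp_le (by norm_num)]
  linarith [Real.exp_one_lt_d9]

theorem log_add_one_mul_sub_nonneg (k : ℕ) :
    0 ≤ ((k : ℝ) + 1) * Real.log (k + 1) - k * Real.log k := by
  rcases Nat.eq_zero_or_pos k with rfl | hk
  · simp
  · have hk' : (1 : ℝ) ≤ k := by exact_mod_cast hk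
    have h1 : Real.log k ≤ Real.log (k + 1) := Real.log_le_log (by linarith) (by linarith)
    have h2 : 0 ≤ Real.log (k + 1) := Real.log_nonneg (by linarith)
    nlinarith

theorem mul_log_ratio_le_one (k : ℕ) : (k : ℝ) * (Real.log (k + 1) - Real.log k) ≤ 1 := by
  rcases Nat.eq_zero_or_pos k with rfl | hk
  · simp
  · have hk' : (0 : ℝ) < k := by exact_mod_cast hk
    rw [← Real.log_div (by positivity) hk'.ne']
    have := Real.log_le_sub_one_of_pos (x := ((k : ℝ) + 1) / k) (by positivity)
    calc (k : ℝ) * Real.log ((k + 1) / k) ≤ k * ((k + 1) / k - 1) := by gcongr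
      _ = 1 := by field_simp; ring

/-- `n` times the amount by which the plug-in entropy of `n` samples may change when one sample is
replaced. -/
noncomputable def plugInDiff (n : ℕ) : ℝ := min (2 * Real.log n) (Real.log n + 1)

theorem plugInDiff_nonneg (n : ℕ) : 0 ≤ plugInDiff n :=
  le_min (by positivity) (by positivity)

theorem plugInDiff_pos {n : ℕ} (hn : 2 ≤ n) : 0 < plugInDiff n := by
  have : 0 < Real.log n := Real.log_pos (by exact_mod_cast hn)
  exact lt_min (by positivity) (by positivity)

/-- The increment of k log k is log (k + 1) + k log (1 + 1 / k), and the last term is at most 1. The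
alternative 2 log n is the smaller one only for n ≤ 2, which is checked by hand. -/
theorem log_add_one_mul_sub_le {k n : ℕ} (h : k + 1 ≤ n) :
    ((k : ℝ) + 1) * Real.log (k + 1) - k * Real.log k ≤ plugInDiff n := by
  have hkn : (k : ℝ) + 1 ≤ n := by exact_mod_cast h
  have hk0 : (0 : ℝ) ≤ k := by positivity
  have h1 : Real.log (k + 1) ≤ Real.log n := Real.log_le_log (by linarith) hkn
  have h2 := mul_log_ratio_le_one k
  refine le_min ?_ (by nlinarith)
  rcases Nat.lt_or_ge 2 n with hn | hn
  · have : Real.log 3 ≤ Real.log n := Real.log_le_log (by norm_num) (by exact_mod_cast hn)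
    nlinarith [one_le_log_three]
  · have hk : k = 0 ∨ k = 1 := by omega
    rcases hk with rfl | rfl
    · simp; positivity
    · have : n = 2 := by omega
      subst this; norm_num

section plugIn

variable {𝒴 : Type*}

open Classical in
theorem plugInEntropy_eq_sum {l : List 𝒴} {U : Finset 𝒴} (h : ∀ x ∈ l, x ∈ U) :
    plugInEntropy l = ∑ x ∈ U, Real.negMulLog ((l.count x : ℝ) / l.length) := by
  rw [plugInEntropy, entropy]
  simp only [empirical]
  refine tsum_eq_sum fun x hx => ?_
  rw [List.count_eq_zero_of_not_mem fun hl => hx (h x hl)]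
  simp

theorem negMulLog_nat_div {n : ℕ} (hn : 0 < n) (k : ℕ) :
    Real.negMulLog ((k : ℝ) / n) = (k * Real.log n - k * Real.log k) / n := by
  have hn' : (n : ℝ) ≠ 0 := by positivity
  rcases Nat.eq_zero_or_pos k with rfl | hk
  · simp
  · have hk' : (k : ℝ) ≠ 0 := by positivity
    rw [Real.negMulLog, Real.log_div hk' hn']
    field_simp; ring

/-- The sum over the other samples, already divided by the full length, does not depend on the
inserted symbol. Replacing a sample thus only exchanges one increment of k log k for another. -/
theorem plugInEntropy_insert {a b : List 𝒴} {n : ℕ} (x : 𝒴) (U : Finset 𝒴)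
    (hU : ∀ z ∈ a ++ b, z ∈ U) (hx : x ∈ U) (hn : a.length + b.length + 1 = n) :
    ∃ k, k + 1 ≤ n ∧ plugInEntropy (a ++ x :: b) =
      (open Classical in ∑ z ∈ U, Real.negMulLog (((a ++ b).count z : ℝ) / n))
        + (Real.log n - (((k : ℝ) + 1) * Real.log (k + 1) - k * Real.log k)) / n := by
  classical
  refine ⟨(a ++ b).count x, ?_, ?_⟩
  · have := List.count_le_length (a := x) (l := a ++ b)
    simp only [List.length_append] at this
    omega
  · have hlen : (a ++ x :: b).length = n := by simp; omega
    have hn0 : 0 < n := by omega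
    rw [plugInEntropy_eq_sum (U := U) (by
      intro z hz
      simp only [List.mem_append, List.mem_cons] at hz
      rcases hz with hz | rfl | hz
      · exact hU z (by simp [hz])
      · exact hx
      · exact hU z (by simp [hz])), hlen]
    have hterm : ∀ z ∈ U, Real.negMulLog (((a ++ x :: b).count z : ℝ) / n)
        = Real.negMulLog (((a ++ b).count z : ℝ) / n)
          + if z = x then (Real.log n - (((a ++ b).count x + 1 : ℝ) *
              Real.log ((a ++ b).count x + 1)
              - (a ++ b).count x * Real.log ((a ++ b).count x))) / n else 0 := by
      intro z _
      by_cases hz : z = x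
      · subst hz
        have : (a ++ z :: b).count z = (a ++ b).count z + 1 := by
          simp [List.count_append]; ring
        rw [this, negMulLog_nat_div hn0, negMulLog_nat_div hn0, if_pos rfl]
        push_cast; ring
      · have : (a ++ x :: b).count z = (a ++ b).count z := by
          simp [List.count_append, Ne.symm hz]
        rw [this, if_neg hz, add_zero]
    rw [Finset.sum_congr rfl hterm, Finset.sum_add_distrib, Finset.sum_ite_eq' U x, if_pos hx]

theorem hasBoundedDiff_plugInEntropy (n : ℕ) :
    HasBoundedDiff n (plugInDiff n / n) (plugInEntropy (𝒴 := 𝒴)) := by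
  classical
  intro a b x y hab
  have hn0 : (0 : ℝ) < n := by exact_mod_cast (by omega : 0 < n)
  set U : Finset 𝒴 := insert x (insert y (a ++ b).toFinset)
  have hU : ∀ z ∈ a ++ b, z ∈ U := by
    intro z hz; simp only [U, Finset.mem_insert, List.mem_toFinset]; tauto
  obtain ⟨k, hk, h1⟩ := plugInEntropy_insert x U hU (by simp [U]) hab
  obtain ⟨j, hj, h2⟩ := plugInEntropy_insert y U hU (by simp [U]) hab
  rw [h1, h2, add_sub_add_left_eq_sub, ← sub_div, abs_div, abs_of_pos hn0]
  gcongr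
  have := log_add_one_mul_sub_nonneg k
  have := log_add_one_mul_sub_nonneg j
  have := log_add_one_mul_sub_le hk
  have := log_add_one_mul_sub_le hj
  rw [abs_le]; constructor <;> linarith

/-! ### The bias of the plug-in estimator -/

variable {T : Finset 𝒴} {p : 𝒴 → ℝ}

open Classical in
theorem iidMean_plugInEntropy {n : ℕ} :
    iidMean T p n plugInEntropy
      = ∑ x ∈ T, iidMean T p n fun l => Real.negMulLog ((l.count x : ℝ) / n) := by
  rw [← iidMean_sum]
  refine iidMean_congr fun l hl hT => ?_
  rw [plugInEntropy_eq_sum hT, hl]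

theorem mul_log_le_tangent {t c : ℝ} (ht : 0 ≤ t) (hc : 0 < c) :
    t * Real.log t ≤ t * Real.log c + t * (t / c) - t := by
  rcases ht.eq_or_lt with rfl | ht
  · simp
  · have := Real.log_le_sub_one_of_pos (x := t / c) (by positivity)
    rw [Real.log_div ht.ne' hc.ne'] at this
    nlinarith

theorem negMulLog_le_tangent {t c : ℝ} (ht : 0 ≤ t) (hc : 0 < c) :
    Real.negMulLog t ≤ -(t * Real.log c) - t + c := by
  rw [Real.negMulLog]
  rcases ht.eq_or_lt with rfl | ht
  · simp [hc.le]
  · have := Real.log_le_sub_one_of_pos (x := c / t) (by positivity)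
    rw [Real.log_div hc.ne' ht.ne'] at this
    have h2 : t * (Real.log c - Real.log t) ≤ t * (c / t - 1) := by gcongr
    have h3 : t * (c / t - 1) = c - t := by field_simp
    linarith

/-- The plug-in estimator is biased downwards. -/
theorem iidMean_plugInEntropy_le (hp : IsWeight T p) (hpos : ∀ x ∈ T, 0 < p x) {n : ℕ}
    (hn : 0 < n) : iidMean T p n plugInEntropy ≤ ∑ x ∈ T, Real.negMulLog (p x) := by
  classical
  rw [iidMean_plugInEntropy]
  refine Finset.sum_le_sum fun x hx => ?_
  have hn' : (0 : ℝ) < n := by exact_mod_cast hn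
  calc iidMean T p n (fun l => Real.negMulLog ((l.count x : ℝ) / n))
      ≤ iidMean T p n (fun l => (-(Real.log (p x)) - 1) / n * (l.count x : ℝ) + p x) := by
        refine iidMean_mono hp fun l _ _ => ?_
        refine (negMulLog_le_tangent (c := p x) (by positivity) (hpos x hx)).trans (le_of_eq ?_)
        ring
    _ = Real.negMulLog (p x) := by
        rw [iidMean_add, iidMean_const_mul, iidMean_const hp, iidMean_count hp hx,
          Real.negMulLog]
        field_simp; ring

/-- The bias of the plug-in estimator, symbol by symbol. -/
theorem entropy_sub_iidMean_plugInEntropy_le (hp : IsWeight T p) (hpos : ∀ x ∈ T, 0 < p x) {n : ℕ}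
    (hn : 0 < n) : ∑ x ∈ T, Real.negMulLog (p x) - iidMean T p n plugInEntropy
      ≤ ∑ x ∈ T, p x * Real.log (1 + 1 / (n * p x)) := by
  classical
  rw [iidMean_plugInEntropy, ← Finset.sum_sub_distrib]
  refine Finset.sum_le_sum fun x hx => ?_
  have hn' : (0 : ℝ) < n := by exact_mod_cast hn
  have hx0 := hpos x hx
  have hx1 : p x ≤ 1 := by
    rw [← hp.sum_eq_one]; exact Finset.single_le_sum (fun y hy => hp.nonneg y hy) hx
  -- For the empirical frequency q of `x`, the number `p x * c` is E[q²] / E[q]. Taking the tangent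
  -- of log there makes the second-moment bound E[q log q] ≤ p log (p c) come out without remainder.
  set c := 1 + (1 - p x) / (n * p x) with hc
  have hcpos : 0 < c := by
    have : 0 ≤ (1 - p x) / (n * p x) := div_nonneg (by linarith) (by positivity)
    linarith
  have hpc : 0 < p x * c := by positivity
  have h1 : iidMean T p n (fun l => -Real.negMulLog ((l.count x : ℝ) / n))
      ≤ p x * Real.log (p x * c) := by
    calc iidMean T p n (fun l => -Real.negMulLog ((l.count x : ℝ) / n))
        ≤ iidMean T p n (fun l => (Real.log (p x * c) - 1) / n * (l.count x : ℝ)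
            + 1 / (n ^ 2 * (p x * c)) * (l.count x : ℝ) ^ 2) := by
          refine iidMean_mono hp fun l _ _ => ?_
          have := mul_log_le_tangent (t := (l.count x : ℝ) / n) (c := p x * c) (by positivity) hpc
          rw [Real.negMulLog, neg_mul, neg_neg]
          refine this.trans (le_of_eq ?_)
          field_simp; ring
      _ = p x * Real.log (p x * c) := by
          rw [iidMean_add, iidMean_const_mul, iidMean_const_mul, iidMean_count hp hx,
            iidMean_count_sq hp hx]
          have : n * p x * (1 - p x) + (n * p x) ^ 2 = n ^ 2 * (p x) ^ 2 * c := by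
            rw [hc]; field_simp; ring
          rw [this]; field_simp; ring
  rw [iidMean_neg, Real.log_mul hx0.ne' hcpos.ne'] at h1
  have h2 : Real.log c ≤ Real.log (1 + 1 / (n * p x)) := by
    refine Real.log_le_log hcpos ?_
    rw [hc]; gcongr; linarith
  rw [Real.negMulLog]
  nlinarith

/-- Jensen's inequality for log under the weights `p`, whose mean is ∑ p (1 + 1 / (n p)) = 1 + S /
n; it is proved with the tangent of log at this mean. -/
theorem sum_mul_log_le_log_card (hp : IsWeight T p) (hpos : ∀ x ∈ T, 0 < p x) {n : ℕ}
    (hn : 0 < n) :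
    ∑ x ∈ T, p x * Real.log (1 + 1 / (n * p x)) ≤ Real.log (1 + T.card / n) := by
  have hn' : (0 : ℝ) < n := by exact_mod_cast hn
  set m : ℝ := 1 + T.card / n with hm
  have hm0 : 0 < m := by positivity
  calc ∑ x ∈ T, p x * Real.log (1 + 1 / (n * p x))
      ≤ ∑ x ∈ T, (p x * (Real.log m - 1) + (p x + 1 / n) / m) := by
        refine Finset.sum_le_sum fun x hx => ?_
        have hx0 := hpos x hx
        have := Real.log_le_sub_one_of_pos (x := (1 + 1 / (n * p x)) / m) (by positivity)
        rw [Real.log_div (by positivity) hm0.ne'] at this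
        have h2 : p x * Real.log (1 + 1 / (n * p x))
            ≤ p x * (Real.log m + ((1 + 1 / (n * p x)) / m - 1)) := by
          gcongr; linarith
        refine h2.trans (le_of_eq ?_)
        field_simp; ring
    _ = Real.log m := by
        rw [Finset.sum_add_distrib, ← Finset.sum_mul, hp.sum_eq_one, ← Finset.sum_div,
          Finset.sum_add_distrib, hp.sum_eq_one, Finset.sum_const, nsmul_eq_mul]
        have : (1 + T.card * (1 / (n : ℝ))) / m = 1 := by
          rw [hm]; field_simp
        rw [this]; ring

theorem sum_mul_log_le_log_kappa (hp : IsWeight T p) {κ : ℝ} (hκ : 0 < κ)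
    (hpκ : ∀ x ∈ T, 1 / κ ≤ p x) {n : ℕ} (hn : 0 < n) :
    ∑ x ∈ T, p x * Real.log (1 + 1 / (n * p x)) ≤ Real.log (1 + κ / n) := by
  have hn' : (0 : ℝ) < n := by exact_mod_cast hn
  calc ∑ x ∈ T, p x * Real.log (1 + 1 / (n * p x))
      ≤ ∑ x ∈ T, p x * Real.log (1 + κ / n) := by
        refine Finset.sum_le_sum fun x hx => ?_
        have hx0 : 0 < p x := lt_of_lt_of_le (by positivity) (hpκ x hx)
        have h1 : 1 / p x ≤ κ := by
          rw [div_le_iff₀ hx0]; have := hpκ x hx; rw [div_le_iff₀ hκ] at this; linarith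
        gcongr ?_ * Real.log (1 + ?_)
        calc 1 / (n * p x) = 1 / p x / n := by field_simp
          _ ≤ κ / n := by gcongr
    _ = _ := by rw [← Finset.sum_mul, hp.sum_eq_one, one_mul]

/-- Every symbol has -log p ≤ log κ. Keeping the exact term of one atom shows that a law close to a
point mass has small entropy, which is needed when a single symbol has been observed. -/
theorem sum_negMulLog_le_atom (hp : IsWeight T p) {κ : ℝ} (hκ : 0 < κ)
    (hpκ : ∀ x ∈ T, 1 / κ ≤ p x) {x₀ : 𝒴} (hx₀ : x₀ ∈ T) :
    ∑ x ∈ T, Real.negMulLog (p x) ≤ Real.negMulLog (p x₀) + (1 - p x₀) * Real.log κ := by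
  classical
  rw [← Finset.add_sum_erase T _ hx₀, ← hp.sum_eq_one, ← Finset.add_sum_erase T p hx₀,
    add_sub_cancel_left, Finset.sum_mul]
  refine add_le_add_right (Finset.sum_le_sum fun x hx => ?_) _
  have hx' := hpκ x (Finset.mem_of_mem_erase hx)
  have h0 : 0 < p x := lt_of_lt_of_le (by positivity) hx'
  have : Real.log (1 / κ) ≤ Real.log (p x) := Real.log_le_log (by positivity) hx'
  rw [Real.log_div one_ne_zero hκ.ne', Real.log_one] at this
  rw [Real.negMulLog]; nlinarith

theorem sum_negMulLog_le_log_kappa (hp : IsWeight T p) {κ : ℝ} (hκ : 0 < κ)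
    (hpκ : ∀ x ∈ T, 1 / κ ≤ p x) : ∑ x ∈ T, Real.negMulLog (p x) ≤ Real.log κ := by
  rw [← one_mul (Real.log κ), ← hp.sum_eq_one, Finset.sum_mul]
  refine Finset.sum_le_sum fun x hx => ?_
  have hx' := hpκ x hx
  have h0 : 0 < p x := lt_of_lt_of_le (by positivity) hx'
  have : Real.log (1 / κ) ≤ Real.log (p x) := Real.log_le_log (by positivity) hx'
  rw [Real.log_div one_ne_zero hκ.ne', Real.log_one] at this
  rw [Real.negMulLog]; nlinarith

theorem plugInEntropy_nonneg (l : List 𝒴) : 0 ≤ plugInEntropy l := by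
  classical
  rw [plugInEntropy_eq_sum (U := l.toFinset) (by simp)]
  refine Finset.sum_nonneg fun x _ => Real.negMulLog_nonneg (by positivity) ?_
  exact div_le_one_of_le₀ (by exact_mod_cast List.count_le_length) (by positivity)

theorem plugInEntropy_singleton (x : 𝒴) : plugInEntropy [x] = 0 := by
  classical
  rw [plugInEntropy_eq_sum (U := {x}) (by simp)]
  simp

/-! ### The support size estimator -/

open Classical in
theorem supportEstimate_eq_card (l : List 𝒴) : supportEstimate l = l.toFinset.card := rfl

theorem hasBoundedDiff_supportEstimate (n : ℕ) :
    HasBoundedDiff n 1 (fun l : List 𝒴 => (supportEstimate l : ℝ)) := by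
  classical
  intro a b x y _
  have h : ∀ x : 𝒴, (a ++ b).toFinset.card ≤ supportEstimate (a ++ x :: b) ∧
      supportEstimate (a ++ x :: b) ≤ (a ++ b).toFinset.card + 1 := by
    intro x
    have : (a ++ x :: b).toFinset = insert x (a ++ b).toFinset := by
      ext z; simp
    rw [supportEstimate_eq_card, this]
    exact ⟨Finset.card_le_card (Finset.subset_insert _ _), Finset.card_insert_le _ _⟩
  obtain ⟨h1, h2⟩ := h x
  obtain ⟨h3, h4⟩ := h y
  rw [abs_le]
  have h5 : (supportEstimate (a ++ x :: b) : ℝ) ≤ supportEstimate (a ++ y :: b) + 1 := by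
    exact_mod_cast (by omega)
  have h6 : (supportEstimate (a ++ y :: b) : ℝ) ≤ supportEstimate (a ++ x :: b) + 1 := by
    exact_mod_cast (by omega)
  constructor <;> linarith

theorem supportEstimate_le_card {l : List 𝒴} (h : ∀ x ∈ l, x ∈ T) :
    supportEstimate l ≤ T.card := by
  classical
  exact Finset.card_le_card fun x hx => h x (List.mem_toFinset.1 hx)

theorem supportEstimate_pos {l : List 𝒴} (h : 0 < l.length) : 1 ≤ supportEstimate l := by
  classical
  obtain ⟨x, hx⟩ := List.exists_mem_of_length_pos h
  exact Finset.card_pos.2 ⟨x, List.mem_toFinset.2 hx⟩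

theorem iidMean_supportEstimate (hp : IsWeight T p) (n : ℕ) :
    iidMean T p n (fun l => (supportEstimate l : ℝ)) = ∑ x ∈ T, (1 - (1 - p x) ^ n) := by
  classical
  rw [← Finset.sum_congr rfl fun x hx => iidMean_mem hp hx n, ← iidMean_sum]
  refine iidMean_congr fun l _ hT => ?_
  rw [supportEstimate_eq_card, Finset.sum_boole]
  congr 2
  ext x
  simp only [List.mem_toFinset, Finset.mem_filter]
  exact ⟨fun h => ⟨hT x h, h⟩, fun h => h.2⟩

theorem sum_one_sub_exp_le (hp : IsWeight T p) (n : ℕ) :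
    ∑ x ∈ T, (1 - Real.exp (-(n * p x))) ≤ iidMean T p n (fun l => (supportEstimate l : ℝ)) := by
  rw [iidMean_supportEstimate hp]
  refine Finset.sum_le_sum fun x hx => ?_
  have hx1 : p x ≤ 1 := by
    rw [← hp.sum_eq_one]; exact Finset.single_le_sum (fun y hy => hp.nonneg y hy) hx
  have : (1 - p x) ^ n ≤ Real.exp (-(p x)) ^ n :=
    pow_le_pow_left₀ (by linarith) (Real.one_sub_le_exp_neg _) n
  rw [← Real.exp_nat_mul] at this
  rw [show -((n : ℝ) * p x) = n * -p x by ring]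
  linarith

theorem iidProb_succ (n : ℕ) (B : List 𝒴 → Prop) :
    iidProb T p (n + 1) B = ∑ x ∈ T, p x * iidProb T p n fun l => B (x :: l) := rfl

theorem iidProb_all_eq (hp : IsWeight T p) {x : 𝒴} (hx : x ∈ T) (n : ℕ) :
    iidProb T p n (fun l => ∀ y ∈ l, y = x) = p x ^ n := by
  classical
  induction n with
  | zero => simp [iidProb, iidMean]
  | succ n ih =>
    have h : ∀ y ∈ T, p y * iidProb T p n (fun l => ∀ z ∈ y :: l, z = x)
        = if y = x then p y * p x ^ n else 0 := by
      intro y _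
      by_cases hy : y = x
      · subst hy
        rw [if_pos rfl, ← ih]
        simp
      · rw [if_neg hy, iidProb_false hp, mul_zero]
        intro l _ _ h
        exact hy (h y (by simp))
    rw [iidProb_succ, Finset.sum_congr rfl h, Finset.sum_ite_eq' T x, if_pos hx]
    ring

/-- The probability that all samples agree. -/
theorem iidProb_supportEstimate_le_one (hp : IsWeight T p) {a : ℝ} (ha : ∀ x ∈ T, p x ≤ a) (n : ℕ) :
    iidProb T p (n + 1) (fun l => supportEstimate l ≤ 1) ≤ a ^ n := by
  classical
  rw [iidProb_succ, ← one_mul (a ^ n), ← hp.sum_eq_one, Finset.sum_mul]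
  refine Finset.sum_le_sum fun x hx => mul_le_mul_of_nonneg_left ?_ (hp.nonneg x hx)
  calc iidProb T p n (fun l => supportEstimate (x :: l) ≤ 1)
      ≤ iidProb T p n (fun l => ∀ y ∈ l, y = x) := by
        refine iidProb_mono hp fun l _ _ h y hy => ?_
        rw [supportEstimate_eq_card] at h
        exact Finset.card_le_one.1 h y (by simp [hy]) x (by simp)
    _ = p x ^ n := iidProb_all_eq hp hx n
    _ ≤ a ^ n := pow_le_pow_left₀ (hp.nonneg x hx) (ha x hx) n

end plugIn

/-! ### Comparison of the bias with the number of observed symbols -/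

theorem log_one_add_inv_nonneg {t : ℝ} (ht : 0 < t) : 0 ≤ Real.log (1 + 1 / t) :=
  Real.log_nonneg (by have : 0 < 1 / t := by positivity
                      linarith)

theorem exp_neg_half_ge : 0.6065 ≤ Real.exp (-(1 / 2)) := by
  have h : Real.exp (-(1 / 2)) ^ 2 = (Real.exp 1)⁻¹ := by
    rw [← Real.exp_nat_mul, ← Real.exp_neg]; norm_num
  have h2 : (0.6065 : ℝ) ^ 2 ≤ Real.exp (-(1 / 2)) ^ 2 := by
    rw [h, le_inv_comm₀ (by norm_num) (Real.exp_pos 1)]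
    refine Real.exp_one_lt_d9.le.trans ?_
    norm_num
  exact le_of_sq_le_sq h2 (Real.exp_pos _).le

/-- `exp r ≤ q` in terms of a rational power of `e`. -/
theorem le_log_of_pow_le {q : ℝ} {m k : ℕ} (hk : 0 < k) (hq : 0 < q)
    (h : (2.7182818286 : ℝ) ^ m ≤ q ^ k) : (m : ℝ) / k ≤ Real.log q := by
  have h1 : Real.exp m ≤ q ^ k := by
    rw [← mul_one (m : ℝ), Real.exp_nat_mul]
    exact (pow_le_pow_left₀ (Real.exp_pos 1).le Real.exp_one_lt_d9.le m).trans h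
  rw [div_le_iff₀ (by positivity), mul_comm, ← Real.log_pow]
  rwa [Real.le_log_iff_exp_le (by positivity)]

theorem log_le_of_le_pow {q : ℝ} {m k : ℕ} (hk : 0 < k) (hq : 0 < q)
    (h : q ^ k ≤ (2.7182818283 : ℝ) ^ m) : Real.log q ≤ (m : ℝ) / k := by
  have h1 : q ^ k ≤ Real.exp m := by
    rw [← mul_one (m : ℝ), Real.exp_nat_mul]
    exact h.trans (pow_le_pow_left₀ (by norm_num) Real.exp_one_gt_d9.le m)
  rw [le_div_iff₀ (by positivity), mul_comm, ← Real.log_pow]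
  rwa [Real.log_le_iff_le_exp (by positivity)]

/-- With l = log (1 + 1 / t), the derivative has the sign of l (e^t - 1 - t) - (e^t - 1) / (1 + t).
On (0, 1] this is nonpositive because l ≤ 1 / t and e^t ≤ 1 + t + t². -/
theorem antitoneOn_mul_log_div :
    AntitoneOn (fun t : ℝ => t * Real.log (1 + 1 / t) / (1 - Real.exp (-t))) (Set.Ioc 0 1) := by
  have hden : ∀ t : ℝ, 0 < t → 0 < 1 - Real.exp (-t) := by
    intro t ht
    have : Real.exp (-t) < 1 := by rw [Real.exp_lt_one_iff]; linarith
    linarith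
  have hder : ∀ t : ℝ, 0 < t → HasDerivAt
      (fun t : ℝ => t * Real.log (1 + 1 / t) / (1 - Real.exp (-t)))
      (((Real.log (1 + 1 / t) - 1 / (1 + t)) * (1 - Real.exp (-t))
        - t * Real.log (1 + 1 / t) * Real.exp (-t)) / (1 - Real.exp (-t)) ^ 2) t := by
    intro t ht
    have h1 : HasDerivAt (fun t : ℝ => 1 + 1 / t) (-(1 / t ^ 2)) t := by
      have := (hasDerivAt_inv ht.ne').const_add 1
      simpa [one_div] using this
    have h2 := (hasDerivAt_id t).mul (h1.log (by positivity))
    have h3 : HasDerivAt (fun t : ℝ => 1 - Real.exp (-t)) (Real.exp (-t)) t := by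
      have := ((hasDerivAt_id t).neg.exp).const_sub 1
      simpa using this
    have h4 := h2.div h3 (hden t ht).ne'
    refine h4.congr_deriv ?_
    congr 1
    simp only [id_eq, Pi.mul_apply]
    congr 2
    field_simp
    ring
  refine antitoneOn_of_deriv_nonpos (convex_Ioc 0 1) ?_ ?_ ?_
  · intro t ht
    exact (hder t ht.1).continuousAt.continuousWithinAt
  · intro t ht
    rw [interior_Ioc] at ht
    exact (hder t ht.1).differentiableAt.differentiableWithinAt
  · intro t ht
    rw [interior_Ioc] at ht
    obtain ⟨h0, h1⟩ := ht
    rw [(hder t h0).deriv]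
    refine div_nonpos_of_nonpos_of_nonneg ?_ (sq_nonneg _)
    have he : Real.exp t ≤ 1 + t + t ^ 2 := by
      have := Real.abs_exp_sub_one_sub_id_le (x := t) (by rw [abs_of_pos h0]; exact h1.le)
      have := (abs_le.1 this).2
      linarith
    have hl0 := log_one_add_inv_nonneg h0
    have hl : Real.log (1 + 1 / t) * t ≤ 1 := by
      have := Real.log_le_sub_one_of_pos (x := 1 + 1 / t) (by positivity)
      have h2 : Real.log (1 + 1 / t) ≤ 1 / t := by linarith
      calc Real.log (1 + 1 / t) * t ≤ 1 / t * t := by gcongr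
        _ = 1 := by field_simp
    set l := Real.log (1 + 1 / t)
    have hgoal : (l - 1 / (1 + t)) * (1 - Real.exp (-t)) - t * l * Real.exp (-t)
        = Real.exp (-t) * (l * (Real.exp t - 1 - t) - (Real.exp t - 1) / (1 + t)) := by
      rw [Real.exp_neg]; have := Real.exp_pos t; field_simp; ring
    rw [hgoal]
    refine mul_nonpos_of_nonneg_of_nonpos (Real.exp_pos _).le ?_
    have h3 : t ≤ Real.exp t - 1 := by linarith [Real.add_one_le_exp t]
    rw [sub_nonpos, le_div_iff₀ (by positivity)]
    have h4 : l * (Real.exp t - 1 - t) * t ≤ Real.exp t - 1 - t := by nlinarith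
    have h5 : (Real.exp t - 1 - t) * (1 + t) ≤ (Real.exp t - 1) * t := by nlinarith
    have h6 : l * (Real.exp t - 1 - t) * (1 + t) * t ≤ (Real.exp t - 1) * t := by nlinarith
    exact le_of_mul_le_mul_right h6 h0

theorem one_sub_exp_neg_ge {t : ℝ} (ht : 0 ≤ t) : t / (1 + t) ≤ 1 - Real.exp (-t) := by
  have h := Real.add_one_le_exp t
  have : Real.exp (-t) ≤ 1 / (1 + t) := by
    rw [Real.exp_neg, ← one_div]
    exact one_div_le_one_div_of_le (by linarith) (by linarith)
  have h2 : t / (1 + t) = 1 - 1 / (1 + t) := by field_simp; ring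
  linarith

/-- With y = 1 / t the left side is the slope of the chord of x log x from 1 to 1 + y. By convexity
it is largest at y = 1. -/
theorem mul_log_le_two_log_two {t : ℝ} (ht : 1 ≤ t) :
    (1 + t) * Real.log (1 + 1 / t) ≤ 2 * Real.log 2 := by
  have h0 : 0 < t := by linarith
  have hy1 : 1 / t ≤ 1 := by rw [div_le_one h0]; exact ht
  have hy0 : 0 < 1 / t := by positivity
  have := Real.convexOn_mul_log.2 (show (1 : ℝ) ∈ Set.Ici 0 by simp)
    (show (2 : ℝ) ∈ Set.Ici 0 by simp) (show 0 ≤ 1 - 1 / t by linarith) hy0.le (by ring)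
  simp only [smul_eq_mul, Real.log_one, mul_zero, zero_add, mul_one] at this
  rw [show 1 - 1 / t + 1 / t * 2 = 1 + 1 / t by ring] at this
  calc (1 + t) * Real.log (1 + 1 / t) = t * ((1 + 1 / t) * Real.log (1 + 1 / t)) := by
        field_simp; ring
    _ ≤ t * (1 / t * (2 * Real.log 2)) := by gcongr
    _ = _ := by field_simp

/-- For `u ≤ 1 / 2`, the ratio of `t log (1 + 1 / t)` and `1 - exp (-t)` on `t ≥ u` is largest at
`t = u`. -/
theorem mul_log_div_le {u t : ℝ} (hu : 0 < u) (hu2 : u ≤ 1 / 2) (hut : u ≤ t) :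
    t * Real.log (1 + 1 / t)
      ≤ u * Real.log (1 + 1 / u) / (1 - Real.exp (-u)) * (1 - Real.exp (-t)) := by
  have ht : 0 < t := by linarith
  have hdt : 0 < 1 - Real.exp (-t) :=
    lt_of_lt_of_le (by positivity) (one_sub_exp_neg_ge ht.le)
  rw [← div_le_iff₀ hdt]
  rcases le_total t 1 with h1 | h1
  · exact antitoneOn_mul_log_div ⟨hu, by linarith⟩ ⟨ht, h1⟩ hut
  -- Beyond 1 the ratio is only bounded by 2 log 2 ≈ 1.386. This lies just below its value ≈ 1.396
  -- at 1/2, which is why `u ≤ 1 / 2` is required.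
  · have h2 := antitoneOn_mul_log_div ⟨hu, by linarith⟩
      (⟨by norm_num, by norm_num⟩ : (1 / 2 : ℝ) ∈ Set.Ioc 0 1) hu2
    refine le_trans ?_ h2
    calc t * Real.log (1 + 1 / t) / (1 - Real.exp (-t))
        ≤ t * Real.log (1 + 1 / t) / (t / (1 + t)) := by
          have := log_one_add_inv_nonneg ht
          gcongr
          exact one_sub_exp_neg_ge ht.le
      _ = (1 + t) * Real.log (1 + 1 / t) := by field_simp
      _ ≤ 2 * Real.log 2 := mul_log_le_two_log_two h1
      _ ≤ _ := by
          have he := exp_neg_half_ge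
          have hpos : 0 < 1 - Real.exp (-(1 / 2 : ℝ)) := by
            have : Real.exp (-(1 / 2 : ℝ)) < 1 := by rw [Real.exp_lt_one_iff]; norm_num
            linarith
          rw [le_div_iff₀ hpos]
          have h3 : (1.098 : ℝ) ≤ Real.log 3 := by
            have := le_log_of_pow_le (q := 3) (m := 78) (k := 71) (by norm_num) (by norm_num)
              (by norm_num)
            refine le_trans ?_ this; norm_num
          rw [show (1 : ℝ) + 1 / (1 / 2) = 3 by norm_num]
          have := Real.log_two_lt_d9
          nlinarith [Real.log_two_gt_d9]

/-- The expansion starts 1 + u / 2 + u² / 12; the coefficient 1/10 leaves room for the remainder of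
the four-term Taylor polynomial of exp. -/
theorem inv_one_sub_exp_neg_le {u : ℝ} (hu : 0 < u) (hu2 : u ≤ 1 / 2) :
    u * (1 - Real.exp (-u))⁻¹ ≤ 1 + u / 2 + u ^ 2 / 10 := by
  have hd : 0 < 1 - Real.exp (-u) :=
    lt_of_lt_of_le (by positivity) (one_sub_exp_neg_ge hu.le)
  rw [← div_eq_mul_inv, div_le_iff₀ hd]
  have h := Real.exp_bound (x := -u) (by rw [abs_neg, abs_of_pos hu]; linarith) (n := 4)
    (by norm_num)
  rw [abs_neg, abs_of_pos hu] at h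
  simp only [Finset.sum_range_succ, Finset.sum_range_zero, Nat.factorial] at h
  norm_num at h
  have h2 := (abs_le.1 h).2
  have h3 : Real.exp (-u) ≤ 1 - u + u ^ 2 / 2 - u ^ 3 / 6 + u ^ 4 * (5 / 96) := by nlinarith
  have h4 : (1 + u / 2 + u ^ 2 / 10) * (u - u ^ 2 / 2 + u ^ 3 / 6 - u ^ 4 * (5 / 96)) ≤
      (1 + u / 2 + u ^ 2 / 10) * (1 - Real.exp (-u)) := by
    exact mul_le_mul_of_nonneg_left (by linarith) (by positivity)
  refine le_trans ?_ h4
  have h5 : 0 ≤ u ^ 3 := by positivity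
  have h6 : 0 ≤ u ^ 4 := by positivity
  have : (1 + u / 2 + u ^ 2 / 10) * (u - u ^ 2 / 2 + u ^ 3 / 6 - u ^ 4 * (5 / 96)) - u
      = u ^ 3 * (1 / 60 - 3 / 160 * u - 3 / 320 * u ^ 2 - 1 / 192 * u ^ 3) := by ring
  have h7 : 0 ≤ 1 / 60 - 3 / 160 * u - 3 / 320 * u ^ 2 - 1 / 192 * u ^ 3 := by
    nlinarith [mul_pos hu hu, mul_nonneg (mul_nonneg hu.le hu.le) (sub_nonneg.2 hu2),
      mul_nonneg hu.le (sub_nonneg.2 hu2)]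
  nlinarith [mul_nonneg h5 h7]

/-- Equivalent to (2 - u) e^u ≤ 2 + u, which for u < 2 is log (1 + x) ≥ 2 x / (x + 2) at x = 2 u /
(2 - u). -/
theorem one_div_add_half_le {u : ℝ} (hu : 0 < u) : 1 / u + 1 / 2 ≤ (1 - Real.exp (-u))⁻¹ := by
  have hd : 0 < 1 - Real.exp (-u) :=
    lt_of_lt_of_le (by positivity) (one_sub_exp_neg_ge hu.le)
  rw [le_inv_comm₀ (by positivity) hd]
  have key : (2 - u) * Real.exp u ≤ 2 + u := by
    rcases le_or_gt 2 u with h | h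
    · nlinarith [Real.exp_pos u]
    · have h2 : 0 < 2 - u := by linarith
      have h1 := Real.le_log_one_add_of_nonneg (x := 2 * u / (2 - u)) (by positivity)
      rw [show 2 * (2 * u / (2 - u)) / (2 * u / (2 - u) + 2) = u by field_simp; ring,
        show 1 + 2 * u / (2 - u) = (2 + u) / (2 - u) by field_simp; ring,
        Real.le_log_iff_exp_le (by positivity), le_div_iff₀ h2] at h1
      linarith
  have h1 : (1 / u + 1 / 2)⁻¹ = 2 * u / (2 + u) := by field_simp
  rw [h1, le_div_iff₀ (by positivity), Real.exp_neg]
  have := Real.exp_pos u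
  field_simp
  nlinarith

theorem inv_one_sub_exp_neg_le_one_add {u : ℝ} (hu : 0 < u) :
    (1 - Real.exp (-u))⁻¹ ≤ 1 + 1 / u := by
  have h := one_sub_exp_neg_ge hu.le
  have h0 : 0 < u / (1 + u) := by positivity
  refine (inv_anti₀ h0 h).trans (le_of_eq ?_)
  field_simp
  ring

theorem one_le_inv_one_sub_exp_neg {u : ℝ} (hu : 0 < u) : 1 ≤ (1 - Real.exp (-u))⁻¹ := by
  have hd : 0 < 1 - Real.exp (-u) :=
    lt_of_lt_of_le (by positivity) (one_sub_exp_neg_ge hu.le)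
  exact (one_le_inv₀ hd).2 (by linarith [Real.exp_pos (-u)])

/-- Produces the constant `D` of `log_one_add_mul_le_of_chord`, with u = n / κ. Both sides grow like
log (1 / u) as u tends to 0. After this cancellation the remaining logarithms are replaced by
tangents at `u₀`, or by a rational lower bound, and `hD` is an inequality between rational functions
of u. -/
theorem chord_sub_log_le {u u₀ D : ℝ} (hu : 0 < u) (hu₀ : u ≤ u₀) (hu2 : u₀ ≤ 1 / 2)
    (hD : (u / 2 + u ^ 2 / 10) * (Real.log (1 / u₀) + u₀ / u - 1)
      + (1 + u / 2 + u ^ 2 / 10) * (Real.log (1 + u₀) + (u - u₀) / (1 + u₀))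
      - 2 * u / (4 + u) ≤ D) :
    u * Real.log (1 + 1 / u) * (1 - Real.exp (-u))⁻¹
      ≤ Real.log ((1 - Real.exp (-u))⁻¹) + D := by
  have h1 := inv_one_sub_exp_neg_le hu (hu₀.trans hu2)
  have h2 := one_div_add_half_le hu
  have hu0' : 0 < u₀ := hu.trans_le hu₀
  set r := (1 - Real.exp (-u))⁻¹
  have hr : Real.log (1 / u) + Real.log (1 + u / 2) ≤ Real.log r := by
    rw [← Real.log_mul (by positivity) (by positivity)]
    refine Real.log_le_log (by positivity) (le_trans (le_of_eq ?_) h2)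
    field_simp
  have h3 : Real.log (1 + 1 / u) = Real.log (1 / u) + Real.log (1 + u) := by
    rw [← Real.log_mul (by positivity) (by positivity)]
    congr 1; field_simp; ring
  have h4 : 2 * u / (4 + u) ≤ Real.log (1 + u / 2) := by
    refine le_trans (le_of_eq ?_) (Real.le_log_one_add_of_nonneg (x := u / 2) (by positivity))
    field_simp; ring
  have h5 : Real.log (1 / u) ≤ Real.log (1 / u₀) + u₀ / u - 1 := by
    have := Real.log_le_sub_one_of_pos (x := u₀ / u) (by positivity)
    rw [show u₀ / u = 1 / u / (1 / u₀) by field_simp, Real.log_div (by positivity)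
      (by positivity)] at this
    rw [show u₀ / u = 1 / u / (1 / u₀) by field_simp]
    linarith
  have h6 : Real.log (1 + u) ≤ Real.log (1 + u₀) + (u - u₀) / (1 + u₀) := by
    have := Real.log_le_sub_one_of_pos (x := (1 + u) / (1 + u₀)) (by positivity)
    rw [Real.log_div (by positivity) (by positivity)] at this
    have h7 : (1 + u) / (1 + u₀) - 1 = (u - u₀) / (1 + u₀) := by field_simp; ring
    linarith
  have hl0 := log_one_add_inv_nonneg hu
  have h7 : u * Real.log (1 + 1 / u) * r
      ≤ (1 + u / 2 + u ^ 2 / 10) * (Real.log (1 / u) + Real.log (1 + u)) := by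
    rw [← h3]; nlinarith
  have h8 : (u / 2 + u ^ 2 / 10) * Real.log (1 / u)
      ≤ (u / 2 + u ^ 2 / 10) * (Real.log (1 / u₀) + u₀ / u - 1) :=
    mul_le_mul_of_nonneg_left h5 (by positivity)
  have h9 : (1 + u / 2 + u ^ 2 / 10) * Real.log (1 + u)
      ≤ (1 + u / 2 + u ^ 2 / 10) * (Real.log (1 + u₀) + (u - u₀) / (1 + u₀)) :=
    mul_le_mul_of_nonneg_left h6 (by positivity)
  linarith

theorem chord_sub_log_le_of_le_half {u : ℝ} (hu : 0 < u) (hu2 : u ≤ 1 / 2) :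
    u * Real.log (1 + 1 / u) * (1 - Real.exp (-u))⁻¹
      ≤ Real.log ((1 - Real.exp (-u))⁻¹) + 0.49 := by
  refine chord_sub_log_le hu hu2 le_rfl ?_
  have h2 := Real.log_two_lt_d9
  have h3 : Real.log (1 + 1 / 2) ≤ 0.4056 := by
    refine (log_le_of_le_pow (m := 73) (k := 180) (by norm_num) (by norm_num)
      (by norm_num)).trans (by norm_num)
  have h4 : 2 * u / (4 + u) ≥ u / 2 - u ^ 2 / 8 := by
    rw [ge_iff_le, le_div_iff₀ (by positivity)]
    nlinarith [pow_pos hu 3]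
  have h5 : (u / 2 + u ^ 2 / 10) * (Real.log (1 / (1 / 2)) + 1 / 2 / u - 1)
     = (u / 2 + u ^ 2 / 10) * (Real.log 2 - 1) + (1 / 4 + u / 20) := by
    rw [show (1 : ℝ) / (1 / 2) = 2 by norm_num]; field_simp; ring
  rw [h5]
  have h6 : (u / 2 + u ^ 2 / 10) * (Real.log 2 - 1) ≤ (u / 2 + u ^ 2 / 10) * (0.6932 - 1) :=
    mul_le_mul_of_nonneg_left (by linarith) (by positivity)
  have h7 : (1 + u / 2 + u ^ 2 / 10) * (Real.log (1 + 1 / 2) + (u - 1 / 2) / (1 + 1 / 2))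
     ≤ (1 + u / 2 + u ^ 2 / 10) * (0.4056 + (u - 1 / 2) / (1 + 1 / 2)) :=
    mul_le_mul_of_nonneg_left (by linarith) (by positivity)
  have h8 : (u / 2 + u ^ 2 / 10) * (0.6932 - 1) + (1 / 4 + u / 20) +
    (1 + u / 2 + u ^ 2 / 10) * (0.4056 + (u - 1 / 2) / (1 + 1 / 2)) - (u / 2 - u ^ 2 / 8) ≤ 0.49 := by
    rw [show (u - 1 / 2) / (1 + 1 / 2) = (u - 1 / 2) * (2 / 3) by ring]
    nlinarith [mul_nonneg hu.le (sub_nonneg.2 hu2), mul_nonneg (mul_nonneg hu.le hu.le) (sub_nonneg.2 hu2)]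
  linarith

theorem chord_sub_log_le_of_le_quarter {u : ℝ} (hu : 0 < u) (hu2 : u ≤ 1 / 4) :
    u * Real.log (1 + 1 / u) * (1 - Real.exp (-u))⁻¹
      ≤ Real.log ((1 - Real.exp (-u))⁻¹) + 0.32 := by
  refine chord_sub_log_le hu hu2 (by norm_num) ?_
  have h2 := Real.log_two_lt_d9
  have h3 : Real.log (1 + 1 / 4) ≤ 0.2235 := by
    refine (log_le_of_le_pow (m := 21) (k := 94) (by norm_num) (by norm_num)
      (by norm_num)).trans (by norm_num)
  have h4 : 2 * u / (4 + u) ≥ u / 2 - u ^ 2 / 8 := by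
    rw [ge_iff_le, le_div_iff₀ (by positivity)]
    nlinarith [pow_pos hu 3]
  have h5 : (u / 2 + u ^ 2 / 10) * (Real.log (1 / (1 / 4)) + 1 / 4 / u - 1)
     = (u / 2 + u ^ 2 / 10) * (2 * Real.log 2 - 1) + (1 / 8 + u / 40) := by
    rw [show (1 : ℝ) / (1 / 4) = 2 ^ 2 by norm_num, Real.log_pow]
    push_cast; field_simp; ring
  rw [h5]
  have h6 : (u / 2 + u ^ 2 / 10) * (2 * Real.log 2 - 1)
      ≤ (u / 2 + u ^ 2 / 10) * (2 * 0.6932 - 1) :=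
    mul_le_mul_of_nonneg_left (by linarith) (by positivity)
  have h7 : (1 + u / 2 + u ^ 2 / 10) * (Real.log (1 + 1 / 4) + (u - 1 / 4) / (1 + 1 / 4))
     ≤ (1 + u / 2 + u ^ 2 / 10) * (0.2235 + (u - 1 / 4) / (1 + 1 / 4)) :=
    mul_le_mul_of_nonneg_left (by linarith) (by positivity)
  have h8 : (u / 2 + u ^ 2 / 10) * (2 * 0.6932 - 1) + (1 / 8 + u / 40) +
    (1 + u / 2 + u ^ 2 / 10) * (0.2235 + (u - 1 / 4) / (1 + 1 / 4)) - (u / 2 - u ^ 2 / 8)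
      ≤ 0.32 := by
    rw [show (u - 1 / 4) / (1 + 1 / 4) = (u - 1 / 4) * (4 / 5) by ring]
    nlinarith [mul_nonneg hu.le (sub_nonneg.2 hu2),
      mul_nonneg (mul_nonneg hu.le hu.le) (sub_nonneg.2 hu2)]
  linarith

/-! ### Reduction of the lower confidence inequality to inequalities between elementary functions -/

/-- The difference of the two deviation widths: the one of the algorithm at confidence
`δ = exp (-2 s²)`, and the one for which McDiarmid's inequality has failure probability `c δ`. -/
noncomputable def devGap (c : ℝ) (n : ℕ) (s : ℝ) : ℝ :=
  2 * Real.log n * √(s ^ 2 + Real.log 2 / 2) / √n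
    - plugInDiff n * √(s ^ 2 - Real.log c / 2) / √n

theorem devGap_ge {c s : ℝ} {n : ℕ} (hn : 3 ≤ n) (hc : 1 ≤ c) (hc2 : Real.log c ≤ 2)
    (hs : 1 ≤ s) :
    s * (Real.log n - 1) / √n
      + (0.32 * Real.log n + (Real.log n + 1) * Real.log c / 4) / (s * √n) ≤ devGap c n s := by
  have hn3 : (3 : ℝ) ≤ n := by exact_mod_cast hn
  have hL : 0 ≤ Real.log n := Real.log_nonneg (by linarith)
  have hc0 := Real.log_nonneg hc
  have hz : 0 < √(n : ℝ) := Real.sqrt_pos.2 (by linarith)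
  have hs0 : 0 < s := by linarith
  have h1 : s + 0.16 / s ≤ √(s ^ 2 + Real.log 2 / 2) := by
    apply Real.le_sqrt_of_sq_le
    have h2 := Real.log_two_gt_d9
    have : (s + 0.16 / s) ^ 2 = s ^ 2 + 0.32 + 0.0256 / s ^ 2 := by field_simp; ring
    have h3 : 0.0256 / s ^ 2 ≤ 0.0256 := div_le_self (by norm_num) (by nlinarith)
    rw [this]; linarith
  have h2 : √(s ^ 2 - Real.log c / 2) ≤ s - Real.log c / (4 * s) := by
    have h4 : Real.log c / (4 * s) ≤ s := by
      rw [div_le_iff₀ (by positivity)]; nlinarith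
    rw [Real.sqrt_le_left (by linarith)]
    have : (s - Real.log c / (4 * s)) ^ 2 = s ^ 2 - Real.log c / 2
        + (Real.log c / (4 * s)) ^ 2 := by field_simp; ring
    rw [this]
    nlinarith [sq_nonneg (Real.log c / (4 * s))]
  have h3 : plugInDiff n ≤ Real.log n + 1 := min_le_right _ _
  have h4 : plugInDiff n * √(s ^ 2 - Real.log c / 2)
      ≤ (Real.log n + 1) * (s - Real.log c / (4 * s)) :=
    mul_le_mul h3 h2 (Real.sqrt_nonneg _) (by linarith)
  have h5 : 2 * Real.log n * (s + 0.16 / s) ≤ 2 * Real.log n * √(s ^ 2 + Real.log 2 / 2) :=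
    mul_le_mul_of_nonneg_left h1 (by linarith)
  rw [devGap, ← sub_div, le_div_iff₀ hz]
  refine le_trans (le_of_eq ?_) (sub_le_sub h5 h4)
  field_simp
  ring

/-- Of the support estimate only `2 ≤ S` is used: if n ≥ 1 + s, then 1 + ρ is at most n / (1 + s)
times 1 + ρ (1 + s) / n, so a gap of log (n / (1 + s)) makes up for everything else. -/
theorem log_one_add_mul_le_of_log_le {n r ρ s S e b : ℝ} (hn : 0 < n) (hρ : 0 ≤ ρ)
    (hr : ρ ≤ r) (hs : 0 ≤ s) (hS : 2 ≤ S) (he : 0 ≤ e) (hne : Real.log (n / (1 + s)) ≤ e)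
    (hb : b ≤ Real.log (1 + ρ)) : b ≤ Real.log (1 + r * (S + s - 1) / n) + e := by
  have h1 : 1 + ρ * (1 + s) / n ≤ 1 + r * (S + s - 1) / n := by
    gcongr
    · nlinarith
    · linarith
  have h2 : 0 ≤ ρ * (1 + s) / n := by positivity
  have h3 : Real.log (1 + ρ * (1 + s) / n) ≤ Real.log (1 + r * (S + s - 1) / n) :=
    Real.log_le_log (by linarith) h1
  suffices h : Real.log (1 + ρ) ≤ Real.log (1 + ρ * (1 + s) / n) + e by linarith
  rcases le_total n (1 + s) with h | h
  · have : Real.log (1 + ρ) ≤ Real.log (1 + ρ * (1 + s) / n) := by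
      refine Real.log_le_log (by linarith) ?_
      have : ρ ≤ ρ * (1 + s) / n := by
        rw [le_div_iff₀ hn]; exact mul_le_mul_of_nonneg_left h hρ
      linarith
    linarith
  · suffices h' : Real.log (1 + ρ) ≤ Real.log (1 + ρ * (1 + s) / n) + Real.log (n / (1 + s)) by
      linarith
    rw [← Real.log_mul (by positivity) (by positivity)]
    refine Real.log_le_log (by positivity) ?_
    have : (1 + ρ * (1 + s) / n) * (n / (1 + s)) = n / (1 + s) + ρ := by field_simp
    rw [this]
    have : 1 ≤ n / (1 + s) := by rw [one_le_div (by positivity)]; exact h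
    linarith

/-- The quotient of 1 + (S + lam) r / n by 1 + r (S + s - 1) / n is 1 + r (lam - s + 1) / (n + r (S
+ s - 1)). It increases in `r` and decreases in `S`, so the worst case is r = R, S = 2. -/
theorem log_one_add_mul_le_of_ratio {n r R s S lam e b N : ℝ} (hn : 0 < n) (hr : 0 ≤ r)
    (hrR : r ≤ R) (hs : 0 ≤ s) (hS : 2 ≤ S) (hlam : s - 1 ≤ lam) (hN0 : 0 ≤ N)
    (hN : N ≤ (S + lam) * r)
    (hne : Real.log (1 + R * (lam - s + 1) / (n + R * (1 + s))) ≤ e)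
    (hb : b ≤ Real.log (1 + N / n)) : b ≤ Real.log (1 + r * (S + s - 1) / n) + e := by
  have hg : 0 ≤ lam - s + 1 := by linarith
  have hS' : 0 ≤ S + s - 1 := by linarith
  have hR : 0 ≤ R := hr.trans hrR
  have h0 : 0 ≤ r * (S + s - 1) / n := by positivity
  refine hb.trans (le_trans ?_ (add_le_add_right hne _))
  have h1 : 0 ≤ R * (lam - s + 1) / (n + R * (1 + s)) := by positivity
  have h2 : 0 ≤ N / n := by positivity
  rw [← Real.log_mul (by linarith) (by linarith)]
  refine Real.log_le_log (by linarith) ?_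
  have h3 : r * (lam - s + 1) / (n + r * (S + s - 1)) ≤ R * (lam - s + 1) / (n + R * (1 + s)) := by
    rw [div_le_div_iff₀ (by positivity) (by positivity)]
    have : r * (n + R * (1 + s)) ≤ R * (n + r * (S + s - 1)) := by
      have : r * R * (1 + s) ≤ r * R * (S + s - 1) :=
        mul_le_mul_of_nonneg_left (by linarith) (by positivity)
      nlinarith
    nlinarith
  have h4 : (1 + r * (S + s - 1) / n) * (1 + r * (lam - s + 1) / (n + r * (S + s - 1)))
      = 1 + (S + lam) * r / n := by
    have : n + r * (S + s - 1) ≠ 0 := by positivity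
    field_simp
    ring
  calc 1 + N / n ≤ 1 + (S + lam) * r / n := by gcongr
    _ = _ := h4.symm
    _ ≤ _ := by gcongr

/-- `log (1 + x) ≥ h(A) + A log x`, where `h` is the binary entropy. -/
theorem binary_le_log_one_add {A x : ℝ} (hA0 : 0 < A) (hA1 : A ≤ 1) (hx : 0 < x) :
    Real.negMulLog A + Real.negMulLog (1 - A) + A * Real.log x ≤ Real.log (1 + x) := by
  have h1 := negMulLog_le_tangent (t := 1 - A) (c := 1 / (1 + x)) (by linarith) (by positivity)
  have h2 := negMulLog_le_tangent (t := A) (c := x / (1 + x)) hA0.le (by positivity)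
  rw [Real.log_div (by norm_num) (by positivity), Real.log_one] at h1
  rw [Real.log_div hx.ne' (by positivity)] at h2
  have : 1 / (1 + x) + x / (1 + x) = 1 := by field_simp
  linarith

/-- The bound on `b` is linear in `S` until S + lam reaches `m`, where it equals log (1 + ρ), and it
may be kept constant from there on. The right side is concave and increasing in `S`, so it suffices
to compare at S = 2, where `hii` enters, and at S = m - lam, where `hi` enters. -/
theorem log_one_add_mul_le_of_chord {n r ρ s S lam e b μ m D : ℝ} (hn : 0 < n) (hr : 1 ≤ r)
    (hρ : 0 < ρ) (hrρ : r ≤ 1 + ρ) (hs : 0 ≤ s) (hS : 2 ≤ S) (hlam : s - 1 ≤ lam)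
    (hm : r * m = ρ * n) (hμm : μ ≤ m) (hμ : μ ≤ S + lam) (hlam0 : 0 ≤ lam)
    (hC : Real.log (1 + ρ) * (r / ρ) ≤ Real.log r + D)
    (hb : b ≤ μ / n * (Real.log (1 + ρ) * (r / ρ)))
    (hg1 : (lam - s + 1) / n < 1)
    (hi : -Real.log (1 - (lam - s + 1) / n) ≤ e) (hA : (2 + lam) / n ≤ 1)
    (hii : (2 + lam) / n * (D - Real.log ((1 + s) / n)) ≤ Real.negMulLog ((2 + lam) / n)
      + Real.negMulLog (1 - (2 + lam) / n) + e) :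
    b ≤ Real.log (1 + r * (S + s - 1) / n) + e := by
  set C := Real.log (1 + ρ) * (r / ρ) with hCdef
  have hr0 : 0 < r := by linarith
  have hC0 : 0 ≤ C := mul_nonneg (Real.log_nonneg (by linarith)) (by positivity)
  have hm0 : 0 < m := by
    have : 0 < r * m := by rw [hm]; positivity
    exact (mul_pos_iff_of_pos_left hr0).1 this
  have hmC : m / n * C = Real.log (1 + ρ) := by
    have : m = ρ * n / r := by rw [eq_div_iff hr0.ne']; linarith
    rw [this, hCdef]; field_simp
  set g := (lam - s + 1) / n with hg
  have hg0 : 0 ≤ g := div_nonneg (by linarith) hn.le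
  -- the right end point of the chord
  have hright : ∀ S', m - lam ≤ S' → 2 ≤ S' →
      m / n * C ≤ Real.log (1 + r * (S' + s - 1) / n) + e := by
    intro S' h1 h2
    rw [hmC]
    have h3 : (1 + ρ) * (1 - g) ≤ 1 + r * (S' + s - 1) / n := by
      have h4 : r * (m - lam + s - 1) / n ≤ r * (S' + s - 1) / n := by gcongr
      have h5 : r * (m - lam + s - 1) / n = ρ - r * g := by
        rw [hg]; field_simp; linarith
      nlinarith
    have h4 := Real.log_le_log (mul_pos (by linarith) (by linarith)) h3
    rw [Real.log_mul (by linarith) (by linarith)] at h4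
    linarith
  -- At S = 2 the quantity log r cancels. It enters `hC`, and it enters log (1 + x) at x = (1 + s) r
  -- / n through the binary entropy bound, both times with weight A = (2 + lam) / n.
  have hleft : (2 + lam) / n * C ≤ Real.log (1 + r * (2 + s - 1) / n) + e := by
    have hA0 : 0 < (2 + lam) / n := by positivity
    have h1 := binary_le_log_one_add hA0 hA (x := (1 + s) / n * r) (by positivity)
    rw [Real.log_mul (by positivity) (by positivity)] at h1
    have h2 := mul_le_mul_of_nonneg_left hC hA0.le
    rw [show 1 + r * (2 + s - 1) / n = 1 + (1 + s) / n * r by field_simp; ring]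
    linarith
  rcases le_or_gt (m - lam) S with h | h
  · refine hb.trans (le_trans ?_ (hright S h hS))
    gcongr
  · refine hb.trans (le_trans (mul_le_mul_of_nonneg_right
      (div_le_div_of_nonneg_right hμ hn.le) hC0) ?_)
    have hd : 0 < m - lam - 2 := by linarith
    have hr' := hright (m - lam) le_rfl (by linarith)
    set θ := (S - 2) / (m - lam - 2) with hθ
    have hθ0 : 0 ≤ θ := div_nonneg (by linarith) hd.le
    have hθ1 : θ ≤ 1 := by rw [hθ, div_le_one hd]; linarith
    have hSθ : S = (1 - θ) * 2 + θ * (m - lam) := by rw [hθ]; field_simp; ring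
    have hx1 : 0 < 1 + r * (2 + s - 1) / n := by
      have : 0 ≤ r * (2 + s - 1) / n := div_nonneg (mul_nonneg hr0.le (by linarith)) hn.le
      linarith
    have hx2 : 0 < 1 + r * (m - lam + s - 1) / n := by
      have : 0 ≤ r * (m - lam + s - 1) / n :=
        div_nonneg (mul_nonneg hr0.le (by linarith)) hn.le
      linarith
    have hconc := strictConcaveOn_log_Ioi.concaveOn.2 (Set.mem_Ioi.2 hx1) (Set.mem_Ioi.2 hx2)
      (show 0 ≤ 1 - θ by linarith) hθ0 (by ring)
    simp only [smul_eq_mul] at hconc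
    have harg : (1 - θ) * (1 + r * (2 + s - 1) / n) + θ * (1 + r * (m - lam + s - 1) / n)
        = 1 + r * (S + s - 1) / n := by
      rw [hSθ]; field_simp; ring
    rw [harg] at hconc
    have h1 := mul_le_mul_of_nonneg_left hleft (show 0 ≤ 1 - θ by linarith)
    have h2 := mul_le_mul_of_nonneg_left hr' hθ0
    have h3 : (S + lam) / n * C = (1 - θ) * ((2 + lam) / n * C) + θ * (m / n * C) := by
      rw [hSθ]; field_simp; ring
    rw [h3]
    linarith

/-! ### Elementary inequalities for the lower confidence bound -/

/-- The derivative in s has the sign of s² (a + 1 / (1 + s)) - k, which increases in s. An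
inequality for all large s thus needs a check at `s₁` only. -/
theorem sq_log_div_add_mono {a k s s₁ : ℝ} (ha : 0 ≤ a) (hs₁ : 0 < s₁) (hs : s₁ ≤ s)
    (hk : k ≤ s₁ ^ 2 * (a + 1 / (1 + s₁))) :
    a * s₁ + k / s₁ + Real.log (1 + s₁) ≤ a * s + k / s + Real.log (1 + s) := by
  have hs0 : 0 < s := by linarith
  have h1 : (s - s₁) / (1 + s) ≤ Real.log (1 + s) - Real.log (1 + s₁) := by
    have := Real.log_le_sub_one_of_pos (x := (1 + s₁) / (1 + s)) (by positivity)
    rw [Real.log_div (by positivity) (by positivity)] at this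
    have h2 : (1 + s₁) / (1 + s) - 1 = -((s - s₁) / (1 + s)) := by field_simp; ring
    linarith
  have h2 : k / s₁ - k / s = k * (s - s₁) / (s * s₁) := by field_simp
  have h3 : k * (s - s₁) / (s * s₁) ≤ (s - s₁) * a + (s - s₁) / (1 + s) := by
    rw [div_le_iff₀ (by positivity)]
    have h4 : s₁ ^ 2 * (a + 1 / (1 + s₁)) ≤ s * s₁ * (a + 1 / (1 + s)) := by
      have h5 : s₁ * (1 / (1 + s₁)) ≤ s * (1 / (1 + s)) := by
        rw [mul_one_div, mul_one_div, div_le_div_iff₀ (by positivity) (by positivity)]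
        nlinarith
      have h6 : s₁ * a ≤ s * a := by gcongr
      nlinarith
    have h7 := mul_le_mul_of_nonneg_right (hk.trans h4) (sub_nonneg.2 hs)
    calc k * (s - s₁) ≤ _ := h7
      _ = _ := by field_simp
  nlinarith

theorem log_div_one_add_le_devGap {n : ℕ} {c s Llo Lhi zhi s₁ l lc : ℝ} (hn : 3 ≤ n) (hc : 1 ≤ c)
    (hc2 : Real.log c ≤ 2) (hlc : lc ≤ Real.log c) (hlc0 : 0 ≤ lc) (hs₁ : 1 ≤ s₁) (hs : s₁ ≤ s)
    (hLlo : Llo ≤ Real.log n) (hLhi : Real.log n ≤ Lhi) (hz : √(n : ℝ) ≤ zhi) (hL1 : 1 ≤ Llo)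
    (hl : l ≤ Real.log (1 + s₁))
    (hk : (0.32 * Llo + (Llo + 1) * lc / 4) / zhi ≤ s₁ ^ 2 * ((Llo - 1) / zhi + 1 / (1 + s₁)))
    (h : Lhi ≤ (Llo - 1) / zhi * s₁ + (0.32 * Llo + (Llo + 1) * lc / 4) / zhi / s₁ + l) :
    Real.log (n / (1 + s)) ≤ devGap c n s := by
  have hn3 : (3 : ℝ) ≤ n := by exact_mod_cast hn
  have hz0 : 0 < √(n : ℝ) := Real.sqrt_pos.2 (by linarith)
  have hzh : 0 < zhi := by linarith
  have hs0 : 0 < s := by linarith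
  refine le_trans ?_ (devGap_ge hn hc hc2 (hs₁.trans hs))
  rw [Real.log_div (by positivity) (by positivity)]
  have h1 := sq_log_div_add_mono (div_nonneg (by linarith) hzh.le) (by linarith) hs hk
  have h2 : (Llo - 1) / zhi * s ≤ s * (Real.log n - 1) / √n := by
    rw [mul_comm, ← mul_div_assoc]
    have : 0 ≤ Real.log n - 1 := by linarith
    gcongr
  have h3 : (0.32 * Llo + (Llo + 1) * lc / 4) / zhi / s
      ≤ (0.32 * Real.log n + (Real.log n + 1) * Real.log c / 4) / (s * √n) := by
    rw [div_div, mul_comm zhi]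
    have : 0 ≤ 0.32 * Real.log n + (Real.log n + 1) * Real.log c / 4 := by
      have : 0 ≤ (Real.log n + 1) * Real.log c := mul_nonneg (by linarith) (by linarith)
      linarith
    have : 0 ≤ Real.log n + 1 := by linarith
    gcongr
  linarith

/-- By AM-GM, the lower bound s P / √n + η / (s √n) of `devGap_ge`, with P = log n - 1, is at least
2 √(P η / n), whatever s is. -/
theorem one_le_devGap {n : ℕ} {c s Llo lc : ℝ} (hn : 3 ≤ n) (hc : 1 ≤ c)
    (hc2 : Real.log c ≤ 2) (hlc : lc ≤ Real.log c) (hlc0 : 0 ≤ lc) (hs : 1 ≤ s)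
    (hLlo : Llo ≤ Real.log n) (hL1 : 1 < Llo)
    (h : n ≤ 4 * (0.32 * Llo + (Llo + 1) * lc / 4) * (Llo - 1)) : 1 ≤ devGap c n s := by
  have hn3 : (3 : ℝ) ≤ n := by exact_mod_cast hn
  have hz0 : 0 < √(n : ℝ) := Real.sqrt_pos.2 (by linarith)
  refine le_trans ?_ (devGap_ge hn hc hc2 hs)
  have hs0 : 0 < s := by linarith
  have hη : 0.32 * Llo + (Llo + 1) * lc / 4
      ≤ 0.32 * Real.log n + (Real.log n + 1) * Real.log c / 4 := by
    have : 0 ≤ Real.log n + 1 := by linarith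
    gcongr
  set η := 0.32 * Real.log n + (Real.log n + 1) * Real.log c / 4
  have hη0 : 0 ≤ 0.32 * Llo + (Llo + 1) * lc / 4 := by
    have : 0 ≤ (Llo + 1) * lc := mul_nonneg (by linarith) hlc0
    linarith
  set P := Real.log n - 1 with hP
  have hP0 : 0 < P := by linarith
  have hz2 : √(n : ℝ) ^ 2 = n := Real.sq_sqrt (by linarith)
  have h1 : (n : ℝ) ≤ 4 * η * P := by
    refine h.trans ?_
    have : Llo - 1 ≤ P := by linarith
    have : 0 ≤ Llo - 1 := by linarith
    have : 0 ≤ η := hη0.trans hη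
    gcongr
  have h2 : s * P / √n + η / (s * √n) = (P * s ^ 2 + η) / (s * √n) := by field_simp
  rw [h2, one_le_div (by positivity)]
  have h3 : 4 * P * (P * s ^ 2 + η - s * √n) = (2 * P * s - √n) ^ 2 + (4 * η * P - n) := by
    linear_combination (-1) * hz2
  have h4 : 0 ≤ 4 * P * (P * s ^ 2 + η - s * √n) := by rw [h3]; nlinarith [sq_nonneg (2 * P * s - √n)]
  have h5 : 0 ≤ P * s ^ 2 + η - s * √n := nonneg_of_mul_nonneg_right h4 (by linarith)
  linarith

/-- In terms of v = 1 / (1 - A) ∈ [1, y], this says that log lies above its chord over [1, y], whose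
slope is at least `ψ`. -/
theorem negMulLog_one_sub_ge {A y ψ : ℝ} (hA0 : 0 ≤ A) (hA : A ≤ 1 - 1 / y) (hy : 1 < y)
    (hψ : ψ * (y - 1) ≤ Real.log y) : ψ * A ≤ Real.negMulLog (1 - A) := by
  have hy0 : 0 < y := by linarith
  have hx : 1 / y ≤ 1 - A := by linarith
  have hx0 : 0 < 1 - A := lt_of_lt_of_le (by positivity) hx
  set v := (1 - A)⁻¹ with hv
  have hv1 : 1 ≤ v := (one_le_inv₀ hx0).2 (by linarith)
  have hvy : v ≤ y := by
    rw [hv, inv_le_comm₀ hx0 hy0, ← one_div]; exact hx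
  have hA' : A = (v - 1) / v := by rw [hv]; field_simp; ring
  have hneg : Real.negMulLog (1 - A) = Real.log v / v := by
    rw [Real.negMulLog, hv, Real.log_inv]; field_simp
  rw [hneg, hA', ← mul_div_assoc]
  have hv0 : 0 < v := by linarith
  refine div_le_div_of_nonneg_right ?_ hv0.le
  have hy1 : 0 < y - 1 := by linarith
  have hconc := strictConcaveOn_log_Ioi.concaveOn.2 (Set.mem_Ioi.2 one_pos) (Set.mem_Ioi.2 hy0)
      (show 0 ≤ (y - v) / (y - 1) from div_nonneg (by linarith) hy1.le)
      (show 0 ≤ (v - 1) / (y - 1) from div_nonneg (by linarith) hy1.le) (by field_simp; ring)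
  simp only [smul_eq_mul, Real.log_one, mul_zero, zero_add, mul_one] at hconc
  have h1 : (y - v) / (y - 1) + (v - 1) / (y - 1) * y = v := by field_simp; ring
  rw [h1] at hconc
  calc ψ * (v - 1) = (v - 1) / (y - 1) * (ψ * (y - 1)) := by field_simp
    _ ≤ (v - 1) / (y - 1) * Real.log y :=
      mul_le_mul_of_nonneg_left hψ (div_nonneg (by linarith) hy1.le)
    _ ≤ _ := hconc

/-- The comparison at S = 2, divided by A = (2 + s √n) / n. The three contributions are separated:
`ψ` bounds the entropy term of 1 - A, `ht` turns the gap into A (log n - 1 - t), and the quotient of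
A by (1 + s) / n is √n up to a factor controlled by a tangent of log. `hsum` adds them up; `t` is
free to balance them. -/
theorem chord_left_le {n : ℕ} {s η D t y ψ e : ℝ} (hn : 0 < n) (hs : 0 < s)
    (he : s * (Real.log n - 1) / √n + η / (s * √n) ≤ e) (hy : 1 < y)
    (hψ : ψ * (y - 1) ≤ Real.log y) (hA : (2 + s * √n) / n ≤ 1 - 1 / y)
    (ht : 2 * (Real.log n - 1) ≤ η * √n / s + t * (2 + s * √n))
    (hsum : D + 1 - Real.log n / 2 ≤ (√n - 2) / (√n * (1 + s)) + ψ - t) :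
    (2 + s * √n) / n * (D - Real.log ((1 + s) / n)) ≤ Real.negMulLog ((2 + s * √n) / n)
      + Real.negMulLog (1 - (2 + s * √n) / n) + e := by
  have hn0 : (0 : ℝ) < n := by exact_mod_cast hn
  set z := √(n : ℝ) with hz
  have hz0 : 0 < z := Real.sqrt_pos.2 hn0
  have hz2 : z ^ 2 = n := Real.sq_sqrt hn0.le
  set A := (2 + s * z) / n with hAdef
  have hA0 : 0 < A := by positivity
  have h1 := negMulLog_one_sub_ge hA0.le hA hy hψ
  have hlogz : Real.log z = Real.log n / 2 := by rw [hz, Real.log_sqrt hn0.le]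
  have h2 : Real.log A - Real.log ((1 + s) / n)
      ≤ Real.log n / 2 - (z - 2) / (z * (1 + s)) := by
    rw [← Real.log_div (by positivity) (by positivity)]
    have h3 : A / ((1 + s) / n) = z * ((2 + s * z) / (z * (1 + s))) := by
      rw [hAdef]; field_simp
    rw [h3, Real.log_mul (by positivity) (by positivity), hlogz]
    have := Real.log_le_sub_one_of_pos (x := (2 + s * z) / (z * (1 + s))) (by positivity)
    have h4 : (2 + s * z) / (z * (1 + s)) - 1 = -((z - 2) / (z * (1 + s))) := by
      field_simp; ring
    linarith
  have h5 : A * (Real.log n - 1 - t) ≤ e := by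
    refine le_trans ?_ he
    have h6 : s * (Real.log n - 1) / z + η / (s * z)
      = (s * z * (Real.log n - 1) + η * z / s) / z ^ 2 := by field_simp
    rw [h6, hAdef, div_mul_eq_mul_div, hz2]
    refine div_le_div_of_nonneg_right ?_ (by positivity)
    linarith
  have h7 : A * (D + (Real.log A - Real.log ((1 + s) / n))) ≤ A * (ψ + (Real.log n - 1 - t)) :=
    mul_le_mul_of_nonneg_left (by linarith) hA0.le
  have h8 : Real.negMulLog A = -(A * Real.log A) := by rw [Real.negMulLog]; ring
  rw [h8]
  linarith

/-- This is x ≤ sinh x at x = log y / 2. -/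
theorem log_le_sub_one_div_sqrt {y : ℝ} (hy : 1 ≤ y) : Real.log y ≤ (y - 1) / √y := by
  have hy0 : 0 < y := by linarith
  have h1 := Real.self_le_sinh_iff.2 (show 0 ≤ Real.log y / 2 from by
    have := Real.log_nonneg hy; linarith)
  rw [Real.sinh_eq, Real.exp_neg] at h1
  have h2 : Real.exp (Real.log y / 2) = √y := by
    rw [← Real.log_sqrt hy0.le, Real.exp_log (Real.sqrt_pos.2 hy0)]
  rw [h2] at h1
  have h3 : (y - 1) / √y = √y - (√y)⁻¹ := by
    have := Real.sqrt_pos.2 hy0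
    field_simp
    rw [Real.sq_sqrt hy0.le]
  linarith

theorem log_le_of_sq_le {y v : ℝ} (hy : 1 ≤ y) (hv : 0 ≤ v) (h : (y - 1) ^ 2 ≤ v ^ 2 * y) :
    Real.log y ≤ v := by
  refine (log_le_sub_one_div_sqrt hy).trans ?_
  have hy0 : 0 < y := by linarith
  rw [div_le_iff₀ (Real.sqrt_pos.2 hy0)]
  refine le_of_sq_le_sq ?_ (by positivity)
  rwa [mul_pow, Real.sq_sqrt hy0.le]

/-! ### The bias is covered by the bias correction, up to the difference of the widths -/

/-- What is known about the bias `b` of the plug-in estimator with `n` samples, the support size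
`N`, the number `μ` that bounds the mean of the support size estimator from below, and the estimate
`S` itself. -/
structure BiasBounds (n : ℕ) (κ s S b μ N : ℝ) : Prop where
  κ_pos : 0 < κ
  one_le_s : 1 ≤ s
  two_le_S : 2 ≤ S
  N_nonneg : 0 ≤ N
  b_le_N : b ≤ Real.log (1 + N / n)
  b_le_κ : b ≤ Real.log (1 + κ / n)
  b_le_μ : (n : ℝ) / κ ≤ 1 / 2 → b ≤ μ / n *
    ((n : ℝ) / κ * Real.log (1 + 1 / ((n : ℝ) / κ)) * (1 - Real.exp (-((n : ℝ) / κ)))⁻¹)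
  N_le : N ≤ μ * (1 - Real.exp (-((n : ℝ) / κ)))⁻¹
  μ_le : μ ≤ κ / (1 - Real.exp (-((n : ℝ) / κ)))⁻¹
  μ_le_S : 7 ≤ n → μ ≤ S + s * √n

theorem one_div_le_inv_one_sub_exp_neg {u : ℝ} (hu : 0 < u) :
    1 / u ≤ (1 - Real.exp (-u))⁻¹ := by
  linarith [one_div_add_half_le hu]

theorem inv_one_sub_exp_neg_anti {u v : ℝ} (hu : 0 < u) (huv : u ≤ v) :
    (1 - Real.exp (-v))⁻¹ ≤ (1 - Real.exp (-u))⁻¹ := by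
  have hd : 0 < 1 - Real.exp (-u) :=
    lt_of_lt_of_le (by positivity) (one_sub_exp_neg_ge hu.le)
  refine inv_anti₀ hd ?_
  have := Real.exp_le_exp.2 (neg_le_neg huv)
  linarith

theorem log_one_add_mul_sub_one_le {n r s S : ℝ} (hn : 0 < n) (hr : 1 ≤ r) (hs : 0 ≤ s)
    (hS : 1 ≤ S) :
    Real.log (1 + r * (S + s - 1) / n) ≤ Real.log (1 + 1 / n * ((S + s) * r - 1)) := by
  have h0 : 0 ≤ r * (S + s - 1) / n :=
    div_nonneg (mul_nonneg (by linarith) (by linarith)) hn.le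
  refine Real.log_le_log (by linarith) ?_
  rw [one_div_mul_eq_div]
  gcongr
  nlinarith

theorem BiasBounds.le_of_log_le {n : ℕ} {κ s S b μ N e : ℝ} (h : BiasBounds n κ s S b μ N)
    (hn : 0 < n) (he : 0 ≤ e) (hne : Real.log (n / (1 + s)) ≤ e) :
    b ≤ Real.log (1 + 1 / n * ((S + s) * (1 - Real.exp (-((n : ℝ) / κ)))⁻¹ - 1)) + e := by
  have hn0 : (0 : ℝ) < n := by exact_mod_cast hn
  have hκ := h.κ_pos
  have hs := h.one_le_s
  have hS := h.two_le_S
  have hu : 0 < (n : ℝ) / κ := by positivity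
  have h1 := one_div_le_inv_one_sub_exp_neg hu
  rw [one_div_div] at h1
  have h2 := log_one_add_mul_sub_one_le hn0 (one_le_inv_one_sub_exp_neg hu)
    (show 0 ≤ s by linarith) (show 1 ≤ S by linarith)
  have h3 := log_one_add_mul_le_of_log_le hn0 (by positivity) h1 (show 0 ≤ s by linarith) hS he
    hne h.b_le_κ
  linarith

/-- Three regimes. `hT` serves s ≥ x₁ √n. Below that threshold, `hJ` serves n / κ ≥ u₀, where the
inverse factor is at most `R`, while `hi` and `hii` are the right and left end points of the chord
for n / κ < u₀. -/
theorem BiasBounds.le_of_conditions {n : ℕ} {κ s S b μ N e u₀ D R x₁ : ℝ}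
    (h : BiasBounds n κ s S b μ N) (hn : 7 ≤ n) (he : 0 ≤ e) (hu₀ : 0 < u₀) (hu₀2 : u₀ ≤ 1 / 2)
    (hD : ∀ u : ℝ, 0 < u → u ≤ u₀ → u * Real.log (1 + 1 / u) * (1 - Real.exp (-u))⁻¹
      ≤ Real.log ((1 - Real.exp (-u))⁻¹) + D)
    (hR : (1 - Real.exp (-u₀))⁻¹ ≤ R)
    (hT : x₁ * √n ≤ s → Real.log (n / (1 + s)) ≤ e)
    (hJ : s < x₁ * √n → Real.log (1 + R * (s * √n - s + 1) / (n + R * (1 + s))) ≤ e)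
    (hi : s < x₁ * √n → (s * √n - s + 1) / n < 1 ∧
      -Real.log (1 - (s * √n - s + 1) / n) ≤ e)
    (hii : s < x₁ * √n → (2 + s * √n) / n ≤ 1 ∧ (2 + s * √n) / n * (D - Real.log ((1 + s) / n))
      ≤ Real.negMulLog ((2 + s * √n) / n) + Real.negMulLog (1 - (2 + s * √n) / n) + e) :
    b ≤ Real.log (1 + 1 / n * ((S + s) * (1 - Real.exp (-((n : ℝ) / κ)))⁻¹ - 1)) + e := by
  rcases le_or_gt (x₁ * √n) s with hx | hx
  · exact h.le_of_log_le (by omega) he (hT hx)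
  have hn0 : (1 : ℝ) ≤ n := by exact_mod_cast (by omega : 1 ≤ n)
  have hz1 : 1 ≤ √(n : ℝ) := Real.one_le_sqrt.2 hn0
  have hκ := h.κ_pos
  have hs := h.one_le_s
  have hS := h.two_le_S
  have hu : 0 < (n : ℝ) / κ := by positivity
  have hr1 := one_le_inv_one_sub_exp_neg hu
  have h2 := log_one_add_mul_sub_one_le (show (0 : ℝ) < n by linarith) hr1
    (show 0 ≤ s by linarith) (show 1 ≤ S by linarith)
  have hlam : s - 1 ≤ s * √n := by nlinarith
  refine le_trans ?_ (add_le_add_left h2 e)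
  rcases le_or_gt u₀ ((n : ℝ) / κ) with hc | hc
  · refine log_one_add_mul_le_of_ratio (by linarith) (by linarith)
      ((inv_one_sub_exp_neg_anti hu₀ hc).trans hR) (by linarith) hS hlam h.N_nonneg ?_ (hJ hx)
      h.b_le_N
    exact h.N_le.trans (mul_le_mul_of_nonneg_right (h.μ_le_S hn) (by linarith))
  · have hDu := hD _ hu hc.le
    have hbμ := h.b_le_μ (hc.le.trans hu₀2)
    have hr2 := inv_one_sub_exp_neg_le_one_add hu
    set r := (1 - Real.exp (-((n : ℝ) / κ)))⁻¹
    have hC : (n : ℝ) / κ * Real.log (1 + 1 / ((n : ℝ) / κ)) * r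
        = Real.log (1 + κ / n) * (r / (κ / n)) := by
      rw [one_div_div]; field_simp
    rw [hC] at hDu hbμ
    rw [one_div_div] at hr2
    obtain ⟨hi1, hi2⟩ := hi hx
    obtain ⟨hii1, hii2⟩ := hii hx
    exact log_one_add_mul_le_of_chord (by linarith) hr1 (by positivity) hr2 (by linarith) hS hlam
      (m := κ / r) (by have : r ≠ 0 := by linarith
                       field_simp) h.μ_le (h.μ_le_S hn) (by positivity) hDu hbμ hi1 hi2 hii1 hii2

/-! ### Numerical verification for two to fifteen samples -/

set_option exponentiation.threshold 600 in
theorem log_five_three_ge : 537 / 322 ≤ Real.log 5.3 := by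
  refine le_trans (by norm_num) (le_log_of_pow_le (m := 537) (k := 322) (by norm_num)
    (by norm_num) (by norm_num))

theorem log_five_three_le : Real.log 5.3 ≤ 2 := by
  refine (log_le_of_le_pow (m := 2) (k := 1) (by norm_num) (by norm_num)
    (by norm_num)).trans (by norm_num)

theorem sqrt_le_sqrt_log {n : ℕ} {s q : ℝ} (hs0 : 0 ≤ s) (hs : Real.log (n + 1) ≤ s ^ 2)
    (hq : q ^ 2 ≤ Real.log (n + 1)) : q ≤ s :=
  le_of_sq_le_sq (hq.trans hs) hs0

theorem devGap_nonneg_two {s : ℝ} : 0 ≤ devGap 1 2 s := by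
  have h1 : plugInDiff 2 * √(s ^ 2 - Real.log 1 / 2)
      ≤ 2 * Real.log (2 : ℕ) * √(s ^ 2 + Real.log 2 / 2) := by
    have h2 := Real.log_two_gt_d9
    refine mul_le_mul (min_le_left _ _) (Real.sqrt_le_sqrt ?_) (Real.sqrt_nonneg _)
      (by push_cast; linarith)
    simp; linarith
  rw [devGap, ← sub_div]
  exact div_nonneg (sub_nonneg.2 h1) (Real.sqrt_nonneg _)

theorem BiasBounds.le_two {κ s S b μ N : ℝ} (h : BiasBounds 2 κ s S b μ N) :
    b ≤ Real.log (1 + 1 / (2 : ℕ) * ((S + s) * (1 - Real.exp (-(((2 : ℕ) : ℝ) / κ)))⁻¹ - 1))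
      + devGap 1 2 s := by
  refine h.le_of_log_le (by norm_num) devGap_nonneg_two ?_
  refine le_trans ?_ devGap_nonneg_two
  have := h.one_le_s
  refine Real.log_nonpos (by positivity) ?_
  rw [div_le_one (by linarith)]
  push_cast; linarith

/-- From three to six samples the first regime covers every admissible s: the number in `hs₁` is a
rational lower bound for √(log (n + 1)), and the other fractions bracket log n, √n and log (1 + s₁).
From n = 4 on, c = 5.3 enlarges the gap at the price of a failure probability of 5.3 δ. -/
theorem BiasBounds.le_three {κ s S b μ N : ℝ} (h : BiasBounds 3 κ s S b μ N)
    (hs : Real.log ((3 : ℕ) + 1) ≤ s ^ 2) :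
    b ≤ Real.log (1 + 1 / (3 : ℕ) * ((S + s) * (1 - Real.exp (-(((3 : ℕ) : ℝ) / κ)))⁻¹ - 1))
      + devGap 2 3 s := by
  have hs1 := h.one_le_s
  have hs₁ : 1177/1000 ≤ s := by
    refine sqrt_le_sqrt_log (by linarith) hs (le_trans ?_ (le_log_of_pow_le (m := 79) (k := 57) (by norm_num) (by norm_num) (by norm_num)))
    norm_num
  have hLlo : 56/51 ≤ Real.log (3 : ℕ) := le_trans (by norm_num)
    (le_log_of_pow_le (m := 56) (k := 51) (by norm_num) (by norm_num) (by norm_num))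
  have hLhi : Real.log (3 : ℕ) ≤ 89/81 := le_trans
    (log_le_of_le_pow (m := 89) (k := 81) (by norm_num) (by norm_num) (by norm_num)) (by norm_num)
  have hl := le_log_of_pow_le (q := 1 + 1177/1000) (m := 7) (k := 9) (by norm_num) (by norm_num)
    (by norm_num)
  have hz : √((3 : ℕ) : ℝ) ≤ 1733/1000 := (Real.sqrt_le_left (by norm_num)).2 (by norm_num)
  have hlc : 69 / 100 ≤ Real.log 2 := by linarith [Real.log_two_gt_d9]
  have hlc2 : Real.log 2 ≤ 2 := by linarith [Real.log_two_lt_d9]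
  refine h.le_of_log_le (by norm_num) ?_ (log_div_one_add_le_devGap (by norm_num) (by norm_num)
    hlc2 hlc (by norm_num) (by norm_num) hs₁ hLlo hLhi hz (by norm_num) hl (by norm_num)
    (by norm_num))
  refine le_trans ?_ (devGap_ge (by norm_num) (by norm_num) hlc2 hs1)
  have h1 : 0 ≤ Real.log (3 : ℕ) - 1 := sub_nonneg.2 (le_trans (by norm_num) hLlo)
  have h2 : 0 ≤ Real.log 2 := by linarith
  have h3 : 0 ≤ Real.log (3 : ℕ) := le_trans (by norm_num) hLlo
  positivity

theorem BiasBounds.le_four {κ s S b μ N : ℝ} (h : BiasBounds 4 κ s S b μ N)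
    (hs : Real.log ((4 : ℕ) + 1) ≤ s ^ 2) :
    b ≤ Real.log (1 + 1 / (4 : ℕ) * ((S + s) * (1 - Real.exp (-(((4 : ℕ) : ℝ) / κ)))⁻¹ - 1))
      + devGap 5.3 4 s := by
  have hs1 := h.one_le_s
  have hs₁ : 317/250 ≤ s := by
    refine sqrt_le_sqrt_log (by linarith) hs (le_trans ?_ (le_log_of_pow_le (m := 37) (k := 23) (by norm_num) (by norm_num) (by norm_num)))
    norm_num
  have hLlo : 18/13 ≤ Real.log (4 : ℕ) := le_trans (by norm_num)
    (le_log_of_pow_le (m := 18) (k := 13) (by norm_num) (by norm_num) (by norm_num))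
  have hLhi : Real.log (4 : ℕ) ≤ 43/31 := le_trans
    (log_le_of_le_pow (m := 43) (k := 31) (by norm_num) (by norm_num) (by norm_num)) (by norm_num)
  have hl := le_log_of_pow_le (q := 1 + 317/250) (m := 9) (k := 11) (by norm_num) (by norm_num)
    (by norm_num)
  have hz : √((4 : ℕ) : ℝ) ≤ 2 := (Real.sqrt_le_left (by norm_num)).2 (by norm_num)
  have hlc : 537 / 322 ≤ Real.log 5.3 := log_five_three_ge
  have hlc2 : Real.log 5.3 ≤ 2 := log_five_three_le
  refine h.le_of_log_le (by norm_num) ?_ (log_div_one_add_le_devGap (by norm_num) (by norm_num)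
    hlc2 hlc (by norm_num) (by norm_num) hs₁ hLlo hLhi hz (by norm_num) hl (by norm_num)
    (by norm_num))
  refine le_trans ?_ (devGap_ge (by norm_num) (by norm_num) hlc2 hs1)
  have h1 : 0 ≤ Real.log (4 : ℕ) - 1 := sub_nonneg.2 (le_trans (by norm_num) hLlo)
  have h2 : 0 ≤ Real.log 5.3 := by linarith
  have h3 : 0 ≤ Real.log (4 : ℕ) := le_trans (by norm_num) hLlo
  positivity

theorem BiasBounds.le_five {κ s S b μ N : ℝ} (h : BiasBounds 5 κ s S b μ N)
    (hs : Real.log ((5 : ℕ) + 1) ≤ s ^ 2) :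
    b ≤ Real.log (1 + 1 / (5 : ℕ) * ((S + s) * (1 - Real.exp (-(((5 : ℕ) : ℝ) / κ)))⁻¹ - 1))
      + devGap 5.3 5 s := by
  have hs1 := h.one_le_s
  have hs₁ : 669/500 ≤ s := by
    refine sqrt_le_sqrt_log (by linarith) hs (le_trans ?_ (le_log_of_pow_le (m := 43) (k := 24) (by norm_num) (by norm_num) (by norm_num)))
    norm_num
  have hLlo : 37/23 ≤ Real.log (5 : ℕ) := le_trans (by norm_num)
    (le_log_of_pow_le (m := 37) (k := 23) (by norm_num) (by norm_num) (by norm_num))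
  have hLhi : Real.log (5 : ℕ) ≤ 29/18 := le_trans
    (log_le_of_le_pow (m := 29) (k := 18) (by norm_num) (by norm_num) (by norm_num)) (by norm_num)
  have hl := le_log_of_pow_le (q := 1 + 669/500) (m := 28) (k := 33) (by norm_num) (by norm_num)
    (by norm_num)
  have hz : √((5 : ℕ) : ℝ) ≤ 2237/1000 := (Real.sqrt_le_left (by norm_num)).2 (by norm_num)
  have hlc : 537 / 322 ≤ Real.log 5.3 := log_five_three_ge
  have hlc2 : Real.log 5.3 ≤ 2 := log_five_three_le
  refine h.le_of_log_le (by norm_num) ?_ (log_div_one_add_le_devGap (by norm_num) (by norm_num)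
    hlc2 hlc (by norm_num) (by norm_num) hs₁ hLlo hLhi hz (by norm_num) hl (by norm_num)
    (by norm_num))
  refine le_trans ?_ (devGap_ge (by norm_num) (by norm_num) hlc2 hs1)
  have h1 : 0 ≤ Real.log (5 : ℕ) - 1 := sub_nonneg.2 (le_trans (by norm_num) hLlo)
  have h2 : 0 ≤ Real.log 5.3 := by linarith
  have h3 : 0 ≤ Real.log (5 : ℕ) := le_trans (by norm_num) hLlo
  positivity

theorem BiasBounds.le_six {κ s S b μ N : ℝ} (h : BiasBounds 6 κ s S b μ N)
    (hs : Real.log ((6 : ℕ) + 1) ≤ s ^ 2) :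
    b ≤ Real.log (1 + 1 / (6 : ℕ) * ((S + s) * (1 - Real.exp (-(((6 : ℕ) : ℝ) / κ)))⁻¹ - 1))
      + devGap 5.3 6 s := by
  have hs1 := h.one_le_s
  have hs₁ : 697/500 ≤ s := by
    refine sqrt_le_sqrt_log (by linarith) hs (le_trans ?_ (le_log_of_pow_le (m := 251) (k := 129) (by norm_num) (by norm_num) (by norm_num)))
    norm_num
  have hLlo : 43/24 ≤ Real.log (6 : ℕ) := le_trans (by norm_num)
    (le_log_of_pow_le (m := 43) (k := 24) (by norm_num) (by norm_num) (by norm_num))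
  have hLhi : Real.log (6 : ℕ) ≤ 52/29 := le_trans
    (log_le_of_le_pow (m := 52) (k := 29) (by norm_num) (by norm_num) (by norm_num)) (by norm_num)
  have hl := le_log_of_pow_le (q := 1 + 697/500) (m := 27) (k := 31) (by norm_num) (by norm_num)
    (by norm_num)
  have hz : √((6 : ℕ) : ℝ) ≤ 49/20 := (Real.sqrt_le_left (by norm_num)).2 (by norm_num)
  have hlc : 537 / 322 ≤ Real.log 5.3 := log_five_three_ge
  have hlc2 : Real.log 5.3 ≤ 2 := log_five_three_le
  refine h.le_of_log_le (by norm_num) ?_ (log_div_one_add_le_devGap (by norm_num) (by norm_num)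
    hlc2 hlc (by norm_num) (by norm_num) hs₁ hLlo hLhi hz (by norm_num) hl (by norm_num)
    (by norm_num))
  refine le_trans ?_ (devGap_ge (by norm_num) (by norm_num) hlc2 hs1)
  have h1 : 0 ≤ Real.log (6 : ℕ) - 1 := sub_nonneg.2 (le_trans (by norm_num) hLlo)
  have h2 : 0 ≤ Real.log 5.3 := by linarith
  have h3 : 0 ≤ Real.log (6 : ℕ) := le_trans (by norm_num) hLlo
  positivity

-- `c1` and `c2` settle large s. `c3` gives a gap of at least 1, enough for the second regime, where
-- the argument of the logarithm stays below e, and, with `c4`, for the right end of the chord,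
-- since 0.632 is below 1 - 1/e. `c5` to `c8` settle the left end; both `c6` and `c7` are needed
-- because `t` may have either sign.
set_option maxHeartbeats 800000 in
theorem BiasBounds.le_mid {n : ℕ} {κ s S b μ N Llo Lhi zlo zhi s₁ l x₁ y ψ t : ℝ}
    (h : BiasBounds n κ s S b μ N) (hn : 7 ≤ n) (hLlo : Llo ≤ Real.log n)
    (hLhi : Real.log n ≤ Lhi) (hzlo : zlo ^ 2 ≤ n) (hzhi : (n : ℝ) ≤ zhi ^ 2) (hzhi0 : 0 ≤ zhi)
    (hzlo2 : 2 ≤ zlo) (hzhi2 : zhi ≤ 3.873) (hL1 : 1 < Llo) (hx₁0 : 0 < x₁) (hx₁ : x₁ ≤ 0.75)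
    (hs₁1 : 1 ≤ s₁) (hs₁ : s₁ ≤ x₁ * zlo) (hl : l ≤ Real.log (1 + s₁)) (hy : 1 < y)
    (hψ : ψ * (y - 1) ≤ Real.log y)
    (c1 : (0.32 * Llo + (Llo + 1) * (537 / 322) / 4) / zhi
      ≤ s₁ ^ 2 * ((Llo - 1) / zhi + 1 / (1 + s₁)))
    (c2 : Lhi ≤ (Llo - 1) / zhi * s₁
      + (0.32 * Llo + (Llo + 1) * (537 / 322) / 4) / zhi / s₁ + l)
    (c3 : n ≤ 4 * (0.32 * Llo + (Llo + 1) * (537 / 322) / 4) * (Llo - 1))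
    (c4 : x₁ * n - x₁ * zlo + 1 ≤ 0.632 * n)
    (c5 : (2 + x₁ * n) / n ≤ 1 - 1 / y)
    (c6 : 2 * (Lhi - 1) ≤ (0.32 * Llo + (Llo + 1) * (537 / 322) / 4) / x₁ + t * (2 + zlo))
    (c7 : 2 * (Lhi - 1) ≤ (0.32 * Llo + (Llo + 1) * (537 / 322) / 4) / x₁ + t * (2 + x₁ * n))
    (c8 : 0.32 + 1 - Llo / 2 ≤ (zlo - 2) / (zlo * (1 + x₁ * zhi)) + ψ - t) :
    b ≤ Real.log (1 + 1 / n * ((S + s) * (1 - Real.exp (-((n : ℝ) / κ)))⁻¹ - 1))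
      + devGap 5.3 n s := by
  have hn7 : (7 : ℝ) ≤ n := by exact_mod_cast hn
  have hz1 : zlo ≤ √(n : ℝ) := Real.le_sqrt_of_sq_le hzlo
  have hz2 : √(n : ℝ) ≤ zhi := (Real.sqrt_le_left hzhi0).2 hzhi
  have hzz : √(n : ℝ) ^ 2 = n := Real.sq_sqrt (by linarith)
  have hs := h.one_le_s
  have hlc := log_five_three_ge
  have hlc2 := log_five_three_le
  have he1 : 1 ≤ devGap 5.3 n s := one_le_devGap (by omega) (by norm_num) hlc2 hlc (by norm_num)
    hs hLlo hL1 c3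
  have hge := devGap_ge (n := n) (by omega) (by norm_num) hlc2 hs
  have hη : 0.32 * Llo + (Llo + 1) * (537 / 322) / 4
      ≤ 0.32 * Real.log n + (Real.log n + 1) * Real.log 5.3 / 4 := by
    have : 0 ≤ Real.log n + 1 := by linarith
    gcongr
  have hη0 : 0 ≤ 0.32 * Llo + (Llo + 1) * (537 / 322) / 4 := by linarith
  set z := √(n : ℝ) with hz
  set η := 0.32 * Real.log n + (Real.log n + 1) * Real.log 5.3 / 4
  set η₀ := 0.32 * Llo + (Llo + 1) * (537 / 322) / 4
  have hxz : ∀ {s : ℝ}, s < x₁ * z → s * z ≤ x₁ * n := fun {s} hx => by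
    rw [← hzz]
    calc s * z ≤ x₁ * z * z := mul_le_mul_of_nonneg_right hx.le (by linarith)
      _ = _ := by ring
  -- 4.53 exceeds 4 (1 + 1/8 + 1/160), the bound of `inv_one_sub_exp_neg_le` at u = 1/4.
  refine h.le_of_conditions (u₀ := 1 / 4) (D := 0.32) (R := 4.53) (x₁ := x₁) (by omega)
    (by linarith) (by norm_num) (by norm_num) (fun u => chord_sub_log_le_of_le_quarter) ?_
    (fun hx => ?_) (fun hx => ?_) (fun hx => ?_) (fun hx => ?_)
  · have := inv_one_sub_exp_neg_le (u := 1 / 4) (by norm_num) (by norm_num)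
    norm_num at this ⊢
    linarith
  · refine log_div_one_add_le_devGap (by omega) (by norm_num) hlc2 hlc (by norm_num) hs₁1
      (hs₁.trans (le_trans ?_ hx)) hLlo hLhi hz2 hL1.le hl c1 c2
    gcongr
  · refine le_trans ?_ he1
    have h1 : s * (z - 2.718) ≤ 2.90475 * 1.155 := by
      have h2 : s ≤ 2.90475 := by
        have : x₁ * z ≤ 0.75 * 3.873 := by gcongr; linarith
        linarith
      calc s * (z - 2.718) ≤ s * 1.155 := by gcongr; linarith
        _ ≤ _ := by gcongr
    have h3 : 0 < (n : ℝ) + 4.53 * (1 + s) := by positivity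
    have h4 : 4.53 * (s * z - s + 1) / (n + 4.53 * (1 + s)) ≤ 1.718 := by
      rw [div_le_iff₀ h3]; linarith
    have h5 : 0 ≤ 4.53 * (s * z - s + 1) / (n + 4.53 * (1 + s)) := by
      refine div_nonneg ?_ h3.le
      have : s * 1 ≤ s * z := mul_le_mul_of_nonneg_left (by linarith) (by linarith)
      linarith
    rw [Real.log_le_iff_le_exp (by linarith)]
    linarith [Real.exp_one_gt_d9]
  · have h1 : (s * z - s + 1) / n ≤ 0.632 := by
      rw [div_le_iff₀ (by linarith)]
      have h1 : s * (z - 1) ≤ x₁ * z * (z - 1) :=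
        mul_le_mul_of_nonneg_right hx.le (by linarith)
      have h2 : x₁ * zlo ≤ x₁ * z := by gcongr
      have h3 : x₁ * z * (z - 1) = x₁ * n - x₁ * z := by rw [← hzz]; ring
      linarith
    refine ⟨by linarith, le_trans ?_ he1⟩
    have h2 : Real.exp (-1) ≤ 1 - (s * z - s + 1) / n := by
      refine le_trans ?_ (show (0.368 : ℝ) ≤ _ by linarith)
      rw [Real.exp_neg, inv_le_comm₀ (Real.exp_pos 1) (by norm_num)]
      refine le_trans ?_ Real.exp_one_gt_d9.le
      norm_num
    have := (Real.le_log_iff_exp_le (by linarith)).2 h2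
    linarith
  · have h1 : (2 + s * z) / n ≤ (2 + x₁ * n) / n := by
      have := hxz hx; gcongr
    have hy0 : 0 < 1 / y := by positivity
    refine ⟨by linarith, ?_⟩
    have hxs : s / z ≤ x₁ := by rw [div_le_iff₀ (by linarith)]; exact hx.le
    refine chord_left_le (t := t) (by omega) (by linarith) hge hy hψ (h1.trans c5) ?_ ?_
    · have h2 : η₀ / x₁ ≤ η * z / s := by
        rw [mul_div_assoc, div_eq_mul_inv]
        refine mul_le_mul hη ?_ (by positivity) (by linarith)
        rw [← inv_div s z]
        exact inv_anti₀ (by positivity) hxs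
      have h3 : min (t * (2 + zlo)) (t * (2 + x₁ * n)) ≤ t * (2 + s * z) := by
        have h4 := hxz hx
        have h5 : zlo ≤ s * z := hz1.trans (le_mul_of_one_le_left (by linarith) hs)
        rcases le_total 0 t with ht | ht
        · exact (min_le_left _ _).trans (mul_le_mul_of_nonneg_left (by linarith) ht)
        · exact (min_le_right _ _).trans (mul_le_mul_of_nonpos_left (by linarith) ht)
      rcases min_choice (t * (2 + zlo)) (t * (2 + x₁ * n)) with hm | hm <;> rw [hm] at h3 <;>
        linarith
    · have h2 : (zlo - 2) / (zlo * (1 + x₁ * zhi)) ≤ (z - 2) / (z * (1 + s)) := by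
        rw [← div_div, ← div_div]
        have h3 : (zlo - 2) / zlo ≤ (z - 2) / z := by
          rw [div_le_div_iff₀ (by linarith) (by linarith)]; nlinarith
        have h4 : s ≤ x₁ * zhi := hx.le.trans (by gcongr)
        have h5 : 0 ≤ (z - 2) / z := div_nonneg (by linarith) (by linarith)
        gcongr
      linarith

set_option exponentiation.threshold 600 in
theorem log_sixteen_ge : 277 / 1500 * (16 - 1) ≤ Real.log 16 :=
  le_trans (by norm_num) (le_log_of_pow_le (m := 277) (k := 100) (by norm_num) (by norm_num)
    (by norm_num))

theorem log_twenty_ge : 3 / 20 * (20 - 1) ≤ Real.log 20 :=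
  le_trans (by norm_num) (le_log_of_pow_le (m := 20) (k := 7) (by norm_num) (by norm_num)
    (by norm_num))

theorem BiasBounds.le_of_seven_le_of_le_fifteen {n : ℕ} {κ s S b μ N : ℝ}
    (h : BiasBounds n κ s S b μ N) (hn : 7 ≤ n) (hn15 : n ≤ 15) :
    b ≤ Real.log (1 + 1 / n * ((S + s) * (1 - Real.exp (-((n : ℝ) / κ)))⁻¹ - 1))
      + devGap 5.3 n s := by
  interval_cases n
  · exact h.le_mid (zlo := 529/200) (zhi := 1323/500) (s₁ := 1719/1000) (x₁ := 13/20) (y := 16)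
      (ψ := 277/1500) (t := -11/100) (by norm_num)
      (le_log_of_pow_le (m := 251) (k := 129) (by norm_num) (by norm_num) (by norm_num))
      (log_le_of_le_pow (m := 72) (k := 37) (by norm_num) (by norm_num) (by norm_num))
      (by norm_num) (by norm_num) (by norm_num) (by norm_num) (by norm_num) (by norm_num)
      (by norm_num) (by norm_num) (by norm_num) (by norm_num)
      (le_log_of_pow_le (m := 1) (k := 1) (by norm_num) (by norm_num) (by norm_num))
      (by norm_num) log_sixteen_ge (by norm_num) (by norm_num) (by norm_num) (by norm_num)
      (by norm_num) (by norm_num) (by norm_num) (by norm_num)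
  · exact h.le_mid (zlo := 707/250) (zhi := 2829/1000) (s₁ := 1979/1000) (x₁ := 7/10) (y := 20)
      (ψ := 3/20) (t := -1/25) (by norm_num)
      (le_log_of_pow_le (m := 79) (k := 38) (by norm_num) (by norm_num) (by norm_num))
      (log_le_of_le_pow (m := 52) (k := 25) (by norm_num) (by norm_num) (by norm_num))
      (by norm_num) (by norm_num) (by norm_num) (by norm_num) (by norm_num) (by norm_num)
      (by norm_num) (by norm_num) (by norm_num) (by norm_num)
      (le_log_of_pow_le (m := 12) (k := 11) (by norm_num) (by norm_num) (by norm_num))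
      (by norm_num) log_twenty_ge (by norm_num) (by norm_num) (by norm_num) (by norm_num)
      (by norm_num) (by norm_num) (by norm_num) (by norm_num)
  · exact h.le_mid (zlo := 3) (zhi := 3) (s₁ := 2099/1000) (x₁ := 7/10) (y := 16)
      (ψ := 277/1500) (t := 0) (by norm_num)
      (le_log_of_pow_le (m := 123) (k := 56) (by norm_num) (by norm_num) (by norm_num))
      (log_le_of_le_pow (m := 167) (k := 76) (by norm_num) (by norm_num) (by norm_num))
      (by norm_num) (by norm_num) (by norm_num) (by norm_num) (by norm_num) (by norm_num)
      (by norm_num) (by norm_num) (by norm_num) (by norm_num)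
      (le_log_of_pow_le (m := 26) (k := 23) (by norm_num) (by norm_num) (by norm_num))
      (by norm_num) log_sixteen_ge (by norm_num) (by norm_num) (by norm_num) (by norm_num)
      (by norm_num) (by norm_num) (by norm_num) (by norm_num)
  · exact h.le_mid (zlo := 1581/500) (zhi := 3163/1000) (s₁ := 2213/1000) (x₁ := 7/10) (y := 16)
      (ψ := 277/1500) (t := 0) (by norm_num)
      (le_log_of_pow_le (m := 99) (k := 43) (by norm_num) (by norm_num) (by norm_num))
      (log_le_of_le_pow (m := 76) (k := 33) (by norm_num) (by norm_num) (by norm_num))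
      (by norm_num) (by norm_num) (by norm_num) (by norm_num) (by norm_num) (by norm_num)
      (by norm_num) (by norm_num) (by norm_num) (by norm_num)
      (le_log_of_pow_le (m := 7) (k := 6) (by norm_num) (by norm_num) (by norm_num))
      (by norm_num) log_sixteen_ge (by norm_num) (by norm_num) (by norm_num) (by norm_num)
      (by norm_num) (by norm_num) (by norm_num) (by norm_num)
  · exact h.le_mid (zlo := 829/250) (zhi := 3317/1000) (s₁ := 2321/1000) (x₁ := 7/10) (y := 16)
      (ψ := 277/1500) (t := 0) (by norm_num)
      (le_log_of_pow_le (m := 163) (k := 68) (by norm_num) (by norm_num) (by norm_num))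
      (log_le_of_le_pow (m := 235) (k := 98) (by norm_num) (by norm_num) (by norm_num))
      (by norm_num) (by norm_num) (by norm_num) (by norm_num) (by norm_num) (by norm_num)
      (by norm_num) (by norm_num) (by norm_num) (by norm_num)
      (le_log_of_pow_le (m := 6) (k := 5) (by norm_num) (by norm_num) (by norm_num))
      (by norm_num) log_sixteen_ge (by norm_num) (by norm_num) (by norm_num) (by norm_num)
      (by norm_num) (by norm_num) (by norm_num) (by norm_num)
  · exact h.le_mid (zlo := 433/125) (zhi := 693/200) (s₁ := 1299/500) (x₁ := 3/4) (y := 16)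
      (ψ := 277/1500) (t := 1/25) (by norm_num)
      (le_log_of_pow_le (m := 82) (k := 33) (by norm_num) (by norm_num) (by norm_num))
      (log_le_of_le_pow (m := 87) (k := 35) (by norm_num) (by norm_num) (by norm_num))
      (by norm_num) (by norm_num) (by norm_num) (by norm_num) (by norm_num) (by norm_num)
      (by norm_num) (by norm_num) (by norm_num) (by norm_num)
      (le_log_of_pow_le (m := 32) (k := 25) (by norm_num) (by norm_num) (by norm_num))
      (by norm_num) log_sixteen_ge (by norm_num) (by norm_num) (by norm_num) (by norm_num)
      (by norm_num) (by norm_num) (by norm_num) (by norm_num)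
  · exact h.le_mid (zlo := 721/200) (zhi := 1803/500) (s₁ := 2703/1000) (x₁ := 3/4) (y := 16)
      (ψ := 277/1500) (t := 1/25) (by norm_num)
      (le_log_of_pow_le (m := 100) (k := 39) (by norm_num) (by norm_num) (by norm_num))
      (log_le_of_le_pow (m := 59) (k := 23) (by norm_num) (by norm_num) (by norm_num))
      (by norm_num) (by norm_num) (by norm_num) (by norm_num) (by norm_num) (by norm_num)
      (by norm_num) (by norm_num) (by norm_num) (by norm_num)
      (le_log_of_pow_le (m := 17) (k := 13) (by norm_num) (by norm_num) (by norm_num))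
      (by norm_num) log_sixteen_ge (by norm_num) (by norm_num) (by norm_num) (by norm_num)
      (by norm_num) (by norm_num) (by norm_num) (by norm_num)
  · exact h.le_mid (zlo := 3741/1000) (zhi := 1871/500) (s₁ := 561/200) (x₁ := 3/4) (y := 16)
      (ψ := 277/1500) (t := 1/25) (by norm_num)
      (le_log_of_pow_le (m := 95) (k := 36) (by norm_num) (by norm_num) (by norm_num))
      (log_le_of_le_pow (m := 66) (k := 25) (by norm_num) (by norm_num) (by norm_num))
      (by norm_num) (by norm_num) (by norm_num) (by norm_num) (by norm_num) (by norm_num)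
      (by norm_num) (by norm_num) (by norm_num) (by norm_num)
      (le_log_of_pow_le (m := 151) (k := 113) (by norm_num) (by norm_num) (by norm_num))
      (by norm_num) log_sixteen_ge (by norm_num) (by norm_num) (by norm_num) (by norm_num)
      (by norm_num) (by norm_num) (by norm_num) (by norm_num)
  · exact h.le_mid (zlo := 484/125) (zhi := 3873/1000) (s₁ := 363/125) (x₁ := 3/4) (y := 16)
      (ψ := 277/1500) (t := 1/25) (by norm_num)
      (le_log_of_pow_le (m := 111) (k := 41) (by norm_num) (by norm_num) (by norm_num))
      (log_le_of_le_pow (m := 65) (k := 24) (by norm_num) (by norm_num) (by norm_num))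
      (by norm_num) (by norm_num) (by norm_num) (by norm_num) (by norm_num) (by norm_num)
      (by norm_num) (by norm_num) (by norm_num) (by norm_num)
      (le_log_of_pow_le (m := 49) (k := 36) (by norm_num) (by norm_num) (by norm_num))
      (by norm_num) log_sixteen_ge (by norm_num) (by norm_num) (by norm_num) (by norm_num)
      (by norm_num) (by norm_num) (by norm_num) (by norm_num)

/-! ### Sixteen samples or more -/

theorem log_three_halves_ge : 0.405 ≤ Real.log 1.5 :=
  le_trans (by norm_num) (le_log_of_pow_le (m := 15) (k := 37) (by norm_num) (by norm_num)
    (by norm_num))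

theorem log_three_halves_le : Real.log 1.5 ≤ 2 :=
  (log_le_of_le_pow (m := 2) (k := 1) (by norm_num) (by norm_num) (by norm_num)).trans
    (by norm_num)

/-- Concavity of log, with 1 + 0.8 z written as 4.2 times the mean of 1 and z / 4 with weights 1/4.2
and 3.2/4.2. At z = √n it yields log n - log (1 + s) ≤ 0.8 (log n - 1) as soon as s ≥ 0.8 √n. -/
theorem log_one_add_mul_ge {z : ℝ} (hz : 4 ≤ z) : 0.8 + 0.4 * Real.log z ≤ Real.log (1 + 0.8 * z) := by
  have h42 : 1.43 ≤ Real.log 4.2 :=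
    le_trans (by norm_num) (le_log_of_pow_le (m := 33) (k := 23) (by norm_num) (by norm_num)
      (by norm_num))
  have h4 : Real.log 4 ≤ 1.4 :=
    (log_le_of_le_pow (m := 7) (k := 5) (by norm_num) (by norm_num) (by norm_num)).trans
      (by norm_num)
  have hconc := strictConcaveOn_log_Ioi.concaveOn.2 (Set.mem_Ioi.2 one_pos)
    (Set.mem_Ioi.2 (show 0 < z / 4 by linarith)) (show (0 : ℝ) ≤ 1 / 4.2 by norm_num)
    (show (0 : ℝ) ≤ 3.2 / 4.2 by norm_num) (by norm_num)
  simp only [smul_eq_mul, Real.log_one, mul_zero, zero_add] at hconc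
  rw [show 1 / 4.2 * 1 + 3.2 / 4.2 * (z / 4) = (1 + 0.8 * z) / 4.2 by ring,
    Real.log_div (by linarith) (by norm_num), Real.log_div (by linarith) (by norm_num)] at hconc
  have h5 : Real.log 4 ≤ Real.log z := Real.log_le_log (by norm_num) hz
  norm_num at hconc
  linarith

/-- The tangent of log at √n = 2 / 0.421. The slope satisfies 0.421² ≤ 1.267 · 0.14, the
discriminant condition in `BiasBounds.le_of_sixteen_le`. -/
theorem log_sqrt_bound {n : ℕ} (hn : 0 < n) : Real.log n - 1 ≤ 0.421 * √n + 0.14 := by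
  have hn0 : (0 : ℝ) < n := by exact_mod_cast hn
  have hz : 0 < √(n : ℝ) := Real.sqrt_pos.2 hn0
  have h1 : Real.log (√n) = Real.log n / 2 := Real.log_sqrt hn0.le
  have h2 := Real.log_le_sub_one_of_pos (x := √(n : ℝ) / (2 / 0.421)) (by positivity)
  rw [Real.log_div hz.ne' (by norm_num), h1] at h2
  have h3 : Real.log (2 / 0.421) ≤ 1.56 :=
    (log_le_of_le_pow (m := 39) (k := 25) (by norm_num) (by norm_num) (by norm_num)).trans
      (by norm_num)
  have h4 : √(n : ℝ) / (2 / 0.421) = 0.421 / 2 * √n := by field_simp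
  linarith

-- Through log (1 + Y) ≤ Y / √(1 + Y) the claim reduces to `key`. For n ≥ 35 the factor log n - 1 is
-- already at least 2.55; smaller n need the second factor, and n ≤ 27 also the lower bound on s.
set_option exponentiation.threshold 600 in
theorem log_one_add_ratio_le {n : ℕ} {s : ℝ} (hn : 16 ≤ n) (hs : 1 ≤ s)
    (hs2 : Real.log (n + 1) ≤ s ^ 2) :
    Real.log (1 + 2.55 * (s * √n - s + 1) / (n + 2.55 * (1 + s))) ≤ s * (Real.log n - 1) / √n := by
  have hn16 : (16 : ℝ) ≤ n := by exact_mod_cast hn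
  have hz4 : 4 ≤ √(n : ℝ) := Real.le_sqrt_of_sq_le (by norm_num; exact hn)
  have hzz : √(n : ℝ) ^ 2 = n := Real.sq_sqrt (by linarith)
  have hL : 2.77 ≤ Real.log n := le_trans (by norm_num)
    (log_sixteen_ge.trans (Real.log_le_log (by norm_num) hn16))
  set z := √(n : ℝ)
  have hz0 : 0 < z := by linarith
  have hsz : s * 1 ≤ s * z := mul_le_mul_of_nonneg_left (by linarith) (by linarith)
  set x := s / z with hx
  have hx0 : 0 < x := by positivity
  set q := 1 + 2.55 * x / z with hq
  have hq1 : 1 ≤ q := by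
    have : 0 ≤ 2.55 * x / z := by positivity
    linarith
  have key : 2.55 ^ 2 ≤ (Real.log n - 1) ^ 2 * (q * (q + 2.55 * x)) := by
    rcases le_or_gt 35 n with h | h
    · have h35 : (3.55 : ℝ) ≤ Real.log n := by
        refine le_trans (by norm_num) ((le_log_of_pow_le (q := 35) (m := 71) (k := 20)
          (by norm_num) (by norm_num) (by norm_num)).trans (Real.log_le_log (by norm_num) ?_))
        exact_mod_cast h
      calc (2.55 : ℝ) ^ 2 ≤ (Real.log n - 1) ^ 2 := by gcongr; linarith
        _ ≤ _ := le_mul_of_one_le_right (sq_nonneg _) (by nlinarith)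
    have hn34 : (n : ℝ) ≤ 34 := by exact_mod_cast Nat.lt_succ_iff.1 h
    rcases le_or_gt 28 n with h2 | h2
    · have h28 : (3.33 : ℝ) ≤ Real.log n := by
        refine le_trans (by norm_num) ((le_log_of_pow_le (q := 28) (m := 333) (k := 100)
          (by norm_num) (by norm_num) (by norm_num)).trans (Real.log_le_log (by norm_num) ?_))
        exact_mod_cast h2
      have hz6 : z ≤ 6 := (Real.sqrt_le_left (by norm_num)).2 (by linarith)
      have hx1 : 1 / 6 ≤ x := by rw [hx]; gcongr
      calc (2.55 : ℝ) ^ 2 ≤ 2.33 ^ 2 * (1 * (1 + 2.55 * (1 / 6))) := by norm_num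
        _ ≤ _ := by gcongr; linarith
    · have h17 : (2.825 : ℝ) ≤ Real.log (n + 1) := by
        refine le_trans (by norm_num) ((le_log_of_pow_le (q := 17) (m := 133) (k := 47)
          (by norm_num) (by norm_num) (by norm_num)).trans (Real.log_le_log (by norm_num) ?_))
        linarith
      have hs1 : 1.68 ≤ s := sqrt_le_sqrt_log (by linarith) hs2 (by linarith)
      have hn27 : (n : ℝ) ≤ 27 := by exact_mod_cast Nat.lt_succ_iff.1 h2
      have hz6 : z ≤ 5.2 := (Real.sqrt_le_left (by norm_num)).2 (by linarith)
      have hx1 : 0.32 ≤ x := by rw [hx, le_div_iff₀ hz0]; linarith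
      have hq2 : 1.15 ≤ q := by
        have : 0.15 ≤ 2.55 * x / z := by rw [le_div_iff₀ hz0]; linarith
        linarith
      calc (2.55 : ℝ) ^ 2 ≤ 1.77 ^ 2 * (1.15 * (1.15 + 2.55 * 0.32)) := by norm_num
        _ ≤ _ := by gcongr; linarith
  have hq0 : 0 < q := by linarith
  have hY : 2.55 * (s * z - s + 1) / (n + 2.55 * (1 + s)) ≤ 2.55 * x / q := by
    have h1 : 2.55 * x / q = 2.55 * (s * z) / (n + 2.55 * s) := by
      have : (n : ℝ) + 2.55 * s ≠ 0 := by positivity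
      rw [hq, hx, ← hzz] at *
      field_simp
    rw [h1]
    have : 0 ≤ s * z := by positivity
    gcongr <;> linarith
  have hY0 : 0 ≤ 2.55 * (s * z - s + 1) / (n + 2.55 * (1 + s)) :=
    div_nonneg (by linarith) (by positivity)
  refine (Real.log_le_log (by linarith) (add_le_add_right hY 1)).trans ?_
  refine log_le_of_sq_le (by linarith) (div_nonneg (mul_nonneg (by linarith) (by linarith)) hz0.le)
    ?_
  have h2 : s * (Real.log n - 1) / z = x * (Real.log n - 1) := by rw [hx]; ring
  rw [h2, add_sub_cancel_left]
  have h3 : (x * (Real.log n - 1)) ^ 2 * (1 + 2.55 * x / q)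
      = x ^ 2 * ((Real.log n - 1) ^ 2 * (q * (q + 2.55 * x))) / q ^ 2 := by
    field_simp
  rw [h3, div_pow, mul_pow, mul_comm (2.55 ^ 2)]
  exact div_le_div_of_nonneg_right (mul_le_mul_of_nonneg_left key (sq_nonneg x)) (sq_nonneg q)

/-- Here -log (1 - g) ≤ g / √(1 - g) and g ≤ s / √n, so everything reduces to (log n - 1)² (1 - g) ≥
1. -/
theorem neg_log_one_sub_le {n : ℕ} {s : ℝ} (hn : 16 ≤ n) (hs : 1 ≤ s) (hsz : s < 0.8 * √n) :
    (s * √n - s + 1) / n < 1 ∧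
      -Real.log (1 - (s * √n - s + 1) / n) ≤ s * (Real.log n - 1) / √n := by
  have hn16 : (16 : ℝ) ≤ n := by exact_mod_cast hn
  have hz4 : 4 ≤ √(n : ℝ) := Real.le_sqrt_of_sq_le (by norm_num; exact hn)
  have hzz : √(n : ℝ) ^ 2 = n := Real.sq_sqrt (by linarith)
  have hL : 2.77 ≤ Real.log n := le_trans (by norm_num)
    (log_sixteen_ge.trans (Real.log_le_log (by norm_num) hn16))
  set z := √(n : ℝ)
  have hz0 : 0 < z := by linarith
  set g := (s * z - s + 1) / n with hg
  have hg1 : g ≤ 0.8 - 0.8 / z + 1 / z ^ 2 := by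
    have : 0.8 - 0.8 / z + 1 / z ^ 2 = (0.8 * z * (z - 1) + 1) / n := by
      rw [← hzz]; field_simp
    rw [this, hg]
    have : s * (z - 1) ≤ 0.8 * z * (z - 1) := mul_le_mul_of_nonneg_right hsz.le (by linarith)
    gcongr
    linarith
  have hg2 : 0.2 ≤ 1 - g := by
    have : 1 / z ^ 2 ≤ 0.8 / z := by
      rw [div_le_div_iff₀ (by positivity) hz0]; nlinarith
    linarith
  have hg3 : g ≤ s / z := by
    rw [hg, ← hzz, div_le_div_iff₀ (by positivity) hz0]
    nlinarith
  have hg0 : 0 ≤ g := by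
    refine div_nonneg ?_ (by linarith)
    have : s * 1 ≤ s * z := mul_le_mul_of_nonneg_left (by linarith) (by linarith)
    linarith
  have key : 1 ≤ (Real.log n - 1) ^ 2 * (1 - g) := by
    rcases le_or_gt 26 n with h | h
    · have h26 : (3.25 : ℝ) ≤ Real.log n := by
        refine le_trans (by norm_num) ((le_log_of_pow_le (q := 26) (m := 13) (k := 4)
          (by norm_num) (by norm_num) (by norm_num)).trans (Real.log_le_log (by norm_num) ?_))
        exact_mod_cast h
      calc (1 : ℝ) ≤ 2.25 ^ 2 * 0.2 := by norm_num
        _ ≤ _ := by gcongr; linarith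
    · have hn25 : (n : ℝ) ≤ 25 := by exact_mod_cast Nat.lt_succ_iff.1 h
      have hz5 : z ≤ 5 := (Real.sqrt_le_left (by norm_num)).2 (by linarith)
      have h1 : 0.32 ≤ 1 - g := by
        have : 0.8 / z - 1 / z ^ 2 - 0.12 = (5 - z) * (0.12 * z - 0.2) / z ^ 2 := by
          field_simp; ring
        have : 0 ≤ (5 - z) * (0.12 * z - 0.2) / z ^ 2 :=
          div_nonneg (mul_nonneg (by linarith) (by linarith)) (by positivity)
        linarith
      calc (1 : ℝ) ≤ 1.77 ^ 2 * 0.32 := by norm_num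
        _ ≤ _ := by gcongr; linarith
  refine ⟨by linarith, ?_⟩
  have hd : 0 < 1 - g := by linarith
  rw [← Real.log_inv]
  refine log_le_of_sq_le ((one_le_inv₀ hd).2 (by linarith))
    (div_nonneg (mul_nonneg (by linarith) (by linarith)) hz0.le) ?_
  have h1 : ((1 - g)⁻¹ - 1) ^ 2 = g ^ 2 / (1 - g) ^ 2 := by field_simp; ring
  have h2 : (s * (Real.log n - 1) / z) ^ 2 * (1 - g)⁻¹
      = (s / z) ^ 2 * ((Real.log n - 1) ^ 2 * (1 - g)) / (1 - g) ^ 2 := by field_simp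
  rw [h1, h2]
  have h3 : 0 ≤ (s / z) ^ 2 := sq_nonneg _
  gcongr
  calc g ^ 2 ≤ (s / z) ^ 2 := by gcongr
    _ ≤ _ := le_mul_of_one_le_right h3 key

set_option exponentiation.threshold 600 in
theorem BiasBounds.le_of_sixteen_le {n : ℕ} {κ s S b μ N : ℝ}
    (h : BiasBounds n κ s S b μ N) (hn : 16 ≤ n) (hs2 : Real.log (n + 1) ≤ s ^ 2) :
    b ≤ Real.log (1 + 1 / n * ((S + s) * (1 - Real.exp (-((n : ℝ) / κ)))⁻¹ - 1))
      + devGap 1.5 n s := by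
  have hn16 : (16 : ℝ) ≤ n := by exact_mod_cast hn
  have hz4 : 4 ≤ √(n : ℝ) := Real.le_sqrt_of_sq_le (by norm_num; exact hn)
  have hzz : √(n : ℝ) ^ 2 = n := Real.sq_sqrt (by linarith)
  have hs := h.one_le_s
  have hL : 2.77 ≤ Real.log n := le_trans (by norm_num)
    (log_sixteen_ge.trans (Real.log_le_log (by norm_num) hn16))
  have hge := devGap_ge (n := n) (by omega) (by norm_num) log_three_halves_le hs
  have hlc := log_three_halves_ge
  have hlogz : Real.log (√n) = Real.log n / 2 := Real.log_sqrt (by linarith)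
  have hKz := log_sqrt_bound (n := n) (by omega)
  have hη : 1.267 ≤ 0.32 * Real.log n + (Real.log n + 1) * Real.log 1.5 / 4 := by
    have : 3.77 * 0.405 ≤ (Real.log n + 1) * Real.log 1.5 := by gcongr; linarith
    linarith
  set η := 0.32 * Real.log n + (Real.log n + 1) * Real.log 1.5 / 4
  set z := √(n : ℝ) with hz
  have hz0 : 0 < z := by linarith
  have hs0 : 0 < s := by linarith
  have he : s * (Real.log n - 1) / z ≤ devGap 1.5 n s := by
    refine le_trans ?_ hge
    have : 0 ≤ η / (s * z) := by positivity
    linarith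
  have he0 : 0 ≤ devGap 1.5 n s :=
    le_trans (div_nonneg (mul_nonneg hs0.le (by linarith)) hz0.le) he
  refine h.le_of_conditions (u₀ := 1 / 2) (D := 0.49) (R := 2.55) (x₁ := 0.8) (by omega) he0
    (by norm_num) (by norm_num) (fun u => chord_sub_log_le_of_le_half) ?_
    (fun hx => ?_) (fun hx => ?_) (fun hx => ?_) (fun hx => ?_)
  · have := inv_one_sub_exp_neg_le (u := 1 / 2) (by norm_num) (by norm_num)
    norm_num at this ⊢
    linarith
  · refine le_trans ?_ he
    rw [Real.log_div (by linarith) (by linarith)]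
    have h1 := log_one_add_mul_ge hz4
    have h2 : Real.log (1 + 0.8 * z) ≤ Real.log (1 + s) :=
      Real.log_le_log (by linarith) (by linarith)
    have h3 : 0.8 * (Real.log n - 1) ≤ s * (Real.log n - 1) / z := by
      rw [le_div_iff₀ hz0]
      have := mul_le_mul_of_nonneg_right hx (show 0 ≤ Real.log n - 1 by linarith)
      linarith
    linarith
  · exact (log_one_add_ratio_le hn hs hs2).trans he
  · obtain ⟨h1, h2⟩ := neg_log_one_sub_le hn hs hx
    exact ⟨h1, h2.trans he⟩
  · have hsz : s * z ≤ 0.8 * n := by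
      rw [← hzz]
      calc s * z ≤ 0.8 * z * z := mul_le_mul_of_nonneg_right hx.le hz0.le
        _ = _ := by ring
    have hA : (2 + s * z) / n ≤ 0.925 := by
      rw [div_le_iff₀ (by linarith)]; linarith
    refine ⟨by linarith, chord_left_le (y := 16) (ψ := 277 / 1500) (t := 0.14) (by omega) hs0 hge
      (by norm_num) log_sixteen_ge (hA.trans (by norm_num)) ?_ ?_⟩
    -- AM-GM in s with η ≥ 1.267, as 2 √(1.267 · 0.14) ≥ 0.842; the completed square shows it.
    · have h1 : 0.842 * z ≤ η * z / s + 0.14 * (s * z) := by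
        have h2 : η * z / s + 0.14 * (s * z) - 0.842 * z
          = z / s * (η - 1.267 + ((0.14 * s - 0.421) ^ 2 + (1.267 * 0.14 - 0.421 ^ 2)) / 0.14) := by
          field_simp; ring
        have h3 : 0 ≤ z / s * (η - 1.267 + ((0.14 * s - 0.421) ^ 2
            + (1.267 * 0.14 - 0.421 ^ 2)) / 0.14) := by
          refine mul_nonneg (by positivity) (add_nonneg (by linarith) (div_nonneg ?_ (by norm_num)))
          have := sq_nonneg (0.14 * s - 0.421)
          norm_num at this ⊢
          linarith
        linarith
      linarith
    · have h0 : 0 ≤ (z - 2) / (z * (1 + s)) := div_nonneg (by linarith) (by positivity)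
      rcases le_or_gt 20 n with h20 | h20
      · have : (2.99 : ℝ) ≤ Real.log n := by
          refine le_trans (by norm_num) ((le_log_of_pow_le (q := 20) (m := 299) (k := 100)
            (by norm_num) (by norm_num) (by norm_num)).trans (Real.log_le_log (by norm_num) ?_))
          exact_mod_cast h20
        linarith
      · have hn19 : (n : ℝ) ≤ 19 := by exact_mod_cast Nat.lt_succ_iff.1 h20
        have hz5 : z ≤ 4.4 := (Real.sqrt_le_left (by norm_num)).2 (by linarith)
        have : 0.1 ≤ (z - 2) / (z * (1 + s)) := by
          rw [le_div_iff₀ (by positivity)]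
          have : z * (1 + s) ≤ z * (1 + 0.8 * 4.4) :=
            mul_le_mul_of_nonneg_left (by linarith) hz0.le
          linarith
        linarith

/-! ### Sequences with a single observed symbol -/

/-- The best constant is about 0.638. Below 1.5, exp (-w²) is bounded from below by its tangents in
w² at 0, 1 and 2 on successive ranges; beyond, 0.67 w exceeds 1. -/
theorem one_sub_exp_neg_sq_le {w : ℝ} (hw : 0 ≤ w) : 1 - Real.exp (-w ^ 2) ≤ 0.67 * w := by
  have h1 : (0.3678 : ℝ) ≤ Real.exp (-1) := by
    rw [Real.exp_neg, le_inv_comm₀ (by norm_num) (Real.exp_pos 1)]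
    exact Real.exp_one_lt_d9.le.trans (by norm_num)
  have h2 : (0.1352 : ℝ) ≤ Real.exp (-2) := by
    have : Real.exp (-2) = Real.exp (-1) * Real.exp (-1) := by rw [← Real.exp_add]; norm_num
    rw [this]
    calc (0.1352 : ℝ) ≤ 0.3678 * 0.3678 := by norm_num
      _ ≤ _ := by gcongr
  have ht : ∀ v : ℝ, Real.exp (-v) * (1 + v - w ^ 2) ≤ Real.exp (-w ^ 2) := by
    intro v
    have h3 := Real.add_one_le_exp (v - w ^ 2)
    calc Real.exp (-v) * (1 + v - w ^ 2) ≤ Real.exp (-v) * Real.exp (v - w ^ 2) :=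
          mul_le_mul_of_nonneg_left (by linarith) (Real.exp_pos _).le
      _ = _ := by rw [← Real.exp_add]; ring_nf
  have h01 := Real.exp_pos (-w ^ 2)
  rcases le_or_gt w 0.67 with h | h
  · have := Real.add_one_le_exp (-w ^ 2)
    nlinarith
  rcases le_or_gt w 1.2 with h' | h'
  · have h3 := ht 1
    have h4 : 0.3678 * (1 + 1 - w ^ 2) ≤ Real.exp (-1) * (1 + 1 - w ^ 2) :=
      mul_le_mul_of_nonneg_right h1 (by nlinarith)
    nlinarith [mul_nonneg (sub_nonneg.2 h.le) (sub_nonneg.2 h')]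
  rcases le_or_gt w 1.5 with h'' | h''
  · have h3 := ht 2
    have h4 : 0.1352 * (1 + 2 - w ^ 2) ≤ Real.exp (-2) * (1 + 2 - w ^ 2) :=
      mul_le_mul_of_nonneg_right h2 (by nlinarith)
    nlinarith [mul_nonneg (sub_nonneg.2 h'.le) (sub_nonneg.2 h'')]
  · linarith

/-- `b` stands for the mass outside the most likely symbol, and log b ≤ 0 is dropped. For n ≥ 10 the
bound on `b` suffices; for 4 ≤ n ≤ 9 the term log (1 + s) ≥ log 2 is kept and saves the factor
0.8423; for n = 2, 3 only b ≤ 1 is used. -/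
theorem mul_log_add_le {n : ℕ} {s b : ℝ} (hn : 2 ≤ n) (hs1 : 1 ≤ s)
    (hs2 : Real.log (n + 1) ≤ s ^ 2) (hb0 : 0 ≤ b) (hb1 : b ≤ 1)
    (hb : 4 ≤ n → b ≤ 1 - Real.exp (-(2 * s ^ 2 / (n - 1)))) :
    b * (Real.log b + 2 * Real.log n - Real.log (1 + s)) ≤ 2 * Real.log n * s / √n := by
  have hn2 : (2 : ℝ) ≤ n := by exact_mod_cast hn
  have hlb : Real.log b ≤ 0 := Real.log_nonpos hb0 hb1
  have hL : 0 ≤ Real.log n := Real.log_nonneg (by linarith)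
  have hz0 : 0 < √(n : ℝ) := Real.sqrt_pos.2 (by linarith)
  have hzz : √(n : ℝ) ^ 2 = n := Real.sq_sqrt (by linarith)
  have hs0 : 0 < s := by linarith
  have hl2 : Real.log 2 ≤ Real.log (1 + s) := Real.log_le_log (by norm_num) (by linarith)
  have hlog2 := Real.log_two_gt_d9
  have hR0 : 0 ≤ 2 * Real.log n * s / √n := by positivity
  have hone : ∀ m : ℝ, 2 * Real.log n - Real.log (1 + s) ≤ m → 0 ≤ m →
      b * (Real.log b + 2 * Real.log n - Real.log (1 + s)) ≤ m := by
    intro m hm hm0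
    calc b * (Real.log b + 2 * Real.log n - Real.log (1 + s)) ≤ b * m :=
          mul_le_mul_of_nonneg_left (by linarith) hb0
      _ ≤ m := mul_le_of_le_one_left hm0 hb1
  rcases le_or_gt 4 n with h4 | h4
  · have hn4 : (4 : ℝ) ≤ n := by exact_mod_cast h4
    have hw2 : (s * √(2 / (n - 1))) ^ 2 = 2 * s ^ 2 / (n - 1) := by
      rw [mul_pow, Real.sq_sqrt (div_nonneg (by norm_num) (by linarith))]; ring
    have hbw : b ≤ 0.67 * (s * √(2 / (n - 1))) := by
      refine (hb h4).trans ?_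
      rw [← hw2]
      exact one_sub_exp_neg_sq_le (by positivity)
    set w := s * √(2 / ((n : ℝ) - 1)) with hw
    have hw0 : 0 ≤ w := by positivity
    have hsz : (s / √n) ^ 2 = s ^ 2 / n := by rw [div_pow, hzz]
    rcases le_or_gt 10 n with h10 | h10
    · have hn10 : (10 : ℝ) ≤ n := by exact_mod_cast h10
      have h1 : 0.67 * w ≤ s / √n := by
        refine le_of_sq_le_sq ?_ (by positivity)
        rw [mul_pow, hw2, hsz, ← mul_div_assoc, div_le_div_iff₀ (by linarith) (by linarith)]
        have := mul_nonneg (sq_nonneg s) (show 0 ≤ (n : ℝ) - 10 by linarith)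
        nlinarith
      calc b * (Real.log b + 2 * Real.log n - Real.log (1 + s)) ≤ b * (2 * Real.log n) :=
            mul_le_mul_of_nonneg_left (by linarith) hb0
        _ ≤ s / √n * (2 * Real.log n) := by gcongr; linarith
        _ = _ := by ring
    · have hn9 : (n : ℝ) ≤ 9 := by exact_mod_cast Nat.lt_succ_iff.1 h10
      have hL9 : Real.log n ≤ 2.1975 := by
        refine (Real.log_le_log (by linarith) hn9).trans ((log_le_of_le_pow (m := 167) (k := 76)
          (by norm_num) (by norm_num) (by norm_num)).trans (by norm_num))
      have h1 : 0.8423 * (0.67 * w) ≤ s / √n := by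
        refine le_of_sq_le_sq ?_ (by positivity)
        rw [mul_pow, mul_pow, hw2, hsz, ← mul_div_assoc, ← mul_div_assoc,
          div_le_div_iff₀ (by linarith) (by linarith)]
        have := mul_nonneg (sq_nonneg s) (show 0 ≤ (n : ℝ) - 4 by linarith)
        nlinarith
      calc b * (Real.log b + 2 * Real.log n - Real.log (1 + s))
          ≤ b * (0.8423 * (2 * Real.log n)) :=
            mul_le_mul_of_nonneg_left (by linarith) hb0
        _ ≤ 0.67 * w * (0.8423 * (2 * Real.log n)) := by gcongr
        _ = 0.8423 * (0.67 * w) * (2 * Real.log n) := by ring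
        _ ≤ s / √n * (2 * Real.log n) := by gcongr
        _ = _ := by ring
  · refine hone _ ?_ hR0
    rw [le_div_iff₀ hz0]
    interval_cases n
    · have h2 : √((2 : ℕ) : ℝ) ≤ 1.42 := (Real.sqrt_le_left (by norm_num)).2 (by norm_num)
      push_cast at *
      nlinarith
    · have h2 : √((3 : ℕ) : ℝ) ≤ 1.733 := (Real.sqrt_le_left (by norm_num)).2 (by norm_num)
      have hs₁ : 1177 / 1000 ≤ s := sqrt_le_sqrt_log (by linarith) hs2
        (le_trans (by norm_num) (le_log_of_pow_le (m := 140) (k := 101) (by norm_num)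
          (by norm_num) (by norm_num)))
      have h3 : 7 / 9 ≤ Real.log (1 + s) := by
        refine le_trans ?_ ((le_log_of_pow_le (q := 1 + 1177 / 1000) (m := 7) (k := 9)
          (by norm_num) (by norm_num) (by norm_num)).trans
          (Real.log_le_log (by norm_num) (by linarith)))
        norm_num
      have h4 : Real.log ((3 : ℕ) : ℝ) ≤ 89 / 81 := le_trans
        (log_le_of_le_pow (m := 89) (k := 81) (by norm_num) (by norm_num) (by norm_num))
        (by norm_num)
      have h5 : 56 / 51 ≤ Real.log ((3 : ℕ) : ℝ) := le_trans (by norm_num)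
        (le_log_of_pow_le (m := 56) (k := 51) (by norm_num) (by norm_num) (by norm_num))
      calc (2 * Real.log ((3 : ℕ) : ℝ) - Real.log (1 + s)) * √((3 : ℕ) : ℝ)
          ≤ (2 * (89 / 81) - 7 / 9) * 1.733 := by gcongr
        _ ≤ 2 * (56 / 51) * (1177 / 1000) := by norm_num
        _ ≤ _ := by gcongr

/-- The correction with Ŝ = 1 is at least log (1 + x) with x = (1 + s) κ / n², and log (1 + x) ≥
h(b) + b log x for the binary entropy h. The terms of `hH` cancel against this, and what remains is
`mul_log_add_le`. -/
theorem le_log_add_of_singleton {n : ℕ} {κ s b H : ℝ} (hn : 2 ≤ n) (hκ : 0 < κ) (hs1 : 1 ≤ s)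
    (hs2 : Real.log (n + 1) ≤ s ^ 2) (hb0 : 0 ≤ b) (hb1 : b ≤ 1)
    (hb : 4 ≤ n → b ≤ 1 - Real.exp (-(2 * s ^ 2 / (n - 1))))
    (hH : H ≤ Real.negMulLog (1 - b) + b * Real.log κ) :
    H ≤ Real.log (1 + 1 / n * ((1 + s) * (1 - Real.exp (-((n : ℝ) / κ)))⁻¹ - 1))
      + 2 * Real.log n * √(s ^ 2 + Real.log 2 / 2) / √n := by
  have hn2 : (2 : ℝ) ≤ n := by exact_mod_cast hn
  have h1 := one_div_add_half_le (u := (n : ℝ) / κ) (by positivity)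
  rw [one_div_div] at h1
  set r := (1 - Real.exp (-((n : ℝ) / κ)))⁻¹
  have hW : 0 < (1 + s) / n ^ 2 * κ := by positivity
  have h2 : Real.log (1 + (1 + s) / n ^ 2 * κ) ≤ Real.log (1 + 1 / n * ((1 + s) * r - 1)) := by
    refine Real.log_le_log (by linarith) ?_
    have h3 : (1 + s) * (κ / n + 1 / 2) ≤ (1 + s) * r :=
      mul_le_mul_of_nonneg_left h1 (by linarith)
    have h4 : (1 + s) / n ^ 2 * κ = 1 / n * ((1 + s) * (κ / n)) := by field_simp
    rw [h4]
    gcongr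
    linarith
  have h3 : 2 * Real.log n * s / √n ≤ 2 * Real.log n * √(s ^ 2 + Real.log 2 / 2) / √n := by
    have : s ≤ √(s ^ 2 + Real.log 2 / 2) :=
      Real.le_sqrt_of_sq_le (by linarith [Real.log_two_gt_d9])
    have : 0 ≤ Real.log n := Real.log_nonneg (by linarith)
    gcongr
  have h4 := mul_log_add_le hn hs1 hs2 hb0 hb1 hb
  rcases hb0.eq_or_lt with rfl | hb0
  · have h5 : 0 ≤ Real.log (1 + (1 + s) / n ^ 2 * κ) := Real.log_nonneg (by linarith)
    simp at hH h4
    linarith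
  · have h5 := binary_le_log_one_add hb0 hb1 hW
    rw [Real.log_mul (by positivity) hκ.ne', Real.log_div (by positivity) (by positivity),
      Real.log_pow] at h5
    have h6 : Real.negMulLog b = -(b * Real.log b) := by rw [Real.negMulLog]; ring
    rw [h6] at h5
    push_cast at h5
    linarith

/-! ### The lower deviation probability -/

/-- The failure probability of the upper confidence bound with `n` samples, in units of the
confidence parameter. -/
noncomputable def lowerTail (n : ℕ) : ℝ :=
  if n ≤ 1 then 0 else if n = 2 then 1 else if n = 3 then 2 else if n ≤ 6 then 6.3
  else if n ≤ 15 then 7.3 else 3.5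

variable {𝒴 : Type*} {T : Finset 𝒴} {p : 𝒴 → ℝ}

theorem ucdSE_exp {l : List 𝒴} {n : ℕ} (hl : l.length = n) (hn : 0 < n) (κ : ℝ) {s : ℝ}
    (hs : 0 ≤ s) :
    ucdSE κ l (Real.exp (-(2 * s ^ 2)))
      = Real.log (1 + 1 / n * ((supportEstimate l + s) * (1 - Real.exp (-((n : ℝ) / κ)))⁻¹ - 1))
        + 2 * Real.log n * √(s ^ 2 + Real.log 2 / 2) / √n := by
  have hn0 : (1 : ℝ) ≤ n := by exact_mod_cast hn
  have h1 : Real.log (1 / Real.exp (-(2 * s ^ 2))) = 2 * s ^ 2 := by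
    rw [one_div, Real.log_inv, Real.log_exp, neg_neg]
  have h2 : Real.log (2 / Real.exp (-(2 * s ^ 2))) = Real.log 2 + 2 * s ^ 2 := by
    rw [Real.log_div (by norm_num) (Real.exp_pos _).ne', Real.log_exp, sub_neg_eq_add]
  rw [ucdSE, biasSE, hl, h1, h2]
  congr 2
  · rw [show 1 / 2 * (2 * s ^ 2) = s ^ 2 by ring, Real.sqrt_sq hs]
  · have h3 : 2 * Real.log n ^ 2 / n * (Real.log 2 + 2 * s ^ 2)
        = (2 * Real.log n) ^ 2 * (s ^ 2 + Real.log 2 / 2) / n := by ring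
    have hL : 0 ≤ 2 * Real.log n := by have := Real.log_nonneg hn0; linarith
    rw [h3, Real.sqrt_div (by have := Real.log_two_gt_d9; positivity),
      Real.sqrt_mul (sq_nonneg _), Real.sqrt_sq hL]

/-- Here μ = ∑ (1 - exp (-n p)), a lower bound for the mean of the support estimator. Since n p ≥ n
/ κ for every symbol, the bias is compared with μ term by term, by the monotonicity statement
`mul_log_div_le`. -/
theorem biasBounds_of_iid (hp : IsWeight T p) (hpos : ∀ x ∈ T, 0 < p x) {κ : ℝ} (hκ : 0 < κ)
    (hpκ : ∀ x ∈ T, 1 / κ ≤ p x) {n : ℕ} (hn : 0 < n) {s S : ℝ} (hs : 1 ≤ s) (hS : 2 ≤ S)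
    (hSμ : 7 ≤ n → iidMean T p n (fun l => (supportEstimate l : ℝ)) - s * √n < S) :
    BiasBounds n κ s S (∑ x ∈ T, Real.negMulLog (p x) - iidMean T p n plugInEntropy)
      (∑ x ∈ T, (1 - Real.exp (-(n * p x)))) T.card := by
  have hn0 : (0 : ℝ) < n := by exact_mod_cast hn
  have hb := entropy_sub_iidMean_plugInEntropy_le hp hpos hn
  have hu : 0 < (n : ℝ) / κ := by positivity
  have hup : ∀ x ∈ T, (n : ℝ) / κ ≤ n * p x := fun x hx => by
    rw [div_eq_mul_one_div]; exact mul_le_mul_of_nonneg_left (hpκ x hx) hn0.le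
  have hd : 0 < 1 - Real.exp (-((n : ℝ) / κ)) :=
    lt_of_lt_of_le (by positivity) (one_sub_exp_neg_ge hu.le)
  refine ⟨hκ, hs, hS, by positivity, hb.trans (sum_mul_log_le_log_card hp hpos hn),
    hb.trans (sum_mul_log_le_log_kappa hp hκ hpκ hn), fun hu2 => hb.trans ?_, ?_, ?_,
    fun h7 => ?_⟩
  · rw [div_mul_eq_mul_div, Finset.sum_mul, Finset.sum_div]
    refine Finset.sum_le_sum fun x hx => ?_
    have h1 := mul_log_div_le hu hu2 (hup x hx)
    rw [le_div_iff₀ hn0]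
    calc p x * Real.log (1 + 1 / (n * p x)) * n = n * p x * Real.log (1 + 1 / (n * p x)) := by ring
      _ ≤ _ := h1
      _ = _ := by rw [div_eq_mul_inv]; ring
  · rw [← div_eq_mul_inv, le_div_iff₀ hd, ← nsmul_eq_mul]
    refine Finset.card_nsmul_le_sum _ _ _ fun x hx => ?_
    have := Real.exp_le_exp.2 (neg_le_neg (hup x hx))
    linarith
  · rw [div_inv_eq_mul]
    calc ∑ x ∈ T, (1 - Real.exp (-(n * p x)))
        ≤ ∑ x ∈ T, p x * (κ * (1 - Real.exp (-((n : ℝ) / κ)))) := ?_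
      _ = _ := by rw [← Finset.sum_mul, hp.sum_eq_one, one_mul]
    refine Finset.sum_le_sum fun x hx => ?_
    -- concavity of `1 - exp (-t)`
    have hx0 := hpos x hx
    have hxu := hup x hx
    have hθ0 : 0 < p x * κ := by positivity
    have hθ1 : 1 ≤ p x * κ := by
      have := hpκ x hx
      rwa [div_le_iff₀ hκ] at this
    have hconv := convexOn_exp.2 (Set.mem_univ (-(n * p x))) (Set.mem_univ (0 : ℝ))
      (show 0 ≤ 1 / (p x * κ) by positivity)
      (show 0 ≤ 1 - 1 / (p x * κ) by rw [sub_nonneg, div_le_one hθ0]; exact hθ1) (by ring)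
    simp only [smul_eq_mul, mul_zero, add_zero, Real.exp_zero, mul_one] at hconv
    have h1 : 1 / (p x * κ) * -(n * p x) = -(n / κ) := by field_simp
    rw [h1] at hconv
    have h2 : p x * κ * Real.exp (-(n / κ)) ≤ Real.exp (-(n * p x)) + (p x * κ - 1) := by
      have := mul_le_mul_of_nonneg_left hconv hθ0.le
      refine this.trans (le_of_eq ?_)
      field_simp
    linarith
  · have := hSμ h7
    have := sum_one_sub_exp_le hp n
    linarith

theorem iidProb_plugInEntropy_le (hp : IsWeight T p) {n : ℕ} (hn : 2 ≤ n) {c s : ℝ} (hc : 1 ≤ c)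
    (hc2 : Real.log c / 2 ≤ s ^ 2) :
    iidProb T p n (fun l => plugInEntropy l ≤ iidMean T p n plugInEntropy
      - plugInDiff n * √(s ^ 2 - Real.log c / 2) / √n) ≤ c * Real.exp (-(2 * s ^ 2)) := by
  have hn0 : (0 : ℝ) < n := by exact_mod_cast (by omega : 0 < n)
  have hd := plugInDiff_pos hn
  refine (iidProb_le_le hp (by omega) (div_pos hd hn0) ?_ (hasBoundedDiff_plugInEntropy n)).trans
    (le_of_eq ?_)
  · have := plugInDiff_nonneg n
    positivity
  · have h1 : 2 * (plugInDiff n * √(s ^ 2 - Real.log c / 2) / √n) ^ 2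
        / (n * (plugInDiff n / n) ^ 2) = 2 * s ^ 2 - Real.log c := by
      rw [div_pow, mul_pow, Real.sq_sqrt (by linarith), Real.sq_sqrt hn0.le]
      field_simp
    rw [h1, neg_sub, sub_eq_add_neg, Real.exp_add, Real.exp_log (by linarith)]

theorem iidProb_supportEstimate_le (hp : IsWeight T p) {n : ℕ} (hn : 0 < n) {s : ℝ} (hs : 0 ≤ s) :
    iidProb T p n (fun l => (supportEstimate l : ℝ) ≤
      iidMean T p n (fun l => (supportEstimate l : ℝ)) - s * √n) ≤ Real.exp (-(2 * s ^ 2)) := by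
  have hn0 : (0 : ℝ) < n := by exact_mod_cast hn
  refine (iidProb_le_le hp hn one_pos (by positivity) (hasBoundedDiff_supportEstimate n)).trans
    (le_of_eq ?_)
  rw [mul_pow, Real.sq_sqrt hn0.le]
  congr 1
  field_simp

/-- Three exceptional events. `A`: the plug-in entropy is far below its mean, with probability at
most c δ. `B`: the support estimate is far below its mean; needed only for n ≥ 7. `D`: all samples
agree although even the heaviest atom makes this no likelier than δ; needed only for n ≥ 4. Outside
`A` and `B`, two or more symbols are handled by `hbias`; a single symbol outside `D` means small n
or a heavy atom. -/
theorem iidProb_lt_le_of_bias (hp : IsWeight T p) (hpos : ∀ x ∈ T, 0 < p x) {κ : ℝ} (hκ : 0 < κ)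
    (hpκ : ∀ x ∈ T, 1 / κ ≤ p x) {n : ℕ} (hn : 2 ≤ n) {c s : ℝ} (hs1 : 1 ≤ s)
    (hs : Real.log (n + 1) ≤ s ^ 2) (hc : 1 ≤ c) (hc2 : Real.log c ≤ 2)
    (hbias : ∀ S b μ N, BiasBounds n κ s S b μ N →
      b ≤ Real.log (1 + 1 / n * ((S + s) * (1 - Real.exp (-((n : ℝ) / κ)))⁻¹ - 1))
        + devGap c n s) :
    iidProb T p n (fun l => plugInEntropy l + ucdSE κ l (Real.exp (-(2 * s ^ 2)))
      < ∑ x ∈ T, Real.negMulLog (p x))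
      ≤ (c + (if 7 ≤ n then 1 else 0) + (if 4 ≤ n then 1 else 0)) * Real.exp (-(2 * s ^ 2)) := by
  classical
  have hn0 : (0 : ℝ) < n := by exact_mod_cast (by omega : 0 < n)
  have hT : T.Nonempty := by
    rcases T.eq_empty_or_nonempty with h | h
    · have := hp.sum_eq_one
      rw [h, Finset.sum_empty] at this
      norm_num at this
    · exact h
  obtain ⟨x₀, hx₀, hmax⟩ := T.exists_max_image p hT
  set δ := Real.exp (-(2 * s ^ 2)) with hδ
  have hδ0 : 0 < δ := Real.exp_pos _
  let A : List 𝒴 → Prop := fun l => plugInEntropy l ≤ iidMean T p n plugInEntropy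
      - plugInDiff n * √(s ^ 2 - Real.log c / 2) / √n
  let B : List 𝒴 → Prop := fun l => 7 ≤ n ∧ (supportEstimate l : ℝ) ≤
      iidMean T p n (fun l => (supportEstimate l : ℝ)) - s * √n
  let D : List 𝒴 → Prop := fun l => (4 ≤ n ∧ p x₀ ^ (n - 1) ≤ δ) ∧ supportEstimate l ≤ 1
  have hA : iidProb T p n A ≤ c * δ := iidProb_plugInEntropy_le hp hn hc (by nlinarith)
  have hB : iidProb T p n B ≤ (if 7 ≤ n then 1 else 0) * δ := by
    split_ifs with h
    · rw [one_mul]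
      exact (iidProb_mono hp fun l _ _ hl => hl.2).trans
        (iidProb_supportEstimate_le hp (by omega) (by linarith))
    · rw [zero_mul, iidProb_false hp]
      exact fun l _ _ hl => h hl.1
  have hD : iidProb T p n D ≤ (if 4 ≤ n then 1 else 0) * δ := by
    split_ifs with h
    · rw [one_mul]
      by_cases h2 : p x₀ ^ (n - 1) ≤ δ
      · refine (iidProb_mono hp fun l _ _ hl => hl.2).trans (le_trans ?_ h2)
        obtain ⟨m, rfl⟩ : ∃ m, n = m + 1 := ⟨n - 1, by omega⟩
        exact iidProb_supportEstimate_le_one hp hmax m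
      · rw [iidProb_false hp]
        · exact hδ0.le
        · exact fun l _ _ hl => h2 hl.1.2
    · rw [zero_mul, iidProb_false hp]
      exact fun l _ _ hl => h hl.1.1
  have hsub : iidProb T p n (fun l => plugInEntropy l + ucdSE κ l δ
      < ∑ x ∈ T, Real.negMulLog (p x)) ≤ iidProb T p n (fun l => (A l ∨ B l) ∨ D l) := by
    refine iidProb_mono hp fun l hl hlT hbad => ?_
    by_contra hcon
    simp only [not_or] at hcon
    obtain ⟨⟨hA', hB'⟩, hD'⟩ := hcon
    refine absurd hbad (not_lt.2 ?_)
    rw [ucdSE_exp hl (by omega) κ (by linarith)]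
    have hSpos := supportEstimate_pos (l := l) (by omega)
    rcases Nat.lt_or_ge (supportEstimate l) 2 with hS | hS
    · have hS1 : supportEstimate l = 1 := by omega
      rw [hS1, Nat.cast_one]
      have hH0 := plugInEntropy_nonneg l
      have hx1 : p x₀ ≤ 1 := by
        rw [← hp.sum_eq_one]; exact Finset.single_le_sum (fun y hy => hp.nonneg y hy) hx₀
      have hx0 := hpos x₀ hx₀
      have := le_log_add_of_singleton hn hκ hs1 hs (b := 1 - p x₀) (by linarith) (by linarith)
        (H := ∑ x ∈ T, Real.negMulLog (p x)) (fun h4 => ?_)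
        (by rw [sub_sub_cancel]; exact sum_negMulLog_le_atom hp hκ hpκ hx₀)
      · linarith
      · have h5 : δ < p x₀ ^ (n - 1) := by
          by_contra h6
          exact hD' ⟨⟨h4, not_lt.1 h6⟩, hS1.le⟩
        have h7 := Real.log_lt_log hδ0 h5
        rw [hδ, Real.log_exp, Real.log_pow, Nat.cast_sub (by omega), Nat.cast_one] at h7
        have hn4 : (4 : ℝ) ≤ n := by exact_mod_cast h4
        have h8 : -(2 * s ^ 2 / (n - 1)) ≤ Real.log (p x₀) := by
          rw [← neg_div, div_le_iff₀ (by linarith)]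
          linarith
        have h9 := (Real.le_log_iff_exp_le hx0).1 h8
        linarith
    · have hS2 : (2 : ℝ) ≤ supportEstimate l := by exact_mod_cast hS
      have h1 := hbias _ _ _ _ (biasBounds_of_iid hp hpos hκ hpκ (by omega) hs1 hS2 (fun h7 => by
        by_contra h8
        exact hB' ⟨h7, not_lt.1 h8⟩))
      have h2 := not_le.1 hA'
      rw [devGap] at h1
      linarith
  calc _ ≤ _ := hsub
    _ ≤ iidProb T p n A + iidProb T p n B + iidProb T p n D :=
      (iidProb_or_le hp n _ D).trans (add_le_add_left (iidProb_or_le hp n A B) _)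
    _ ≤ _ := by linarith

/-- The choice of c is 1 for n = 2, 2 for n = 3, 5.3 for 4 ≤ n ≤ 15 and 1.5 from 16 on; adding the
events `B` and `D` where they occur gives `lowerTail`. One sample never fails, because the
correction already exceeds log κ. -/
theorem iidProb_lt_le (hp : IsWeight T p) (hpos : ∀ x ∈ T, 0 < p x) {κ : ℝ} (hκ : 0 < κ)
    (hpκ : ∀ x ∈ T, 1 / κ ≤ p x) {n : ℕ} (hn : 1 ≤ n) {s : ℝ} (hs0 : 0 ≤ s)
    (hs : Real.log (n + 1) ≤ s ^ 2) :
    iidProb T p n (fun l => plugInEntropy l + ucdSE κ l (Real.exp (-(2 * s ^ 2)))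
      < ∑ x ∈ T, Real.negMulLog (p x)) ≤ lowerTail n * Real.exp (-(2 * s ^ 2)) := by
  rcases hn.eq_or_lt with rfl | hn2
  · rw [iidProb_false hp]
    · simp [lowerTail]
    · intro l hl _
      rw [not_lt, ucdSE_exp hl one_pos κ hs0]
      have hS : (1 : ℝ) ≤ supportEstimate l := by
        exact_mod_cast supportEstimate_pos (l := l) (by omega)
      have h1 := plugInEntropy_nonneg l
      have hu : 0 < ((1 : ℕ) : ℝ) / κ := by positivity
      have h2 := one_div_le_inv_one_sub_exp_neg hu
      rw [one_div_div] at h2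
      have h3 := sum_negMulLog_le_log_kappa hp hκ hpκ
      have h4 : Real.log κ ≤ Real.log (1 + 1 / ((1 : ℕ) : ℝ) * ((supportEstimate l + s) *
          (1 - Real.exp (-(((1 : ℕ) : ℝ) / κ)))⁻¹ - 1)) := by
        refine Real.log_le_log hκ ?_
        rw [Nat.cast_one, div_one] at h2
        have h5 := one_le_inv_one_sub_exp_neg hu
        rw [Nat.cast_one, one_div_one, one_mul]
        rw [Nat.cast_one] at h5
        set r := (1 - Real.exp (-(1 / κ)))⁻¹
        have : 1 * r ≤ (supportEstimate l + s) * r :=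
          mul_le_mul_of_nonneg_right (by linarith) (by linarith)
        linarith
      have h5 : 0 ≤ 2 * Real.log ((1 : ℕ) : ℝ) * √(s ^ 2 + Real.log 2 / 2) / √((1 : ℕ) : ℝ) := by
        simp
      linarith
  · have hn2' : (2 : ℝ) ≤ n := by exact_mod_cast hn2
    have hs1 : 1 ≤ s := by
      have h3 : 1 ≤ s ^ 2 := one_le_log_three.trans
        ((Real.log_le_log (by norm_num) (by linarith)).trans hs)
      nlinarith
    have key := fun c => iidProb_lt_le_of_bias hp hpos hκ hpκ hn2 (c := c) hs1 hs
    have hl2 := Real.log_two_lt_d9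
    rcases Nat.lt_or_ge n 4 with h | h
    · interval_cases n
      · refine (key 1 le_rfl (by simp) fun S b μ N h => h.le_two).trans (le_of_eq ?_)
        norm_num [lowerTail]
      · refine (key 2 (by norm_num) (by linarith) fun S b μ N h => h.le_three hs).trans
          (le_of_eq ?_)
        norm_num [lowerTail]
    rcases Nat.lt_or_ge n 7 with h' | h'
    · refine (key 5.3 (by norm_num) log_five_three_le fun S b μ N h => ?_).trans (le_of_eq ?_)
      · interval_cases n
        · exact h.le_four hs
        · exact h.le_five hs
        · exact h.le_six hs
      · have h1 : ¬ n ≤ 1 := by omega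
        have h2 : n ≠ 2 := by omega
        have h3 : n ≠ 3 := by omega
        have h4 : n ≤ 6 := by omega
        have h5 : ¬ 7 ≤ n := by omega
        norm_num [lowerTail, h1, h2, h3, h4, h5, h]
    rcases Nat.lt_or_ge n 16 with h'' | h''
    · refine (key 5.3 (by norm_num) log_five_three_le fun S b μ N h =>
        h.le_of_seven_le_of_le_fifteen h' (by omega)).trans (le_of_eq ?_)
      have h1 : ¬ n ≤ 1 := by omega
      have h2 : n ≠ 2 := by omega
      have h3 : n ≠ 3 := by omega
      have h4 : ¬ n ≤ 6 := by omega
      have h5 : n ≤ 15 := by omega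
      norm_num [lowerTail, h1, h2, h3, h4, h5, h, h']
    · refine (key 1.5 (by norm_num) log_three_halves_le fun S b μ N h =>
        h.le_of_sixteen_le h'' hs).trans (le_of_eq ?_)
      have h1 : ¬ n ≤ 1 := by omega
      have h2 : n ≠ 2 := by omega
      have h3 : n ≠ 3 := by omega
      have h4 : ¬ n ≤ 6 := by omega
      have h5 : ¬ n ≤ 15 := by omega
      norm_num [lowerTail, h1, h2, h3, h4, h5, h, h']

end EntropyBandit

namespace EntropyBandit

/-! ### The confidence width of a suboptimal arm after sufficiently many plays -/

/-- The maximum of log² x / x is 4 / e² ≈ 0.5413, attained at x = e². -/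
theorem sq_log_le_mul {x : ℝ} (hx : 1 ≤ x) : Real.log x ^ 2 ≤ 0.542 * x := by
  have hx0 : 0 < x := by linarith
  have hz : 0 < √x := Real.sqrt_pos.2 hx0
  have h1 : Real.log (√x) = Real.log x / 2 := Real.log_sqrt hx0.le
  have h2 := Real.log_le_sub_one_of_pos (x := √x / Real.exp 1) (by positivity)
  rw [Real.log_div hz.ne' (Real.exp_pos 1).ne', Real.log_exp, h1] at h2
  have h3 : √x / Real.exp 1 ≤ √x * 0.3679 := by
    rw [div_eq_mul_inv]
    refine mul_le_mul_of_nonneg_left ?_ hz.le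
    rw [inv_le_comm₀ (Real.exp_pos 1) (by norm_num)]
    exact le_trans (by norm_num) Real.exp_one_gt_d9.le
  have h4 : Real.log x ≤ 0.7358 * √x := by linarith
  calc Real.log x ^ 2 ≤ (0.7358 * √x) ^ 2 := by
        gcongr
        exact Real.log_nonneg hx
    _ = 0.7358 ^ 2 * x := by rw [mul_pow, Real.sq_sqrt hx0.le]
    _ ≤ _ := by gcongr; norm_num

theorem sq_log_div_anti {x y : ℝ} (hx : Real.exp 2 ≤ x) (hxy : x ≤ y) :
    Real.log y ^ 2 * x ≤ Real.log x ^ 2 * y := by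
  have hx0 : 0 < x := (Real.exp_pos 2).trans_le hx
  have hL : 2 ≤ Real.log x := (Real.le_log_iff_exp_le hx0).2 hx
  have hy0 : 0 < y := by linarith
  -- `log y - log x ≤ 2 (√(y / x) - 1)`
  set q := √(y / x) with hq
  have hq2 : q ^ 2 = y / x := Real.sq_sqrt (by positivity)
  have hq1 : 1 ≤ q := Real.one_le_sqrt.2 ((one_le_div hx0).2 hxy)
  have h1 := Real.log_le_sub_one_of_pos (x := q) (by linarith)
  rw [hq, Real.log_sqrt (by positivity), ← hq, Real.log_div hy0.ne' hx0.ne'] at h1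
  have h2 : Real.log y ≤ Real.log x * q := by nlinarith
  have hy : y = q ^ 2 * x := by rw [hq2]; field_simp
  have hLy : 0 ≤ Real.log y := by
    have := Real.log_le_log hx0 hxy; linarith
  calc Real.log y ^ 2 * x ≤ (Real.log x * q) ^ 2 * x := by gcongr
    _ = _ := by rw [hy]; ring

/-- This is where the 15 in Γ comes from. With y = 15 a log² a, one has log y ≤ 3.872 log a and
3.872² ≤ 15, so log² y ≤ y / a; since log² / id decreases beyond e², this passes to x ≥ y. For a ≤
1.84 the global bound suffices, as 0.542 · 1.84 < 1. -/
theorem log_sq_mul_le_of_le {a x : ℝ} (ha : 0 < a) (hx : 1 ≤ x)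
    (h : 15 * (a * Real.log a ^ 2) ≤ x) : Real.log x ^ 2 * a ≤ x := by
  rcases le_or_gt a 1.84 with h1 | h1
  · have := sq_log_le_mul hx
    calc Real.log x ^ 2 * a ≤ 0.542 * x * 1.84 := by gcongr
      _ ≤ x := by linarith
  · have hla : 0.6 ≤ Real.log a := by
      refine le_trans (by norm_num) ((le_log_of_pow_le (q := 1.84) (m := 3) (k := 5)
        (by norm_num) (by norm_num) (by norm_num)).trans (Real.log_le_log (by norm_num) h1.le))
    set y := 15 * (a * Real.log a ^ 2) with hy
    have hy0 : Real.exp 2 ≤ y := by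
      have h2 : Real.exp 2 = Real.exp 1 * Real.exp 1 := by rw [← Real.exp_add]; norm_num
      have h3 : Real.exp 1 * Real.exp 1 ≤ 2.7182818286 * 2.7182818286 := by
        have := Real.exp_one_lt_d9.le
        gcongr
      have h4 : 15 * (1.84 * 0.6 ^ 2) ≤ y := by rw [hy]; gcongr
      rw [h2]
      norm_num at h3 h4 ⊢
      linarith
    have h5 := sq_log_div_anti hy0 h
    have hx0 : 0 < x := by linarith
    have hL : 0 < Real.log a := by linarith
    have h6 : Real.log y = Real.log 15 + Real.log a + 2 * Real.log (Real.log a) := by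
      rw [hy, Real.log_mul (by norm_num) (by positivity), Real.log_mul (by positivity)
        (by positivity), Real.log_pow]
      push_cast; ring
    have h15 : Real.log 15 ≤ 2.71 := (log_le_of_le_pow (m := 65) (k := 24)
      (by norm_num) (by norm_num) (by norm_num)).trans (by norm_num)
    -- The tangent of log at 2 / 2.872: doubled, its slope brings the coefficient of log a to 3.872,
    -- and the constants then add up to something negative.
    have h7 : Real.log (Real.log a) ≤ Real.log a * (2.872 / 2) - Real.log (2.872 / 2) - 1 := by
      have := Real.log_le_sub_one_of_pos (x := Real.log a * (2.872 / 2)) (by positivity)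
      rw [Real.log_mul hL.ne' (by norm_num)] at this
      linarith
    have h8 : 0.3575 ≤ Real.log (2.872 / 2) := le_trans (by norm_num)
      (le_log_of_pow_le (m := 18) (k := 50) (by norm_num) (by norm_num) (by norm_num))
    have h9 : Real.log y ≤ 3.872 * Real.log a := by linarith
    have h10 : 0 ≤ Real.log y := Real.log_nonneg (by linarith [Real.add_one_le_exp (2 : ℝ)])
    have h11 : Real.log y ^ 2 ≤ 15 * Real.log a ^ 2 := by
      calc Real.log y ^ 2 ≤ (3.872 * Real.log a) ^ 2 := by gcongr
        _ = 3.872 ^ 2 * Real.log a ^ 2 := by ring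
        _ ≤ _ := by gcongr; norm_num
    have h12 : Real.log x ^ 2 * y ≤ 15 * Real.log a ^ 2 * x :=
      h5.trans (mul_le_mul_of_nonneg_right h11 hx0.le)
    have h13 : (15 * Real.log a ^ 2) * (Real.log x ^ 2 * a) ≤ (15 * Real.log a ^ 2) * x := by
      refine le_trans (le_of_eq ?_) h12
      rw [hy]; ring
    exact le_of_mul_le_mul_left h13 (by positivity)

/-- The upper confidence deviation with `S` observed symbols, plus the upper deviation of the
plug-in estimator, at confidence `exp (-2 s²)`. -/
noncomputable def upperWidth (n : ℕ) (κ S s : ℝ) : ℝ :=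
  Real.log (1 + 1 / n * ((S + s) * (1 - Real.exp (-((n : ℝ) / κ)))⁻¹ - 1))
    + 2 * Real.log n * √(s ^ 2 + Real.log 2 / 2) / √n
    + plugInDiff n * √(s ^ 2 + Real.log 2 / 2) / √n

theorem upperWidth_mono {n : ℕ} {κ S S' s s' : ℝ} (hn : 0 < n) (hκ : 0 < κ) (hS1 : 1 ≤ S)
    (hS : S ≤ S') (hs0 : 0 ≤ s) (hs : s ≤ s') : upperWidth n κ S s ≤ upperWidth n κ S' s' := by
  have hn0 : (1 : ℝ) ≤ n := by exact_mod_cast hn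
  have hr := one_le_inv_one_sub_exp_neg (u := (n : ℝ) / κ) (by positivity)
  have hL := Real.log_nonneg hn0
  have hd := plugInDiff_nonneg n
  have h1 : 0 ≤ (S + s) * (1 - Real.exp (-((n : ℝ) / κ)))⁻¹ - 1 := by nlinarith
  have h2 : 0 ≤ 1 / (n : ℝ) * ((S + s) * (1 - Real.exp (-((n : ℝ) / κ)))⁻¹ - 1) :=
    mul_nonneg (by positivity) h1
  unfold upperWidth
  gcongr

-- The gap is split into βΔ for the bias correction and (1 - β)Δ for the deviations, one term of Γ
-- for each. For n ≤ 7 this is direct, since n + κ ≤ 8 κ. For n ≥ 8 the term s / n is not controlled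
-- by the first term of Γ; it is paid for by `plugInDiff`, which keeps the deviations within 0.871
-- of their budget.
set_option maxHeartbeats 1000000 in
theorem upperWidth_lt {n : ℕ} {κ S s β Δ : ℝ} (hn : 0 < n) (hκ : 1 ≤ κ) (hS1 : 1 ≤ S)
    (hSκ : S ≤ κ) (hs : 0 ≤ s) (hβ : β ∈ Set.Ioo (0 : ℝ) 1) (hΔ : 0 < Δ)
    (h1 : 2 * √κ * (√S + √s) /
      min (Real.exp (β * Δ / 2) - 1) (√(Real.exp (β * Δ / 2) - 1)) ≤ n)
    (h2 : 15 * polylog 2 (8 * (Real.log 2 + 2 * s ^ 2) / ((1 - β) ^ 2 * Δ ^ 2)) ≤ n) :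
    upperWidth n κ S s < Δ := by
  obtain ⟨hβ0, hβ1⟩ := hβ
  have hn0 : (1 : ℝ) ≤ n := by exact_mod_cast hn
  have hnpos : (0 : ℝ) < n := by linarith
  have hκ0 : 0 < κ := by linarith
  have hS0 : 0 ≤ S := by linarith
  have hlog2 := Real.log_two_gt_d9
  have hz0 : 0 < √(n : ℝ) := Real.sqrt_pos.2 hnpos
  have hzz : √(n : ℝ) ^ 2 = n := Real.sq_sqrt hnpos.le
  have hL := Real.log_nonneg hn0
  set E := Real.exp (β * Δ / 2) - 1 with hE
  have hE0 : 0 < E := by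
    have : 0 < β * Δ / 2 := by positivity
    have := Real.add_one_lt_exp this.ne'
    linarith
  have hexp : Real.exp (β * Δ) = (1 + E) ^ 2 := by
    rw [hE, add_sub_cancel, ← Real.exp_nat_mul]
    congr 1; push_cast; ring
  -- consequences of the first lower bound on `n`
  have hm : 2 * √κ * (√S + √s) ≤ n * min E (√E) := by
    rwa [div_le_iff₀ (lt_min hE0 (Real.sqrt_pos.2 hE0))] at h1
  have hm1 : 2 * √κ * (√S + √s) ≤ n * E := hm.trans (by gcongr; exact min_le_left _ _)
  have hm2 : 4 * κ * (S + s) ≤ n ^ 2 * E := by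
    have h3 : 2 * √κ * (√S + √s) ≤ n * √E := hm.trans (by gcongr; exact min_le_right _ _)
    have h4 : (2 * √κ * (√S + √s)) ^ 2 ≤ (n * √E) ^ 2 := by gcongr
    rw [mul_pow, mul_pow, mul_pow, Real.sq_sqrt hE0.le, Real.sq_sqrt hκ0.le] at h4
    have h5 : S + s ≤ (√S + √s) ^ 2 := by
      have h6 := mul_nonneg (Real.sqrt_nonneg S) (Real.sqrt_nonneg s)
      nlinarith [Real.sq_sqrt hS0, Real.sq_sqrt hs]
    have h7 : 2 ^ 2 * κ * (S + s) ≤ 2 ^ 2 * κ * (√S + √s) ^ 2 := by gcongr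
    linarith
  -- consequence of the second lower bound
  set w := √(s ^ 2 + Real.log 2 / 2) with hw
  have hw2 : w ^ 2 = s ^ 2 + Real.log 2 / 2 := Real.sq_sqrt (by positivity)
  have hw0 : 0 ≤ w := Real.sqrt_nonneg _
  have hε : 4 * Real.log n * w / √n ≤ (1 - β) * Δ := by
    set a := 8 * (Real.log 2 + 2 * s ^ 2) / ((1 - β) ^ 2 * Δ ^ 2) with ha
    have hβ' : 0 < 1 - β := by linarith
    have ha0 : 0 < a := by positivity
    have h3 := log_sq_mul_le_of_le ha0 hn0 h2
    refine le_of_sq_le_sq ?_ (by positivity)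
    rw [div_pow, mul_pow, hw2, hzz, div_le_iff₀ hnpos]
    have h4 : a * ((1 - β) ^ 2 * Δ ^ 2) = 8 * (Real.log 2 + 2 * s ^ 2) := by
      rw [ha]; field_simp
    have h5 := mul_le_mul_of_nonneg_right h3 (show 0 ≤ (1 - β) ^ 2 * Δ ^ 2 by positivity)
    rw [mul_assoc, h4] at h5
    nlinarith
  have hr := inv_one_sub_exp_neg_le_one_add (u := (n : ℝ) / κ) (by positivity)
  rw [one_div_div] at hr
  have hr1 := one_le_inv_one_sub_exp_neg (u := (n : ℝ) / κ) (by positivity)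
  have hd1 : plugInDiff n ≤ 2 * Real.log n := min_le_left _ _
  have hd2 : plugInDiff n ≤ Real.log n + 1 := min_le_right _ _
  unfold upperWidth
  rw [← hw]
  set r := (1 - Real.exp (-((n : ℝ) / κ)))⁻¹
  have hbr : 1 / (n : ℝ) * ((S + s) * r - 1) ≤ (S + s) / n + κ * (S + s) / n ^ 2 - 1 / n := by
    have h3 : (S + s) * r ≤ (S + s) * (1 + κ / n) := by gcongr
    have h4 : (S + s) / n + κ * (S + s) / n ^ 2 - 1 / n
      = 1 / (n : ℝ) * ((S + s) * (1 + κ / n) - 1) := by field_simp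
    rw [h4]
    gcongr
  have hb0 : 0 < 1 + 1 / (n : ℝ) * ((S + s) * r - 1) := by
    have h3 : 0 ≤ (S + s) * r - 1 := by nlinarith
    have h4 : 0 ≤ 1 / (n : ℝ) * ((S + s) * r - 1) := mul_nonneg (by positivity) h3
    linarith
  rcases Nat.lt_or_ge n 8 with h8 | h8
  · have hn7 : (n : ℝ) ≤ 7 := by exact_mod_cast Nat.lt_succ_iff.1 h8
    have h3 : (S + s) / n + κ * (S + s) / n ^ 2 ≤ 2 * E := by
      have h4 : (S + s) / n + κ * (S + s) / n ^ 2 = (S + s) * (n + κ) / n ^ 2 := by field_simp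
      rw [h4, div_le_iff₀ (by positivity)]
      have h5 : (S + s) * (n + κ) ≤ (S + s) * (8 * κ) := by gcongr; linarith
      linarith
    have h4 : Real.log (1 + 1 / n * ((S + s) * r - 1)) < β * Δ := by
      rw [Real.log_lt_iff_lt_exp hb0, hexp]
      have : 0 ≤ 1 / (n : ℝ) := by positivity
      nlinarith
    have h5 : plugInDiff n * w / √n ≤ 2 * Real.log n * w / √n := by gcongr
    have h6 : 4 * Real.log n * w / √n = 2 * Real.log n * w / √n + 2 * Real.log n * w / √n := by
      ring
    linarith
  · have hn8 : (8 : ℝ) ≤ n := by exact_mod_cast h8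
    have hL8 : 2.079 ≤ Real.log n := by
      have : Real.log 8 = 3 * Real.log 2 := by
        rw [show (8 : ℝ) = 2 ^ 3 by norm_num, Real.log_pow]; push_cast; ring
      have := Real.log_le_log (by norm_num) hn8
      linarith
    have hz8 : 2.82 ≤ √(n : ℝ) := Real.le_sqrt_of_sq_le (by norm_num; linarith)
    set c := 4 * Real.log n * w / √n with hc
    have hc0 : 0 ≤ c := by positivity
    have h3 : 2 * Real.log n * w / √n + plugInDiff n * w / √n ≤ 0.871 * c := by
      rw [← add_div, ← add_mul, hc, ← mul_div_assoc, ← mul_assoc]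
      gcongr
      linarith
    have hsw : s ≤ w := Real.le_sqrt_of_sq_le (by linarith)
    have h4 : s / n ≤ 0.043 * c := by
      have h5 : s / n = s / √n / √n := by rw [div_div, ← sq, hzz]
      rw [h5, hc, div_le_iff₀ hz0]
      have h6 : 0.043 * (4 * Real.log n * w / √n) * √n = 0.172 * Real.log n * w := by
        field_simp; ring
      rw [h6, div_le_iff₀ hz0]
      have h7 : 1 ≤ 0.172 * Real.log n * √n := by
        calc (1 : ℝ) ≤ 0.172 * 2.079 * 2.82 := by norm_num
          _ ≤ _ := by gcongr
      calc s ≤ w := hsw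
        _ ≤ w * (0.172 * Real.log n * √n) := le_mul_of_one_le_right hw0 h7
        _ = _ := by ring
    have h5 : S / n ≤ E / 2 := by
      rw [div_le_iff₀ hnpos]
      have h6 : S ≤ √κ * √S := by
        calc S = √S * √S := (Real.mul_self_sqrt hS0).symm
          _ ≤ _ := by gcongr
      have h7 : 0 ≤ √κ * √s := by positivity
      nlinarith
    have h6 : κ * (S + s) / n ^ 2 ≤ E / 4 := by
      rw [div_le_iff₀ (by positivity)]; linarith
    have h7 : Real.log (1 + 1 / n * ((S + s) * r - 1)) < β * Δ + 0.129 * c := by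
      rw [Real.log_lt_iff_lt_exp hb0, Real.exp_add, hexp]
      have h9 := Real.add_one_le_exp (0.129 * c)
      have h10 : (1 + E) ^ 2 * (0.129 * c + 1) ≤ (1 + E) ^ 2 * Real.exp (0.129 * c) := by gcongr
      have h11 : 0 ≤ 1 / (n : ℝ) := by positivity
      have h12 : (S + s) / n = S / n + s / n := add_div _ _ _
      have h13 : 1 + 2 * E + 0.129 * c ≤ (1 + E) ^ 2 * (0.129 * c + 1) := by
        have : 0 ≤ E * c := by positivity
        have : 0 ≤ E ^ 2 * c := by positivity
        nlinarith [sq_nonneg E]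
      linarith
    linarith

section upperTail

variable {𝒴 : Type*} {T : Finset 𝒴} {p : 𝒴 → ℝ}

theorem IsWeight.le_one (hp : IsWeight T p) {x : 𝒴} (hx : x ∈ T) : p x ≤ 1 := by
  rw [← hp.sum_eq_one]
  exact Finset.single_le_sum (fun y hy => hp.nonneg y hy) hx

/-- No bias enters, since the plug-in estimator is biased downwards. The summand log 2 / 2 produces
the factor 1/2. One sample is separate because its difference bound is zero. -/
theorem iidProb_gt_le (hp : IsWeight T p) (hpos : ∀ x ∈ T, 0 < p x) {n : ℕ} (hn : 1 ≤ n) (s : ℝ) :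
    iidProb T p n (fun l => ∑ x ∈ T, Real.negMulLog (p x)
      + plugInDiff n * √(s ^ 2 + Real.log 2 / 2) / √n < plugInEntropy l)
      ≤ 1 / 2 * Real.exp (-(2 * s ^ 2)) := by
  have hn0 : (0 : ℝ) < n := by exact_mod_cast hn
  rcases hn.eq_or_lt with rfl | hn2
  · rw [iidProb_false hp]
    · positivity
    · intro l hl _
      obtain ⟨x, rfl⟩ := List.length_eq_one_iff.1 hl
      have h1 : 0 ≤ ∑ x ∈ T, Real.negMulLog (p x) := Finset.sum_nonneg fun x hx =>
        Real.negMulLog_nonneg (hp.nonneg x hx) (hp.le_one hx)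
      have h2 := plugInDiff_nonneg 1
      rw [plugInEntropy_singleton, not_lt]
      positivity
  · have hd := plugInDiff_pos hn2
    have hH := iidMean_plugInEntropy_le hp hpos (by omega : 0 < n)
    have hlog2 := Real.log_two_gt_d9
    refine (iidProb_mono hp fun l _ _ hl => ?_).trans
      ((iidProb_ge_le hp (by omega) (div_pos hd hn0)
      (e := plugInDiff n * √(s ^ 2 + Real.log 2 / 2) / √n) (by positivity)
        (hasBoundedDiff_plugInEntropy n)).trans (le_of_eq ?_))
    · linarith
    · have h1 : 2 * (plugInDiff n * √(s ^ 2 + Real.log 2 / 2) / √n) ^ 2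
          / (n * (plugInDiff n / n) ^ 2) = 2 * s ^ 2 + Real.log 2 := by
        rw [div_pow, mul_pow, Real.sq_sqrt (by positivity), Real.sq_sqrt hn0.le]
        field_simp
      rw [h1, neg_add, Real.exp_add, Real.exp_neg (Real.log 2), Real.exp_log (by norm_num)]
      ring

end upperTail

/-! ### The samples of an arm are dominated by independent samples -/

section bandit

variable {K : ℕ} {𝒳 : Fin K → Type*} {Ω : Type*}

theorem playCount_succ (I : ℕ → Ω → Fin K) (i : Fin K) (t : ℕ) (ω : Ω) :
    playCount I i (t + 1) ω = playCount I i t ω + if I (t + 1) ω = i then 1 else 0 := by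
  rw [playCount, ← Order.succ_eq_add_one t, ← Finset.insert_Icc_right_eq_Icc_succ (by simp),
    Finset.filter_insert]
  split_ifs with h
  · rw [Finset.card_insert_of_notMem (by simp)]; rfl
  · rfl

theorem length_samples (X : ∀ i, ℕ → Ω → 𝒳 i) (I : ℕ → Ω → Fin K) (i : Fin K) (t : ℕ) (ω : Ω) :
    (samples X I i t ω).length = playCount I i t ω := by
  induction t with
  | zero => simp [samples, playCount]
  | succ t ih =>
    rw [playCount_succ, samples]
    split_ifs with h
    · simp [ih]
    · simp [ih]

variable [∀ i, Countable (𝒳 i)] [∀ i, MeasurableSpace (𝒳 i)]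
  [∀ i, MeasurableSingletonClass (𝒳 i)] {mΩ : MeasurableSpace Ω} {μ : Measure Ω}
  {ℱ : Filtration ℕ mΩ} {p : ∀ i, PMF (𝒳 i)} {X : ∀ i, ℕ → Ω → 𝒳 i} {I : ℕ → Ω → Fin K}

theorem measurableSet_samples_eq (hX : IsMemoryless μ ℱ p X)
    (hI : ∀ t, Measurable[ℱ t] (I (t + 1))) (i : Fin K) (t : ℕ) (l : List (𝒳 i)) :
    MeasurableSet[ℱ t] {ω | samples X I i t ω = l} := by
  induction t generalizing l with
  | zero =>
    by_cases h : ([] : List (𝒳 i)) = l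
    · simp [samples, h]
    · simp [samples, h]
  | succ t ih =>
    have hIm : MeasurableSet[ℱ (t + 1)] {ω | I (t + 1) ω = i} :=
      ℱ.mono (Nat.le_succ t) _ (hI t (measurableSet_singleton i))
    have hs : ∀ l, MeasurableSet[ℱ (t + 1)] {ω | samples X I i t ω = l} := fun l =>
      ℱ.mono (Nat.le_succ t) _ (ih l)
    have hx : ∀ x, MeasurableSet[ℱ (t + 1)] {ω | X i (t + 1) ω = x} := fun x =>
      hX.measurable_symbol i t (measurableSet_singleton x)
    have heq : {ω | samples X I i (t + 1) ω = l}
        = ({ω | I (t + 1) ω = i} ∩ ⋃ x : 𝒳 i, ⋃ l' : List (𝒳 i), ⋃ _ : l' ++ [x] = l,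
            {ω | samples X I i t ω = l'} ∩ {ω | X i (t + 1) ω = x})
          ∪ ({ω | I (t + 1) ω = i}ᶜ ∩ {ω | samples X I i t ω = l}) := by
      ext ω
      by_cases h : I (t + 1) ω = i <;> simp [samples, h]
    rw [heq]
    refine MeasurableSet.union (hIm.inter (MeasurableSet.iUnion fun x => MeasurableSet.iUnion
      fun l' => MeasurableSet.iUnion fun _ => (hs l').inter (hx x))) (hIm.compl.inter (hs l))

theorem measurableSet_samples (hX : IsMemoryless μ ℱ p X)
    (hI : ∀ t, Measurable[ℱ t] (I (t + 1))) (i : Fin K) (t : ℕ) (B : List (𝒳 i) → Prop) :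
    MeasurableSet[ℱ t] {ω | B (samples X I i t ω)} := by
  have heq : {ω | B (samples X I i t ω)}
      = ⋃ l : List (𝒳 i), ⋃ _ : B l, {ω | samples X I i t ω = l} := by
    ext ω; simp
  rw [heq]
  exact MeasurableSet.iUnion fun l => MeasurableSet.iUnion fun _ =>
    measurableSet_samples_eq hX hI i t l

/-- Induction on the round. The prefix `l ++ [x]` appears exactly when the samples are `l`, the arm
is played and the new symbol is `x`. The first two conditions are decided before the round, so
independence gives the factor p(x). They form `F`, which is disjoint from `G`, and both lie in the
next `G`. -/
theorem measure_prefix_concat_le (hX : IsMemoryless μ ℱ p X)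
    (hI : ∀ t, Measurable[ℱ t] (I (t + 1))) (i : Fin K) (t : ℕ) (l : List (𝒳 i)) (x : 𝒳 i) :
    μ {ω | l ++ [x] <+: samples X I i t ω}
      ≤ p i x * μ {ω | l <+: samples X I i t ω ∧ samples X I i t ω ≠ l} := by
  induction t with
  | zero => simp [samples]
  | succ t ih =>
    set F := {ω | samples X I i t ω = l} ∩ {ω | I (t + 1) ω = i}
    set G := {ω | l <+: samples X I i t ω ∧ samples X I i t ω ≠ l}
    have hF : MeasurableSet[ℱ t] F :=
      (measurableSet_samples_eq hX hI i t l).inter (hI t (measurableSet_singleton i))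
    have hG : MeasurableSet[ℱ t] G :=
      measurableSet_samples hX hI i t fun l' => l <+: l' ∧ l' ≠ l
    have h1 : {ω | l ++ [x] <+: samples X I i (t + 1) ω} ⊆
        {ω | l ++ [x] <+: samples X I i t ω} ∪ ({ω | X i (t + 1) ω = x} ∩ F) := by
      intro ω hω
      simp only [Set.mem_ofPred_eq, samples] at hω
      split_ifs at hω with h
      · rw [List.prefix_concat_iff] at hω
        rcases hω with hω | hω
        · right
          obtain ⟨h1, h2⟩ := List.append_inj' hω rfl
          exact ⟨by simpa using h2.symm, h1.symm, h⟩
        · exact Or.inl hω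
      · exact Or.inl hω
    have h2 : G ∪ F ⊆ {ω | l <+: samples X I i (t + 1) ω ∧ samples X I i (t + 1) ω ≠ l} := by
      rintro ω (⟨h3, h4⟩ | ⟨h3, h4⟩)
      · simp only [Set.mem_ofPred_eq, samples]
        split_ifs with h
        · refine ⟨h3.trans (List.prefix_append _ _), fun h5 => h4 ?_⟩
          have h6 := h3.length_le
          have h7 := congrArg List.length h5
          simp at h7
          omega
        · exact ⟨h3, h4⟩
      · simp only [Set.mem_ofPred_eq] at h3 h4
        simp [samples, h3, h4]
    have hdisj : Disjoint G F := by
      rw [Set.disjoint_left]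
      rintro ω ⟨_, h3⟩ ⟨h4, _⟩
      exact h3 h4
    have hind : μ ({ω | X i (t + 1) ω = x} ∩ F) = p i x * μ F := by
      rw [← hX.law_symbol i t x]
      exact (Indep_iff _ _ μ).1 (hX.indep_past i t) _ _
        ⟨{x}, measurableSet_singleton x, rfl⟩ hF
    calc μ {ω | l ++ [x] <+: samples X I i (t + 1) ω}
        ≤ μ {ω | l ++ [x] <+: samples X I i t ω} + μ ({ω | X i (t + 1) ω = x} ∩ F) :=
          (measure_mono h1).trans (measure_union_le _ _)
      _ ≤ p i x * μ G + p i x * μ F := by rw [hind]; gcongr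
      _ = p i x * μ (G ∪ F) := by
          rw [measure_union hdisj (ℱ.le t _ hF), mul_add]
      _ ≤ _ := by gcongr

/-- Only an inequality, because the arm may not have been played often enough. This replaces a
coupling with an independent sequence. -/
theorem measure_prefix_le [IsProbabilityMeasure μ] (hX : IsMemoryless μ ℱ p X)
    (hI : ∀ t, Measurable[ℱ t] (I (t + 1))) (i : Fin K) (t : ℕ) (l : List (𝒳 i)) :
    μ {ω | l <+: samples X I i t ω} ≤ (l.map (p i)).prod := by
  induction l using List.reverseRecOn with
  | nil => simp
  | append_singleton l x ih =>
    refine (measure_prefix_concat_le hX hI i t l x).trans ?_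
    rw [List.map_append, List.prod_append, mul_comm]
    simp only [List.map_cons, List.map_nil, List.prod_singleton]
    gcongr
    exact (measure_mono fun ω hω => hω.1).trans ih

/-- The fixed prefix `c` serves the induction: each step moves the first free sample into it. -/
theorem measure_exists_append_le [IsProbabilityMeasure μ] (hX : IsMemoryless μ ℱ p X)
    (hI : ∀ t, Measurable[ℱ t] (I (t + 1))) (i : Fin K) (t : ℕ) {T : Finset (𝒳 i)}
    (hT : ∀ x, x ∉ T → p i x = 0) (hp : IsWeight T fun x => (p i x).toReal) (n : ℕ)
    (B : List (𝒳 i) → Prop) (c : List (𝒳 i)) :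
    μ {ω | ∃ l : List (𝒳 i), l.length = n ∧ B l ∧ samples X I i t ω = c ++ l}
      ≤ (c.map (p i)).prod * ENNReal.ofReal (iidProb T (fun x => (p i x).toReal) n B) := by
  induction n generalizing B c with
  | zero =>
    by_cases h : B []
    · have h1 : iidProb T (fun x => (p i x).toReal) 0 B = 1 := by simp [iidProb, iidMean, h]
      rw [h1, ENNReal.ofReal_one, mul_one]
      refine (measure_mono ?_).trans (measure_prefix_le hX hI i t c)
      rintro ω ⟨l, _, _, h4⟩
      exact ⟨l, h4.symm⟩
    · have : {ω | ∃ l : List (𝒳 i), l.length = 0 ∧ B l ∧ samples X I i t ω = c ++ l} = ∅ := by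
        rw [Set.eq_empty_iff_forall_notMem]
        rintro ω ⟨l, h2, h3, -⟩
        rw [List.length_eq_zero_iff] at h2
        exact h (h2 ▸ h3)
      rw [this]; simp
  | succ n ih =>
    have h1 : {ω | ∃ l : List (𝒳 i), l.length = n + 1 ∧ B l ∧ samples X I i t ω = c ++ l} ⊆
        ⋃ x : 𝒳 i, {ω | ∃ l : List (𝒳 i), l.length = n ∧ B (x :: l) ∧
          samples X I i t ω = (c ++ [x]) ++ l} := by
      rintro ω ⟨l, h2, h3, h4⟩
      obtain ⟨x, l', rfl⟩ := List.exists_cons_of_length_eq_add_one h2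
      exact Set.mem_iUnion.2 ⟨x, l', by simpa using h2, h3, by simpa using h4⟩
    refine (measure_mono h1).trans ((measure_iUnion_le _).trans ?_)
    refine (ENNReal.tsum_le_tsum fun x => ih (fun l => B (x :: l)) (c ++ [x])).trans (le_of_eq ?_)
    rw [tsum_eq_sum (s := T) fun x hx => by simp [hT x hx], iidProb_succ,
      ENNReal.ofReal_sum_of_nonneg fun x hx => mul_nonneg (hp.nonneg x hx) (iidProb_nonneg hp _ _),
      Finset.mul_sum]
    refine Finset.sum_congr rfl fun x hx => ?_
    rw [ENNReal.ofReal_mul (hp.nonneg x hx), ENNReal.ofReal_toReal ((p i).apply_ne_top x)]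
    simp [mul_assoc]

theorem measure_samples_le [IsProbabilityMeasure μ] (hX : IsMemoryless μ ℱ p X)
    (hI : ∀ t, Measurable[ℱ t] (I (t + 1))) (i : Fin K) (t : ℕ) {T : Finset (𝒳 i)}
    (hT : ∀ x, x ∉ T → p i x = 0) (hp : IsWeight T fun x => (p i x).toReal) (n : ℕ)
    (B : List (𝒳 i) → Prop) :
    μ {ω | (samples X I i t ω).length = n ∧ B (samples X I i t ω)}
      ≤ ENNReal.ofReal (iidProb T (fun x => (p i x).toReal) n B) := by
  refine (measure_mono ?_).trans ((measure_exists_append_le hX hI i t hT hp n B []).trans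
    (le_of_eq (by simp)))
  rintro ω ⟨h1, h2⟩
  exact ⟨_, h1, h2, by simp⟩

end bandit

/-! ### Summing the failure probabilities -/

/-- Comparison of a power with the increment of its primitive, which makes the series telescope; it
follows from ((t - 1) / t)^(-a) ≥ 1 + a / t. -/
theorem rpow_one_sub_le {a : ℝ} (ha : 0 < a) {t : ℝ} (ht : 1 < t) :
    a * t ^ (-1 - a) ≤ (t - 1) ^ (-a) - t ^ (-a) := by
  have ht0 : 0 < t := by linarith
  have h1 : t ^ (-1 - a) = t ^ (-a) / t := by
    rw [show -1 - a = -a - 1 by ring, Real.rpow_sub_one ht0.ne']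
  have h2 : 1 + a / t ≤ ((t - 1) / t) ^ (-a) := by
    have h3 : 0 < (t - 1) / t := div_pos (by linarith) ht0
    rw [Real.rpow_def_of_pos h3]
    have h4 := Real.log_le_sub_one_of_pos h3
    have h5 : (t - 1) / t - 1 = -(1 / t) := by field_simp; ring
    have h6 : a / t ≤ Real.log ((t - 1) / t) * -a := by
      rw [h5] at h4
      have := mul_le_mul_of_nonneg_left h4 ha.le
      rw [mul_neg, mul_one_div] at this
      linarith
    have := Real.add_one_le_exp (Real.log ((t - 1) / t) * -a)
    linarith
  have h3 : (t - 1) ^ (-a) = ((t - 1) / t) ^ (-a) * t ^ (-a) := by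
    rw [← Real.mul_rpow (div_nonneg (by linarith) ht0.le) ht0.le]
    congr 1; field_simp
  have h4 : 0 < t ^ (-a) := by positivity
  rw [h1, h3]
  have := mul_le_mul_of_nonneg_right h2 h4.le
  calc a * (t ^ (-a) / t) = (1 + a / t) * t ^ (-a) - t ^ (-a) := by field_simp; ring
    _ ≤ _ := by linarith

theorem sum_rpow_one_sub_le {α : ℝ} (hα : 2 < α) (t : ℕ) :
    ∑ m ∈ Finset.Icc 1 t, ((m : ℝ) + 1) * ((m : ℝ) + 1) ^ (-α) ≤ 1 / (α - 2) := by
  have ha : 0 < α - 2 := by linarith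
  have key : ∑ m ∈ Finset.Icc 1 t, ((m : ℝ) + 1) * ((m : ℝ) + 1) ^ (-α)
      ≤ 1 / (α - 2) * (1 - ((t : ℝ) + 1) ^ (-(α - 2))) := by
    induction t with
    | zero => simp
    | succ t ih =>
      rw [Finset.sum_Icc_succ_top (by omega)]
      have ht : (1 : ℝ) < ((t + 1 : ℕ) : ℝ) + 1 := by
        push_cast; linarith [(Nat.cast_nonneg t : (0 : ℝ) ≤ t)]
      have h1 := rpow_one_sub_le ha ht
      rw [show -1 - (α - 2) = 1 + -α by ring, Real.rpow_add (by linarith), Real.rpow_one] at h1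
      have h2 : ((t + 1 : ℕ) : ℝ) + 1 - 1 = (t : ℝ) + 1 := by push_cast; ring
      rw [h2] at h1
      have h3 : (((t + 1 : ℕ) : ℝ) + 1) * (((t + 1 : ℕ) : ℝ) + 1) ^ (-α)
          ≤ 1 / (α - 2) * (((t : ℝ) + 1) ^ (-(α - 2))
            - (((t + 1 : ℕ) : ℝ) + 1) ^ (-(α - 2))) := by
        rw [one_div_mul_eq_div, le_div_iff₀ ha]; linarith
      linarith
  refine key.trans (mul_le_of_le_one_right (by positivity) ?_)
  have : 0 ≤ ((t : ℝ) + 1) ^ (-(α - 2)) := by positivity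
  linarith

/-- The excess of `∑ n ≤ m, (lowerTail n + 1 / 2)` over `4 (m + 1)`. -/
noncomputable def tailExcess (m : ℕ) : ℝ :=
  if m ≤ 6 then 0 else if m ≤ 14 then 0.7 + 3.8 * ((m : ℝ) - 7) else 31.1

/-- From n = 16 on each summand is exactly 4, so the excess accumulated by then stays constant. -/
theorem sum_lowerTail_le (m : ℕ) :
    ∑ n ∈ Finset.Icc 1 m, (lowerTail n + 1 / 2) ≤ 4 * ((m : ℝ) + 1) + tailExcess m := by
  rcases Nat.lt_or_ge m 16 with h | h
  · interval_cases m <;>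
      norm_num [Finset.sum_Icc_succ_top, lowerTail, tailExcess]
  · have key : ∑ n ∈ Finset.Icc 1 m, (lowerTail n + 1 / 2) ≤ 4 * ((m : ℝ) + 1) + 31.1 := by
      induction m, h using Nat.le_induction with
      | base => norm_num [Finset.sum_Icc_succ_top, lowerTail]
      | succ m hm ih =>
        rw [Finset.sum_Icc_succ_top (by omega)]
        have h1 : lowerTail (m + 1) = 3.5 := by
          have h1 : ¬ m + 1 ≤ 1 := by omega
          have h2 : m + 1 ≠ 2 := by omega
          have h3 : m + 1 ≠ 3 := by omega
          have h4 : ¬ m + 1 ≤ 6 := by omega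
          have h5 : ¬ m + 1 ≤ 15 := by omega
          simp only [lowerTail, h1, h2, h3, h4, h5, if_false]
        rw [h1]
        push_cast at ih ⊢
        linarith
    have h1 : tailExcess m = 31.1 := by
      have h1 : ¬ m ≤ 6 := by omega
      have h2 : ¬ m ≤ 14 := by omega
      simp only [tailExcess, h1, h2, if_false]
    rw [h1]; exact key

theorem tailExcess_nonneg (m : ℕ) : 0 ≤ tailExcess m := by
  unfold tailExcess
  split_ifs with h1 h2
  · exact le_rfl
  · have : (7 : ℝ) ≤ m := by exact_mod_cast (by omega : 7 ≤ m)
    linarith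
  · norm_num

theorem sum_tailExcess_le (t : ℕ) :
    ∑ m ∈ Finset.Icc 1 t, tailExcess m * (((m : ℝ) + 1) ^ 2)⁻¹ ≤ 3 := by
  have key : ∀ t : ℕ, 14 ≤ t → ∑ m ∈ Finset.Icc 1 t, tailExcess m * (((m : ℝ) + 1) ^ 2)⁻¹
      ≤ 2.8 - 31.1 / ((t : ℝ) + 1) := by
    intro t ht
    induction t, ht using Nat.le_induction with
    | base => norm_num [Finset.sum_Icc_succ_top, tailExcess]
    | succ t ht ih =>
      rw [Finset.sum_Icc_succ_top (by omega)]
      have h1 : tailExcess (t + 1) = 31.1 := by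
        have h1 : ¬ t + 1 ≤ 6 := by omega
        have h2 : ¬ t + 1 ≤ 14 := by omega
        simp only [tailExcess, h1, h2, if_false]
      rw [h1]
      have h2 : (31.1 : ℝ) * ((((t + 1 : ℕ) : ℝ) + 1) ^ 2)⁻¹
          ≤ 31.1 / ((t : ℝ) + 1) - 31.1 / (((t + 1 : ℕ) : ℝ) + 1) := by
        push_cast
        have h3 : 31.1 / ((t : ℝ) + 1) - 31.1 / ((t : ℝ) + 1 + 1)
            = 31.1 * (((t : ℝ) + 1) * ((t : ℝ) + 1 + 1))⁻¹ := by field_simp; ring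
        rw [h3]
        gcongr
        nlinarith
      linarith
  have hmono : ∑ m ∈ Finset.Icc 1 t, tailExcess m * (((m : ℝ) + 1) ^ 2)⁻¹
      ≤ ∑ m ∈ Finset.Icc 1 (max t 14), tailExcess m * (((m : ℝ) + 1) ^ 2)⁻¹ := by
    refine Finset.sum_le_sum_of_subset_of_nonneg
      (Finset.Icc_subset_Icc_right (le_max_left _ _)) fun m _ _ => ?_
    exact mul_nonneg (tailExcess_nonneg m) (by positivity)
  have h1 := key _ (le_max_right t 14)
  have h2 : (0 : ℝ) ≤ 31.1 / (((max t 14 : ℕ) : ℝ) + 1) := by positivity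
  linarith

/-- The leading 1 is the cost of rounding Γ up. The excess contributes at most 3, already at
exponent 2, and the main part 4 / (α - 2). -/
theorem sum_failure_le {α : ℝ} (hα : 2 < α) (t : ℕ) :
    1 + ∑ m ∈ Finset.Icc 1 t, (∑ n ∈ Finset.Icc 1 m, (lowerTail n + 1 / 2)) *
      ((m : ℝ) + 1) ^ (-α) ≤ 4 * (α - 1) / (α - 2) := by
  have h1 : ∀ m ∈ Finset.Icc 1 t, (∑ n ∈ Finset.Icc 1 m, (lowerTail n + 1 / 2)) *
      ((m : ℝ) + 1) ^ (-α) ≤ 4 * (((m : ℝ) + 1) * ((m : ℝ) + 1) ^ (-α))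
        + tailExcess m * (((m : ℝ) + 1) ^ 2)⁻¹ := by
    intro m _
    have h2 : 0 ≤ ((m : ℝ) + 1) ^ (-α) := by positivity
    have h3 := mul_le_mul_of_nonneg_right (sum_lowerTail_le m) h2
    have h4 : ((m : ℝ) + 1) ^ (-α) ≤ (((m : ℝ) + 1) ^ 2)⁻¹ := by
      rw [← Real.rpow_natCast, ← Real.rpow_neg (by positivity)]
      exact Real.rpow_le_rpow_of_exponent_le (by linarith [(Nat.cast_nonneg m : (0 : ℝ) ≤ m)])
        (by push_cast; linarith)
    have h5 := mul_le_mul_of_nonneg_left h4 (tailExcess_nonneg m)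
    linarith
  have h2 := Finset.sum_le_sum h1
  rw [Finset.sum_add_distrib, ← Finset.mul_sum] at h2
  have h3 := sum_rpow_one_sub_le hα t
  have h4 := sum_tailExcess_le t
  have h5 : 4 * (α - 1) / (α - 2) = 4 + 4 * (1 / (α - 2)) := by
    have : α - 2 ≠ 0 := by linarith
    field_simp; ring
  linarith

/-! ### Probability mass functions with finite support -/

section pmf

variable {𝒴 : Type*} {q : PMF 𝒴} {κ : ℝ}

theorem finite_support_of_le (hκ : 0 < κ) (h : ∀ x ∈ q.support, 1 / κ ≤ (q x).toReal) :
    q.support.Finite := by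
  have hs : Summable fun x => (q x).toReal := ENNReal.summable_toReal q.tsum_coe_ne_top
  have h1 := hs.tendsto_cofinite_zero.eventually (gt_mem_nhds (show 0 < 1 / κ by positivity))
  rw [Filter.eventually_cofinite] at h1
  exact h1.subset fun x hx => not_lt.2 (h x hx)

variable {T : Finset 𝒴}

theorem isWeight_of_support (hT : ∀ x, x ∈ T ↔ x ∈ q.support) :
    IsWeight T fun x => (q x).toReal := by
  refine ⟨fun x _ => ENNReal.toReal_nonneg, ?_⟩
  rw [← ENNReal.toReal_sum fun x _ => q.apply_ne_top x, ← tsum_eq_sum (L := .unconditional 𝒴), q.tsum_coe,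
    ENNReal.toReal_one]
  intro x hx
  rw [hT, PMF.mem_support_iff, not_not] at hx
  exact hx

theorem pmfEntropy_eq_sum (hT : ∀ x, x ∈ T ↔ x ∈ q.support) :
    pmfEntropy q = ∑ x ∈ T, Real.negMulLog (q x).toReal := by
  refine tsum_eq_sum fun x hx => ?_
  rw [hT, PMF.mem_support_iff, not_not] at hx
  simp [hx]

theorem supportSize_eq_card (hT : ∀ x, x ∈ T ↔ x ∈ q.support) : supportSize q = T.card := by
  have : q.support = (T : Set 𝒴) := by ext x; rw [Finset.mem_coe, hT]
  rw [supportSize, this, Set.ncard_coe_finset]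

theorem toReal_pos_of_mem (hT : ∀ x, x ∈ T ↔ x ∈ q.support) : ∀ x ∈ T, 0 < (q x).toReal :=
  fun x hx => ENNReal.toReal_pos ((PMF.mem_support_iff _ _).1 ((hT x).1 hx)) (q.apply_ne_top x)

theorem card_le_of_le (hκ : 0 < κ) (h : ∀ x ∈ q.support, 1 / κ ≤ (q x).toReal)
    (hT : ∀ x, x ∈ T ↔ x ∈ q.support) : (T.card : ℝ) ≤ κ := by
  have h1 := Finset.card_nsmul_le_sum T (fun x => (q x).toReal) (1 / κ)
    fun x hx => h x ((hT x).1 hx)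
  rw [(isWeight_of_support hT).sum_eq_one, nsmul_eq_mul, mul_one_div, div_le_one hκ] at h1
  exact h1

theorem one_le_card_of_support (hT : ∀ x, x ∈ T ↔ x ∈ q.support) : 1 ≤ T.card := by
  obtain ⟨x, hx⟩ := q.support_nonempty
  exact Finset.card_pos.2 ⟨x, (hT x).2 hx⟩

end pmf

/-! ### The regret -/

section bandit

variable {K : ℕ} {𝒳 : Fin K → Type*} {Ω : Type*}

theorem playCount_le (I : ℕ → Ω → Fin K) (i : Fin K) (t : ℕ) (ω : Ω) : playCount I i t ω ≤ t :=
  (Finset.card_filter_le _ _).trans (by simp)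

theorem sum_playCount (I : ℕ → Ω → Fin K) (t : ℕ) (ω : Ω) : ∑ i, playCount I i t ω = t := by
  have := Finset.card_eq_sum_card_fiberwise (f := fun τ => I τ ω) (s := Finset.Icc 1 t)
    (t := Finset.univ) (fun _ _ => Finset.mem_coe.2 (Finset.mem_univ _))
  rw [Nat.card_Icc, Nat.add_sub_cancel] at this
  exact this.symm

-- Plays made while the count is below Γ never raise it above ⌈Γ⌉; all others are counted by the
-- sum.
open Classical in
theorem playCount_le_add_sum (I : ℕ → Ω → Fin K) (i : Fin K) (Γ : ℝ) (t : ℕ) (ω : Ω) :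
    playCount I i t ω ≤ ⌈Γ⌉₊ + ∑ m ∈ Finset.range t,
      if I (m + 1) ω = i ∧ Γ ≤ playCount I i m ω then 1 else 0 := by
  induction t with
  | zero => simp [playCount]
  | succ t ih =>
    rw [playCount_succ, Finset.sum_range_succ]
    by_cases h1 : I (t + 1) ω = i
    · by_cases h2 : Γ ≤ playCount I i t ω
      · simp only [h1, h2, and_self, if_true]; omega
      · have h3 : playCount I i t ω < ⌈Γ⌉₊ := Nat.lt_ceil.2 (not_le.1 h2)
        simp only [h1, if_true]; omega
    · simp only [h1, false_and, if_false]; omega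

/-- The deviation parameter `s` with `exp (-2 s²) = t ^ (-α)`. -/
noncomputable def devParam (α t : ℝ) : ℝ := √(α * Real.log t / 2)

theorem devParam_sq {α t : ℝ} (hα : 0 ≤ α) (ht : 1 ≤ t) :
    devParam α t ^ 2 = α * Real.log t / 2 :=
  Real.sq_sqrt (by have := Real.log_nonneg ht; positivity)

theorem exp_devParam {α t : ℝ} (hα : 0 ≤ α) (ht : 1 ≤ t) :
    Real.exp (-(2 * devParam α t ^ 2)) = t ^ (-α) := by
  rw [devParam_sq hα ht, Real.rpow_def_of_pos (by linarith)]
  congr 1; ring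

theorem upperWidth_lt_of_gammaSE_le {n : ℕ} {α κ S β Δ t : ℝ} (hn : 0 < n) (hα : 0 ≤ α)
    (ht : 1 ≤ t) (hκ : 1 ≤ κ) (hS1 : 1 ≤ S) (hSκ : S ≤ κ) (hβ : β ∈ Set.Ioo (0 : ℝ) 1)
    (hΔ : 0 < Δ) (h : gammaSE α β S κ Δ t ≤ n) : upperWidth n κ S (devParam α t) < Δ := by
  have h0 : 0 ≤ α * Real.log t / 2 := by have := Real.log_nonneg ht; positivity
  have h1 : √(devParam α t) = (α * Real.log t / 2) ^ (1 / 4 : ℝ) := by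
    rw [devParam, Real.sqrt_eq_rpow, Real.sqrt_eq_rpow, ← Real.rpow_mul h0]; norm_num
  have h2 : Real.log 2 + 2 * devParam α t ^ 2 = Real.log (2 * t ^ α) := by
    rw [devParam_sq hα ht, Real.log_mul (by norm_num) (by positivity), Real.log_rpow (by linarith)]
    ring
  rw [gammaSE, max_le_iff, ← h1, ← h2] at h
  exact upperWidth_lt hn hκ hS1 hSκ (Real.sqrt_nonneg _) hβ hΔ h.1 h.2

theorem gammaSE_pos {α κ S β Δ t : ℝ} (hα : 0 ≤ α) (ht : 1 ≤ t) (hκ : 1 ≤ κ) (hS1 : 1 ≤ S)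
    (hβ : β ∈ Set.Ioo (0 : ℝ) 1) (hΔ : 0 < Δ) : 0 < gammaSE α β S κ Δ t := by
  refine lt_max_of_lt_left (div_pos ?_ ?_)
  · have := Real.log_nonneg ht
    positivity
  · have h1 : 0 < β * Δ / 2 := by have := hβ.1; positivity
    have h2 := Real.add_one_lt_exp h1.ne'
    have h3 : 0 < Real.exp (β * Δ / 2) - 1 := by linarith
    exact lt_min h3 (Real.sqrt_pos.2 h3)

variable [∀ i, Countable (𝒳 i)] [∀ i, MeasurableSpace (𝒳 i)]
  [∀ i, MeasurableSingletonClass (𝒳 i)] {mΩ : MeasurableSpace Ω} {μ : Measure Ω}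
  {ℱ : Filtration ℕ mΩ} {p : ∀ i, PMF (𝒳 i)} {X : ∀ i, ℕ → Ω → 𝒳 i} {I : ℕ → Ω → Fin K}
  {κ : Fin K → ℝ} {α β : ℝ}

theorem measurable_playCount (hX : IsMemoryless μ ℱ p X)
    (hI : ∀ t, Measurable[ℱ t] (I (t + 1))) (i : Fin K) (t : ℕ) :
    Measurable fun ω => (playCount I i t ω : ℝ) := by
  have h : Measurable (playCount I i t) := by
    refine measurable_to_countable' fun n => ?_
    have h1 := ℱ.le t _ (measurableSet_samples hX hI i t fun l => l.length = n)
    simp only [length_samples] at h1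
    exact h1
  exact measurable_from_nat.comp h

variable [IsProbabilityMeasure μ]

/-- If the optimal arm `j` is not underestimated and the plug-in entropy of arm `i` is not too
large, then the maximality of the index of `i` contradicts its total width being below the gap. The
two failures are summed over the possible numbers of samples. -/
theorem measure_play_le (hα : 2 < α) (hβ : β ∈ Set.Ioo (0 : ℝ) 1) (hκ : ∀ i, 1 ≤ κ i)
    (hp : ∀ i, ∀ x ∈ (p i).support, 1 / κ i ≤ (p i x).toReal)
    (hX : IsMemoryless μ ℱ p X)
    (hI : IsUCBRun ℱ X (fun _ Y => plugInEntropy Y) (fun i Y δ => ucdSE (κ i) Y δ)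
      (fun t => (t : ℝ) ^ (-α)) I) {i j : Fin K}
    (hj : pmfEntropy (p j) = ⨆ k, pmfEntropy (p k)) (hi : 0 < gap p i) {m t : ℕ} (hmt : m < t) :
    μ.real {ω | I (m + 1) ω = i ∧
      gammaSE α β (supportSize (p i)) (κ i) (gap p i) t ≤ playCount I i m ω}
      ≤ (∑ n ∈ Finset.Icc 1 m, (lowerTail n + 1 / 2)) * ((m : ℝ) + 1) ^ (-α) := by
  have hκ0 : ∀ k, 0 < κ k := fun k => one_pos.trans_le (hκ k)
  have hfin : ∀ k, ∃ T : Finset (𝒳 k), ∀ x, x ∈ T ↔ x ∈ (p k).support := fun k =>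
    ⟨(finite_support_of_le (hκ0 k) (hp k)).toFinset, fun x => Set.Finite.mem_toFinset _⟩
  choose T hT using hfin
  have hw := fun k => isWeight_of_support (hT k)
  have hpos := fun k => toReal_pos_of_mem (hT k)
  have hpκ : ∀ k, ∀ x ∈ T k, 1 / κ k ≤ (p k x).toReal := fun k x hx => hp k x ((hT k x).1 hx)
  have hT0 : ∀ k, ∀ x, x ∉ T k → p k x = 0 := fun k x hx => by
    rw [hT, PMF.mem_support_iff, not_not] at hx; exact hx
  have hm1 : (1 : ℝ) ≤ (m : ℝ) + 1 := by linarith [(Nat.cast_nonneg m : (0 : ℝ) ≤ m)]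
  have ht1 : (m : ℝ) + 1 ≤ t := by exact_mod_cast hmt
  set s := devParam α ((m : ℝ) + 1) with hs
  have hs0 : 0 ≤ s := Real.sqrt_nonneg _
  have hδ : Real.exp (-(2 * s ^ 2)) = ((m : ℝ) + 1) ^ (-α) := exp_devParam (by linarith) hm1
  have hs2 : s ^ 2 = α * Real.log ((m : ℝ) + 1) / 2 := devParam_sq (by linarith) hm1
  have hst : s ≤ devParam α t := by
    refine Real.sqrt_le_sqrt ?_
    have := Real.log_le_log (by linarith) ht1
    gcongr
  have hS : supportSize (p i) = (T i).card := supportSize_eq_card (hT i)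
  have hS1 : (1 : ℝ) ≤ (T i).card := by exact_mod_cast one_le_card_of_support (hT i)
  have hSκ := card_le_of_le (hκ0 i) (hp i) (hT i)
  rw [hS]
  let L : List (𝒳 j) → Prop := fun l =>
    plugInEntropy l + ucdSE (κ j) l (Real.exp (-(2 * s ^ 2)))
      < ∑ x ∈ T j, Real.negMulLog (p j x).toReal
  -- Symbols outside the support count as a failure, so that otherwise the support estimate is at
  -- most the true size; for independent samples from `T i` this part is void.
  let U : ℕ → List (𝒳 i) → Prop := fun n l => (¬ ∀ x ∈ l, x ∈ T i) ∨
    ∑ x ∈ T i, Real.negMulLog (p i x).toReal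
      + plugInDiff n * √(s ^ 2 + Real.log 2 / 2) / √n < plugInEntropy l
  have hsub : {ω | I (m + 1) ω = i ∧
      gammaSE α β (T i).card (κ i) (gap p i) t ≤ playCount I i m ω} ⊆
      ⋃ n ∈ Finset.Icc 1 m,
        ({ω | (samples X I j m ω).length = n ∧ L (samples X I j m ω)} ∪
          {ω | (samples X I i m ω).length = n ∧ U n (samples X I i m ω)}) := by
    rintro ω ⟨hω1, hω2⟩
    have hlen := fun k => length_samples X I k m ω
    have hΓ := gammaSE_pos (κ := κ i) (S := (T i).card) (by linarith : 0 ≤ α) (hm1.trans ht1)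
      (hκ i) hS1 hβ hi
    have hni : 0 < playCount I i m ω := by
      have : (0 : ℝ) < playCount I i m ω := hΓ.trans_le hω2
      exact_mod_cast this
    have hmax := hI.maximizes m ω j
    rw [hω1] at hmax
    simp only [ucbIndex] at hmax
    rw [if_neg (show ¬ (samples X I i m ω).length = 0 by rw [hlen]; omega)] at hmax
    have hδ' : (((m + 1 : ℕ) : ℝ)) ^ (-α) = Real.exp (-(2 * s ^ 2)) := by
      rw [hδ]; push_cast; rfl
    rw [hδ'] at hmax
    rcases Nat.eq_zero_or_pos (playCount I j m ω) with hj0 | hj0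
    · rw [if_pos (show (samples X I j m ω).length = 0 by rw [hlen]; exact hj0), top_le_iff] at hmax
      exact absurd hmax (EReal.coe_ne_top _)
    rw [if_neg (show ¬ (samples X I j m ω).length = 0 by rw [hlen]; omega), EReal.coe_le_coe_iff] at hmax
    by_contra hcon
    simp only [Set.mem_iUnion, not_exists] at hcon
    have hL : ¬ L (samples X I j m ω) := fun h => hcon _
      (Finset.mem_Icc.2 ⟨hj0, playCount_le I j m ω⟩) (Or.inl ⟨hlen j, h⟩)
    have hU : ¬ U (playCount I i m ω) (samples X I i m ω) := fun h => hcon _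
      (Finset.mem_Icc.2 ⟨hni, playCount_le I i m ω⟩) (Or.inr ⟨hlen i, h⟩)
    simp only [L, not_lt] at hL
    simp only [U, not_or, not_not, not_lt] at hU
    obtain ⟨hU1, hU2⟩ := hU
    rw [ucdSE_exp (hlen i) hni _ hs0] at hmax
    have hwid := upperWidth_lt_of_gammaSE_le hni (by linarith) (hm1.trans ht1) (hκ i) hS1 hSκ hβ hi
      hω2
    have hSpos : (1 : ℝ) ≤ supportEstimate (samples X I i m ω) := by
      exact_mod_cast supportEstimate_pos (by rw [hlen]; exact hni)
    have hSle : (supportEstimate (samples X I i m ω) : ℝ) ≤ (T i).card := by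
      exact_mod_cast supportEstimate_le_card hU1
    have hmono := upperWidth_mono hni (hκ0 i) hSpos hSle hs0 hst
    have hwid' := hmono.trans_lt hwid
    rw [← pmfEntropy_eq_sum (hT i)] at hU2
    rw [← pmfEntropy_eq_sum (hT j), hj] at hL
    rw [gap] at hwid'
    unfold upperWidth at hwid'
    linarith
  have hprob : ∀ n ∈ Finset.Icc 1 m,
      μ.real ({ω | (samples X I j m ω).length = n ∧ L (samples X I j m ω)} ∪
          {ω | (samples X I i m ω).length = n ∧ U n (samples X I i m ω)})
        ≤ (lowerTail n + 1 / 2) * ((m : ℝ) + 1) ^ (-α) := by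
    intro n hn
    obtain ⟨hn1, hnm⟩ := Finset.mem_Icc.1 hn
    -- This uses α > 2 together with n ≤ m, and is the condition under which the lower tail was
    -- bounded.
    have hns : Real.log ((n : ℝ) + 1) ≤ s ^ 2 := by
      rw [hs2]
      have h1 : Real.log ((n : ℝ) + 1) ≤ Real.log ((m : ℝ) + 1) :=
        Real.log_le_log (by positivity) (by gcongr)
      have := Real.log_nonneg hm1
      nlinarith
    have hreal : ∀ {A : Set Ω} {x : ℝ}, 0 ≤ x → μ A ≤ ENNReal.ofReal x → μ.real A ≤ x :=
      fun {A x} hx h => ENNReal.toReal_le_of_le_ofReal hx h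
    have h1 := hreal (iidProb_nonneg (hw j) n L)
      (measure_samples_le hX hI.measurable_play j m (hT0 j) (hw j) n L)
    have h2 := hreal (iidProb_nonneg (hw i) n (U n))
      (measure_samples_le hX hI.measurable_play i m (hT0 i) (hw i) n (U n))
    have h3 := iidProb_lt_le (hw j) (hpos j) (hκ0 j) (hpκ j) hn1 hs0 hns
    have h4 : iidProb (T i) (fun x => (p i x).toReal) n (U n)
        ≤ 1 / 2 * Real.exp (-(2 * s ^ 2)) := by
      refine (iidProb_mono (hw i) fun l _ hl hU => ?_).trans
        (iidProb_gt_le (hw i) (hpos i) hn1 s)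
      exact hU.resolve_left (not_not.2 hl)
    have h5 := measureReal_union_le (μ := μ)
      {ω | (samples X I j m ω).length = n ∧ L (samples X I j m ω)}
      {ω | (samples X I i m ω).length = n ∧ U n (samples X I i m ω)}
    rw [← hδ]
    linarith
  calc _ ≤ _ := measureReal_mono hsub (measure_ne_top _ _)
    _ ≤ _ := measureReal_biUnion_finset_le _ _
    _ ≤ _ := Finset.sum_le_sum hprob
    _ = _ := by rw [Finset.sum_mul]

theorem integrable_playCount (hX : IsMemoryless μ ℱ p X)
    (hI : ∀ t, Measurable[ℱ t] (I (t + 1))) (i : Fin K) (t : ℕ) :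
    Integrable (fun ω => (playCount I i t ω : ℝ)) μ := by
  refine Integrable.of_bound (measurable_playCount hX hI i t).aestronglyMeasurable (t : ℝ)
    (Filter.Eventually.of_forall fun ω => ?_)
  rw [Real.norm_of_nonneg (by positivity)]
  exact_mod_cast playCount_le I i t ω

theorem pseudoRegret_eq_sum (hX : IsMemoryless μ ℱ p X)
    (hI : ∀ t, Measurable[ℱ t] (I (t + 1))) (t : ℕ) :
    pseudoRegret μ p I t = ∑ i, (∫ ω, (playCount I i t ω : ℝ) ∂μ) * gap p i := by
  have h1 : ∑ i, ∫ ω, (playCount I i t ω : ℝ) ∂μ = t := by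
    rw [← integral_finsetSum _ fun i _ => integrable_playCount hX hI i t]
    have : ∀ ω, ∑ i, (playCount I i t ω : ℝ) = t := fun ω => by
      exact_mod_cast sum_playCount I t ω
    simp [this]
  simp only [gap, mul_sub, Finset.sum_sub_distrib, ← Finset.sum_mul, h1, pseudoRegret]

theorem integral_playCount_le (hα : 2 < α) (hβ : β ∈ Set.Ioo (0 : ℝ) 1) (hκ : ∀ i, 1 ≤ κ i)
    (hp : ∀ i, ∀ x ∈ (p i).support, 1 / κ i ≤ (p i x).toReal)
    (hX : IsMemoryless μ ℱ p X)
    (hI : IsUCBRun ℱ X (fun _ Y => plugInEntropy Y) (fun i Y δ => ucdSE (κ i) Y δ)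
      (fun t => (t : ℝ) ^ (-α)) I) {i j : Fin K}
    (hj : pmfEntropy (p j) = ⨆ k, pmfEntropy (p k)) (hi : 0 < gap p i) (t : ℕ) (ht : 1 ≤ t) :
    ∫ ω, (playCount I i t ω : ℝ) ∂μ
      ≤ gammaSE α β (supportSize (p i)) (κ i) (gap p i) t + 4 * (α - 1) / (α - 2) := by
  classical
  set Γ := gammaSE α β (supportSize (p i)) (κ i) (gap p i) t with hΓ
  have hΓ0 : 0 ≤ Γ := by
    obtain ⟨T, hT⟩ : ∃ T : Finset (𝒳 i), ∀ x, x ∈ T ↔ x ∈ (p i).support :=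
      ⟨(finite_support_of_le (one_pos.trans_le (hκ i)) (hp i)).toFinset,
        fun x => Set.Finite.mem_toFinset _⟩
    refine (gammaSE_pos (by linarith) (by exact_mod_cast ht) (hκ i) ?_ hβ hi).le
    rw [supportSize_eq_card hT]
    exact_mod_cast one_le_card_of_support hT
  let Ev : ℕ → Set Ω := fun m => {ω | I (m + 1) ω = i ∧ Γ ≤ playCount I i m ω}
  have hEv : ∀ m, MeasurableSet (Ev m) := fun m =>
    (ℱ.le m _ (hI.measurable_play m (measurableSet_singleton i))).inter
      (measurableSet_le measurable_const (measurable_playCount hX hI.measurable_play i m))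
  have hint : ∀ m, Integrable ((Ev m).indicator fun _ => (1 : ℝ)) μ := fun m =>
    (integrable_const 1).indicator (hEv m)
  have h1 : ∀ ω, (playCount I i t ω : ℝ)
      ≤ (Γ + 1) + ∑ m ∈ Finset.range t, (Ev m).indicator (fun _ => (1 : ℝ)) ω := by
    intro ω
    have h2 : (playCount I i t ω : ℝ) ≤ (⌈Γ⌉₊ : ℝ) + ∑ m ∈ Finset.range t,
        if I (m + 1) ω = i ∧ Γ ≤ playCount I i m ω then (1 : ℝ) else 0 := by
      exact_mod_cast playCount_le_add_sum I i Γ t ω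
    refine h2.trans (add_le_add (Nat.ceil_lt_add_one hΓ0).le (le_of_eq ?_))
    refine Finset.sum_congr rfl fun m _ => ?_
    rw [Set.indicator_apply]
    rfl
  have h2 : ∫ ω, (playCount I i t ω : ℝ) ∂μ ≤ ∫ ω, ((Γ + 1) + ∑ m ∈ Finset.range t,
      (Ev m).indicator (fun _ => (1 : ℝ)) ω) ∂μ := integral_mono (integrable_playCount (μ := μ) hX hI.measurable_play i t)
    ((integrable_const (Γ + 1)).add (integrable_finsetSum (Finset.range t) fun m _ => hint m)) h1
  have h3 : ∫ ω, ((Γ + 1) + ∑ m ∈ Finset.range t,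
      (Ev m).indicator (fun _ => (1 : ℝ)) ω) ∂μ = (Γ + 1) + ∑ m ∈ Finset.range t, μ.real (Ev m) := by
    rw [integral_add (integrable_const _) (integrable_finsetSum _ fun m _ => hint m),
      integral_finsetSum _ fun m _ => hint m]
    simp [integral_indicator_const _ (hEv _)]
  let g : ℕ → ℝ := fun m =>
    (∑ n ∈ Finset.Icc 1 m, (lowerTail n + 1 / 2)) * ((m : ℝ) + 1) ^ (-α)
  have h4 : ∑ m ∈ Finset.range t, μ.real (Ev m) ≤ ∑ m ∈ Finset.range t, g m :=
    Finset.sum_le_sum fun m hm =>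
      measure_play_le hα hβ hκ hp hX hI hj hi (Finset.mem_range.1 hm)
  -- The term m = 0 vanishes: before round 1 there are no samples, so the inner sum is empty.
  have h5 : ∀ t, ∑ m ∈ Finset.range (t + 1), g m = ∑ m ∈ Finset.Icc 1 t, g m := by
    intro t
    induction t with
    | zero => simp [g]
    | succ t ih => rw [Finset.sum_range_succ, ih, Finset.sum_Icc_succ_top (by omega)]
  obtain ⟨t', rfl⟩ : ∃ t', t = t' + 1 := ⟨t - 1, by omega⟩
  have h6 := sum_failure_le hα t'
  rw [h5] at h4
  have h7 := h2.trans (le_of_eq h3)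
  simp only [g] at h4
  linarith

end bandit

end EntropyBandit

theorem theorem14 {K : ℕ} (hK : 2 ≤ K) {𝒳 : Fin K → Type*} [∀ i, Countable (𝒳 i)]
    [∀ i, MeasurableSpace (𝒳 i)] [∀ i, MeasurableSingletonClass (𝒳 i)]
    {Ω : Type*} {mΩ : MeasurableSpace Ω} (μ : Measure Ω) [IsProbabilityMeasure μ]
    (ℱ : Filtration ℕ mΩ) (p : ∀ i, PMF (𝒳 i)) (X : ∀ i, ℕ → Ω → 𝒳 i) (I : ℕ → Ω → Fin K)
    (κ : Fin K → ℝ) (α β : ℝ) (hα : 2 < α) (hβ : β ∈ Set.Ioo (0 : ℝ) 1)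
    (hκ : ∀ i, 1 ≤ κ i)
    (hp : ∀ i, ∀ x ∈ (p i).support, 1 / κ i ≤ (p i x).toReal)
    (hX : EntropyBandit.IsMemoryless μ ℱ p X)
    (hI : EntropyBandit.IsUCBRun ℱ X (fun _ Y => EntropyBandit.plugInEntropy Y)
      (fun i Y δ => EntropyBandit.ucdSE (κ i) Y δ) (fun t => (t : ℝ) ^ (-α)) I)
    (t : ℕ) (ht : 1 ≤ t) :
    EntropyBandit.pseudoRegret μ p I t ≤
      ∑ i with 0 < EntropyBandit.gap p i,
        (EntropyBandit.gammaSE α β (EntropyBandit.supportSize (p i)) (κ i)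
            (EntropyBandit.gap p i) t * EntropyBandit.gap p i +
          4 * (α - 1) / (α - 2) * EntropyBandit.gap p i) := by
  have : Nonempty (Fin K) := ⟨⟨0, by omega⟩⟩
  obtain ⟨j, hj⟩ := exists_eq_ciSup_of_finite (f := fun k => EntropyBandit.pmfEntropy (p k))
  rw [EntropyBandit.pseudoRegret_eq_sum hX hI.measurable_play, Finset.sum_filter]
  refine Finset.sum_le_sum fun i _ => ?_
  split_ifs with hi
  · rw [← add_mul]
    exact mul_le_mul_of_nonneg_right
      (EntropyBandit.integral_playCount_le hα hβ hκ hp hX hI hj hi t ht) hi.le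
  · have hint : 0 ≤ ∫ ω, (EntropyBandit.playCount I i t ω : ℝ) ∂μ :=
      integral_nonneg fun ω => by positivity
    exact mul_nonpos_of_nonneg_of_nonpos hint (not_lt.1 hi)
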